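/- Let $n\ge 1$. A Calderón–Zygmund kernel is a function $K(x,y)$ on $\mathbb R^n\times\mathbb R^n$ with values in $\mathbb C$ for which there are constants $C<\infty$ and $0<\delta\le 1$ such that $|K(x,y)|\le C|x-y|^{-n}$ for $x\ne y$ and $|K(x,y)-K(x',y)|+|K(y,x)-K(y,x')|\le C|x-x'|^{\delta}/|x-y|^{n+\delta}$ whenever $|x-x'|<|x-y|/2$. A Calderón–Zygmund operator is a linear operator $T$, bounded on $L^2(\mathbb R^n)$, with $Tf(x)=\int K(x,y)f(y)\,dy$ for $x\notin\operatorname{supp} f$ for some such $K$ (here $Tf$ is a function with a definite value at each point, and linearity and the representation hold pointwise). For a family $\Phi=\{\phi_\alpha\}_{\alpha\in I}$ of real-valued measurable functions on $\mathbb R^n$, with $I$ an arbitrary index set, put $$T^\Phi f(x)=\sup_{\alpha\in I}\bigl|T(e^{2\pi i\phi_\alpha}f)(x)\bigr| ,\qquad f\in L^2(\mathbb R^n).$$ Assume that $T^\Phi$ satisfies the weak-type inequalities: for some $r_0>1$ and some function $\psi$ with finite values, $T^\Phi f$ is measurable and $\|T^\Phi f\|_{L^{r,\infty}}\le\psi(r)\|f\|_{L^r}$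 for all $1<r\le r_0$ and all $f\in L^2\cap L^r$. A Young function is a continuous, convex, increasing function $A:[0,\infty)\to[0,\infty)$ with $A(0)=0$ and $A(t)\to\infty$ as $t\to\infty$; it is doubling if $A(2t)\le CA(t)$ for all $t>0$ and some constant $C$. Write $\bar A(t)=\sup_{s>0}\{st-A(s)\}\in[0,\infty]$; write $\bar A\in B_q$ if $\int_c^\infty \frac{\bar A(t)}{t^q}\frac{dt}{t}<\infty$ for some $c>0$; and for a cube $Q$ (with sides parallel to the axes) write $\|f\|_{A,Q}=\inf\{\lambda>0:\frac1{|Q|}\int_Q A(|f|/\lambda)\le1\}$. **Theorem.** Let $1<p<\infty$ with $p'=p/(p-1)$, and let $A,B$ be doubling Young functions such that $\bar A\in B_{p'}$ and $\bar B\in B_{p/r}$ for some $1<r<\min\{r_0,p\}$. Let $u,v$ be positive locally integrable functions on $\mathbb R^n$ such that $$\sup_{Q}\|u^{1/p}\|_{A,Q}\,\|v^{-r/p}\|_{B,Q}^{1/r}<\infty ,$$ the supremum being over all cubes $Q\subset\mathbb R^n$. Then $T^\Phi:L^p(v)\to L^p(u)$; that is, there is a constant $C<\infty$, independent of $f$,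 such that $$\int_{\mathbb R^n}|T^\Phi f(x)|^p\,u(x)\,dx\le C\int_{\mathbb R^n}|f(x)|^p\,v(x)\,dx$$ for all $f\in L^2(\mathbb R^n)$, and $T^\Phi$ extends from $L^2\cap L^p(v)$ to a map $S:L^p(v)\to L^p(u)$ with nonnegative values that satisfies the same inequality for all $f\in L^p(v)$, and $$\int_{\mathbb R^n}|Sf-Sg|^p\,u\le C\int_{\mathbb R^n}|f-g|^p\,v\qquad (f,g\in L^p(v)).$$ -/

import Mathlib

open MeasureTheory
open scoped NNReal ENNReal

noncomputable section

namespace MaxModCZ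

/-- Euclidean space `ℝⁿ`, with its Euclidean norm and Lebesgue measure. -/
abbrev Eu (n : ℕ) : Type := EuclideanSpace ℝ (Fin n)

/-! ### Young functions, Luxemburg norms, the `B_q` condition -/

/-- `A : [0,∞) → [0,∞)` is a Young function. -/
structure IsYoung (A : ℝ≥0 → ℝ≥0) : Prop where
  continuous : Continuous A
  convex : ConvexOn ℝ≥0 Set.univ A
  monotone : Monotone A
  map_zero : A 0 = 0
  tendsto_atTop : Filter.Tendsto A Filter.atTop Filter.atTop

/-- The doubling condition `A(2t) ≤ C A(t)` for `t > 0`. -/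
def IsDoubling (A : ℝ≥0 → ℝ≥0) : Prop :=
  ∃ C : ℝ≥0, 0 < C ∧ ∀ t : ℝ≥0, 0 < t → A (2 * t) ≤ C * A t

/-- The complementary function `Ā(t) = sup_{s > 0} (s t - A(s))`, with values in `[0,∞]`.
For `A 0 = 0` and `A` continuous the supremum is nonnegative, so that cutting the
differences off at `0` does not change it. -/
def complementary (A : ℝ≥0 → ℝ≥0) (t : ℝ≥0) : ℝ≥0∞ :=
  ⨆ (s : ℝ≥0) (_ : 0 < s), ENNReal.ofReal ((s : ℝ) * (t : ℝ) - (A s : ℝ))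

/-- The condition `D ∈ B_q`: `∫_c^∞ D(t) / t^q dt/t < ∞` for some `c > 0`.
A monotone `D` that takes the value `∞` does not satisfy it. -/
def SatisfiesB (q : ℝ) (D : ℝ≥0 → ℝ≥0∞) : Prop :=
  ∃ c : ℝ, 0 < c ∧
    ∫⁻ t in Set.Ioi c, D t.toNNReal / ENNReal.ofReal (t ^ q) / ENNReal.ofReal t < ∞

/-- The cube `∏ᵢ [aᵢ, aᵢ + ℓ)`. -/
def cube {n : ℕ} (a : Eu n) (ℓ : ℝ) : Set (Eu n) :=
  {x | ∀ i, x i ∈ Set.Ico (a i) (a i + ℓ)}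

/-- The Luxemburg norm `‖f‖_{A,Q} = inf {l > 0 : |Q|⁻¹ ∫_Q A(|f|/l) ≤ 1}`
(equal to `∞` when no such `l` exists). -/
def luxemburg {n : ℕ} (A : ℝ≥0 → ℝ≥0) (Q : Set (Eu n)) (f : Eu n → ℝ) : ℝ≥0∞ :=
  ⨅ (l : ℝ≥0) (_ : 0 < l)
    (_ : (volume Q)⁻¹ * ∫⁻ y in Q, (A (‖f y‖₊ / l) : ℝ≥0∞) ≤ 1), (l : ℝ≥0∞)

/-- A positive weight: a locally integrable function that is positive (almost everywhere). -/
structure IsPosWeight {n : ℕ} (w : Eu n → ℝ) : Prop where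
  locallyIntegrable : LocallyIntegrable w volume
  pos : ∀ᵐ x, 0 < w x

/-- The two-weight bump quantity
`[u,v]_{A,B} = sup_Q ‖u^{1/p}‖_{A,Q} ‖v^{-r/p}‖_{B,Q}^{1/r}`, over all cubes `Q`. -/
def bump {n : ℕ} (p r : ℝ) (A B : ℝ≥0 → ℝ≥0) (u v : Eu n → ℝ) : ℝ≥0∞ :=
  ⨆ (a : Eu n) (ℓ : ℝ) (_ : 0 < ℓ),
    luxemburg A (cube a ℓ) (fun x => u x ^ (1 / p)) *
      luxemburg B (cube a ℓ) (fun x => v x ^ (-r / p)) ^ (1 / r)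

/-! ### Calderón–Zygmund operators and their maximal modulations -/

/-- The size and regularity conditions on a Calderón–Zygmund kernel. -/
def IsCZKernel {n : ℕ} (K : Eu n → Eu n → ℂ) : Prop :=
  ∃ C δ : ℝ, 0 < δ ∧ δ ≤ 1 ∧
    (∀ x y, x ≠ y → ‖K x y‖ ≤ C / ‖x - y‖ ^ n) ∧
    (∀ x x' y, ‖x - x'‖ < ‖x - y‖ / 2 →
      ‖K x y - K x' y‖ + ‖K y x - K y x'‖ ≤
        C * ‖x - x'‖ ^ δ / ‖x - y‖ ^ ((n : ℝ) + δ))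

/-- `T` is a Calderón–Zygmund operator: linear and bounded on `L²(ℝⁿ)` and represented by a
Calderón–Zygmund kernel off the support of the function. The operator sends functions to
functions with a definite value at each point, and linearity and the representation hold
pointwise, so that suprema over uncountable families of modulations make sense.
What `T` does outside `L²` is irrelevant. -/
structure IsCZOperator {n : ℕ} (T : (Eu n → ℂ) → Eu n → ℂ) : Prop where
  map_add : ∀ f g, MemLp f 2 volume → MemLp g 2 volume → T (f + g) = T f + T g
  map_smul : ∀ (c : ℂ) (f), MemLp f 2 volume → T (c • f) = c • T f
  bounded : ∃ C : ℝ≥0, ∀ f, MemLp f 2 volume →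
    MemLp (T f) 2 volume ∧ eLpNorm (T f) 2 volume ≤ C * eLpNorm f 2 volume
  kernel : ∃ K : Eu n → Eu n → ℂ, IsCZKernel K ∧
    ∀ f, MemLp f 2 volume → ∀ x, x ∉ tsupport f → T f x = ∫ y, K x y * f y

/-- The modulation `(M^φ f)(x) = e^{2πi φ(x)} f(x)`. -/
def modulate {n : ℕ} (φ : Eu n → ℝ) (f : Eu n → ℂ) : Eu n → ℂ :=
  fun x => Complex.exp (2 * Real.pi * Complex.I * (φ x : ℂ)) * f x

/-- The maximally modulated operator `T^Φ f(x) = sup_α |T(M^{φ_α} f)(x)|`. -/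
def maxMod {n : ℕ} {ι : Type*} (T : (Eu n → ℂ) → Eu n → ℂ) (φ : ι → Eu n → ℝ)
    (f : Eu n → ℂ) (x : Eu n) : ℝ≥0∞ :=
  ⨆ α, ‖T (modulate (φ α) f) x‖ₑ

/-- The quasinorm `‖g‖_{L^{r,∞}} = sup_{t > 0} t |{g > t}|^{1/r}` of `g ≥ 0`. -/
def weakNorm {n : ℕ} (r : ℝ) (g : Eu n → ℝ≥0∞) : ℝ≥0∞ :=
  ⨆ t : ℝ≥0, (t : ℝ≥0∞) * volume {x | (t : ℝ≥0∞) < g x} ^ (1 / r)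

/-- The a priori weak-type inequalities `‖T^Φ f‖_{L^{r,∞}} ≤ ψ(r) ‖f‖_r` for `1 < r ≤ r₀`,
for `f` in `L² ∩ L^r` (where `T^Φ f` is defined). -/
def WeakTypeBounds {n : ℕ} {ι : Type*} (T : (Eu n → ℂ) → Eu n → ℂ) (φ : ι → Eu n → ℝ)
    (r₀ : ℝ) (ψ : ℝ → ℝ≥0) : Prop :=
  ∀ r : ℝ, 1 < r → r ≤ r₀ → ∀ f : Eu n → ℂ,
    MemLp f 2 volume → MemLp f (ENNReal.ofReal r) volume →
      AEMeasurable (maxMod T φ f) volume ∧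
        weakNorm r (maxMod T φ f) ≤ ψ r * eLpNorm f (ENNReal.ofReal r) volume

/-- `f ∈ L^p(v)`. -/
def MemWeightedLp {n : ℕ} (p : ℝ) (v : Eu n → ℝ) (f : Eu n → ℂ) : Prop :=
  AEStronglyMeasurable f volume ∧ ∫⁻ x, ‖f x‖ₑ ^ p * ENNReal.ofReal (v x) < ∞

end MaxModCZ

end

/-! Fix the exponent `r`. In all but a small part of a dyadic cube `Q`, the weak-type inequality at
`r` bounds `T^Φ (f 1_{3Q})` by the `r`-average of `f` over `3Q`; on the stopping cubes covering the
rest, the regularity of the kernel replaces `3Q` by the triple of the stopping cube at the cost of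
a comparable average. Iterating, `T^Φ f` is dominated on a cube by a sparse sum of `r`-averages.

Pair the sparse sum with a test function. The generalized Hölder inequality splits each average,
the bump condition absorbs the norms of the weights, and sparseness leaves the product of the Orlicz
maximal functions of `Ā` and `B̄`, which are bounded on the relevant Lebesgue spaces by the `B_q`
conditions. Exhausting `ℝⁿ` by cubes gives the inequality on `L² ∩ L^p(v)`, and the sublinear
estimate `|T^Φ f - T^Φ g| ≤ T^Φ (f - g)` extends it, with the Lipschitz bound, to `L^p(v)`. -/

open scoped ProbabilityTheory

noncomputable section

namespace MaxModCZ

/-! ### Dyadic cubes -/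

section DyadicGrid

variable {n : ℕ}

lemma measurableSet_cube (a : Eu n) (ℓ : ℝ) : MeasurableSet (cube a ℓ) := by
  have : cube a ℓ = ⋂ i, (fun x : Eu n => x i) ⁻¹' Set.Ico (a i) (a i + ℓ) := by
    ext x; simp [cube]
  rw [this]
  exact MeasurableSet.iInter fun i => measurableSet_Ico.preimage (by fun_prop)

lemma volume_cube (a : Eu n) (ℓ : ℝ) : volume (cube a ℓ) = ENNReal.ofReal ℓ ^ n := by
  have h : cube a ℓ = (MeasurableEquiv.toLp 2 (Fin n → ℝ)).symm ⁻¹'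
      (Set.univ.pi fun i => Set.Ico (a i) (a i + ℓ)) := by
    ext x; simp [cube]
  rw [h, (EuclideanSpace.volume_preserving_symm_measurableEquiv_toLp (Fin n)).measure_preimage
    (MeasurableSet.univ_pi fun i => measurableSet_Ico).nullMeasurableSet, Real.volume_pi_Ico]
  simp

lemma volume_cube_mul (a b : Eu n) {c : ℝ} (hc : 0 ≤ c) (ℓ : ℝ) :
    volume (cube a (c * ℓ)) = ENNReal.ofReal c ^ n * volume (cube b ℓ) := by
  rw [volume_cube, volume_cube, ENNReal.ofReal_mul hc, mul_pow]

lemma volume_cube_ne_zero (a : Eu n) {ℓ : ℝ} (hℓ : 0 < ℓ) : volume (cube a ℓ) ≠ 0 := by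
  rw [volume_cube]
  exact (ENNReal.pow_pos (ENNReal.ofReal_pos.2 hℓ) n).ne'

lemma volume_cube_ne_top (a : Eu n) (ℓ : ℝ) : volume (cube a ℓ) ≠ ∞ := by
  rw [volume_cube]
  exact ENNReal.pow_ne_top ENNReal.ofReal_ne_top

lemma corner_le_of_cube_subset {a b : Eu n} {ℓ m : ℝ} (hℓ : 0 < ℓ) (h : cube a ℓ ⊆ cube b m)
    (i : Fin n) : b i ≤ a i ∧ a i + ℓ ≤ b i + m := by
  have diagonal_mem : ∀ t, 0 ≤ t → t < ℓ → b i ≤ a i + t ∧ a i + t < b i + m := by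
    intro t h0 ht
    have : (WithLp.toLp 2 fun i => a i + t : Eu n) ∈ cube b m := h fun i => by
      constructor <;> simp <;> linarith
    simpa using this i
  refine ⟨by simpa using (diagonal_mem 0 le_rfl hℓ).1, le_of_forall_lt fun c hc => ?_⟩
  rcases le_or_gt 0 (c - a i) with h0 | h0
  · linarith [(diagonal_mem (c - a i) h0 (by linarith)).2]
  · linarith [(diagonal_mem 0 le_rfl hℓ).2]

/-- The cube concentric with `cube a ℓ` and three times as large. -/
def tripleCube (a : Eu n) (ℓ : ℝ) : Set (Eu n) := cube (WithLp.toLp 2 fun i => a i - ℓ) (3 * ℓ)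

lemma mem_tripleCube {a : Eu n} {ℓ : ℝ} {x : Eu n} :
    x ∈ tripleCube a ℓ ↔ ∀ i, a i - ℓ ≤ x i ∧ x i < a i + 2 * ℓ := by
  simp only [tripleCube, cube, Set.mem_ofPred_eq, Set.mem_Ico]
  refine forall_congr' fun i => ?_
  constructor <;> rintro ⟨h1, h2⟩ <;> constructor <;> linarith

lemma measurableSet_tripleCube (a : Eu n) (ℓ : ℝ) : MeasurableSet (tripleCube a ℓ) :=
  measurableSet_cube _ _

lemma cube_subset_tripleCube {a : Eu n} {ℓ : ℝ} (hℓ : 0 < ℓ) : cube a ℓ ⊆ tripleCube a ℓ := by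
  intro x hx
  rw [mem_tripleCube]
  intro i
  constructor <;> linarith [(hx i).1, (hx i).2]

/-- Indices of the cubes of a dyadic grid: the pair `(k, m)` stands for the cube of generation `k`
at the integer position `m`. -/
abbrev DyadicIndex (n : ℕ) : Type := ℕ × (Fin n → ℤ)

/-- The side length of a dyadic cube in the grid whose cubes of generation `0` have side `ℓ`. -/
def dyadicSide (ℓ : ℝ) (Q : DyadicIndex n) : ℝ := ℓ / 2 ^ Q.1

/-- The lower corner of a dyadic cube in the grid generated by `cube a ℓ`. -/
def dyadicCorner (a : Eu n) (ℓ : ℝ) (Q : DyadicIndex n) : Eu n :=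
  WithLp.toLp 2 fun i => a i + Q.2 i * dyadicSide ℓ Q

/-- The dyadic cube of index `Q` in the grid generated by `cube a ℓ`, which has index `(0, 0)`. -/
def dyadicCube (a : Eu n) (ℓ : ℝ) (Q : DyadicIndex n) : Set (Eu n) :=
  cube (dyadicCorner a ℓ Q) (dyadicSide ℓ Q)

/-- The triple of the dyadic cube of index `Q`. -/
def dyadicTriple (a : Eu n) (ℓ : ℝ) (Q : DyadicIndex n) : Set (Eu n) :=
  tripleCube (dyadicCorner a ℓ Q) (dyadicSide ℓ Q)

/-- The position of the dyadic cube of generation `k` that contains `x`. -/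
def dyadicPos (a : Eu n) (ℓ : ℝ) (k : ℕ) (x : Eu n) : Fin n → ℤ :=
  fun i => ⌊(x i - a i) / (ℓ / 2 ^ k)⌋

variable {a : Eu n} {ℓ : ℝ}

lemma dyadicSide_pos (hℓ : 0 < ℓ) (Q : DyadicIndex n) : 0 < dyadicSide ℓ Q := by
  unfold dyadicSide; positivity

lemma dyadicSide_le (hℓ : 0 < ℓ) (Q : DyadicIndex n) : dyadicSide ℓ Q ≤ ℓ :=
  div_le_self hℓ.le (one_le_pow₀ (by norm_num))

lemma dyadicCube_zero (a : Eu n) (ℓ : ℝ) : dyadicCube a ℓ (0, 0) = cube a ℓ := by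
  simp [dyadicCube, dyadicCorner, dyadicSide]

lemma dyadicTriple_zero (a : Eu n) (ℓ : ℝ) : dyadicTriple a ℓ (0, 0) = tripleCube a ℓ := by
  simp [dyadicTriple, dyadicCorner, dyadicSide]

lemma measurableSet_dyadicCube (a : Eu n) (ℓ : ℝ) (Q : DyadicIndex n) :
    MeasurableSet (dyadicCube a ℓ Q) :=
  measurableSet_cube _ _

lemma measurableSet_dyadicTriple (a : Eu n) (ℓ : ℝ) (Q : DyadicIndex n) :
    MeasurableSet (dyadicTriple a ℓ Q) :=
  measurableSet_cube _ _

lemma volume_dyadicCube_ne_zero (hℓ : 0 < ℓ) (Q : DyadicIndex n) : volume (dyadicCube a ℓ Q) ≠ 0 :=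
  volume_cube_ne_zero _ (dyadicSide_pos hℓ Q)

lemma volume_dyadicCube_ne_top (Q : DyadicIndex n) : volume (dyadicCube a ℓ Q) ≠ ∞ :=
  volume_cube_ne_top _ _

lemma volume_dyadicTriple_ne_zero (hℓ : 0 < ℓ) (Q : DyadicIndex n) :
    volume (dyadicTriple a ℓ Q) ≠ 0 :=
  volume_cube_ne_zero _ (mul_pos three_pos (dyadicSide_pos hℓ Q))

lemma volume_dyadicTriple_ne_top (Q : DyadicIndex n) : volume (dyadicTriple a ℓ Q) ≠ ∞ :=
  volume_cube_ne_top _ _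

lemma volume_dyadicTriple (Q : DyadicIndex n) :
    volume (dyadicTriple a ℓ Q) = 3 ^ n * volume (dyadicCube a ℓ Q) := by
  simpa [dyadicCube, dyadicTriple, tripleCube] using
    volume_cube_mul _ (dyadicCorner a ℓ Q) (zero_le_three (α := ℝ)) (dyadicSide ℓ Q)

lemma volume_dyadicCube_of_succ {Q R : DyadicIndex n} (h : R.1 = Q.1 + 1) :
    volume (dyadicCube a ℓ Q) = 2 ^ n * volume (dyadicCube a ℓ R) := by
  have : dyadicSide ℓ Q = 2 * dyadicSide ℓ R := by
    simp only [dyadicSide, h, pow_succ]; field_simp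
  rw [dyadicCube, this]
  simpa [dyadicCube] using volume_cube_mul _ (dyadicCorner a ℓ R) (zero_le_two (α := ℝ)) _

lemma dyadicCube_subset_dyadicTriple (hℓ : 0 < ℓ) (Q : DyadicIndex n) :
    dyadicCube a ℓ Q ⊆ dyadicTriple a ℓ Q :=
  cube_subset_tripleCube (dyadicSide_pos hℓ Q)

lemma dyadicCorner_mem_dyadicCube (hℓ : 0 < ℓ) (Q : DyadicIndex n) :
    dyadicCorner a ℓ Q ∈ dyadicCube a ℓ Q := by
  have := dyadicSide_pos hℓ Q
  intro i
  constructor <;> linarith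

lemma mem_dyadicCube (hℓ : 0 < ℓ) {Q : DyadicIndex n} {x : Eu n} :
    x ∈ dyadicCube a ℓ Q ↔ dyadicPos a ℓ Q.1 x = Q.2 := by
  have hs : 0 < ℓ / 2 ^ Q.1 := by positivity
  simp only [dyadicCube, cube, Set.mem_ofPred_eq, Set.mem_Ico, funext_iff, dyadicPos,
    Int.floor_eq_iff]
  refine forall_congr' fun i => ?_
  rw [le_div_iff₀ hs, div_lt_iff₀ hs]
  simp only [dyadicCorner, dyadicSide]
  constructor <;> rintro ⟨h1, h2⟩ <;> constructor <;> linarith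

lemma mem_dyadicCube_dyadicPos (hℓ : 0 < ℓ) (k : ℕ) (x : Eu n) :
    x ∈ dyadicCube a ℓ (k, dyadicPos a ℓ k x) :=
  (mem_dyadicCube hℓ).2 rfl

lemma dyadicPos_eq_of_le (hℓ : 0 < ℓ) {j k : ℕ} (hjk : j ≤ k) {x y : Eu n}
    (h : dyadicPos a ℓ k x = dyadicPos a ℓ k y) : dyadicPos a ℓ j x = dyadicPos a ℓ j y := by
  obtain ⟨d, rfl⟩ := Nat.exists_eq_add_of_le hjk
  have floor_coarsen : ∀ t : ℝ,
      ⌊t / (ℓ / 2 ^ j)⌋ = ⌊t / (ℓ / 2 ^ (j + d))⌋ / ((2 ^ d : ℕ) : ℤ) := by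
    intro t
    rw [← Int.floor_div_natCast, pow_add]
    congr 1
    push_cast
    field_simp
  ext i
  have hi := congrFun h i
  simp only [dyadicPos] at hi ⊢
  rw [floor_coarsen, floor_coarsen, hi]

lemma dyadicCube_subset_of_mem (hℓ : 0 < ℓ) {Q R : DyadicIndex n} (hQR : Q.1 ≤ R.1) {x : Eu n}
    (hQ : x ∈ dyadicCube a ℓ Q) (hR : x ∈ dyadicCube a ℓ R) :
    dyadicCube a ℓ R ⊆ dyadicCube a ℓ Q := by
  intro y hy
  rw [mem_dyadicCube hℓ] at *
  rw [← hQ]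
  exact dyadicPos_eq_of_le hℓ hQR (hy.trans hR.symm)

lemma eq_of_mem_dyadicCube (hℓ : 0 < ℓ) {Q R : DyadicIndex n} (hQR : Q.1 = R.1) {x : Eu n}
    (hQ : x ∈ dyadicCube a ℓ Q) (hR : x ∈ dyadicCube a ℓ R) : Q = R := by
  rw [mem_dyadicCube hℓ] at *
  exact Prod.ext hQR (by rw [← hQ, ← hR, hQR])

lemma dyadicTriple_subset (hℓ : 0 < ℓ) {Q R : DyadicIndex n}
    (h : dyadicCube a ℓ R ⊆ dyadicCube a ℓ Q) : dyadicTriple a ℓ R ⊆ dyadicTriple a ℓ Q := by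
  intro x hx
  rw [dyadicTriple, mem_tripleCube] at *
  intro i
  have hcorner := corner_le_of_cube_subset (dyadicSide_pos hℓ R) h i
  constructor <;> linarith [hcorner.1, hcorner.2, (hx i).1, (hx i).2]

/-- The cube concentric with a dyadic cube and fifteen times as large; it contains every triple
of a cube at most twice as large that meets the triple of the given cube. -/
def vitaliCube (a : Eu n) (ℓ : ℝ) (Q : DyadicIndex n) : Set (Eu n) :=
  cube (WithLp.toLp 2 fun i => dyadicCorner a ℓ Q i - 7 * dyadicSide ℓ Q) (15 * dyadicSide ℓ Q)

lemma volume_vitaliCube (Q : DyadicIndex n) :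
    volume (vitaliCube a ℓ Q) = 5 ^ n * volume (dyadicTriple a ℓ Q) := by
  rw [vitaliCube, show 15 * dyadicSide ℓ Q = 5 * (3 * dyadicSide ℓ Q) by ring, dyadicTriple,
    tripleCube, volume_cube_mul _ (WithLp.toLp 2 fun i => dyadicCorner a ℓ Q i - dyadicSide ℓ Q)
      (by norm_num)]
  simp

lemma dyadicTriple_subset_vitaliCube {Q R : DyadicIndex n}
    (hQR : (dyadicTriple a ℓ Q ∩ dyadicTriple a ℓ R).Nonempty)
    (hside : dyadicSide ℓ Q ≤ 2 * dyadicSide ℓ R) : dyadicTriple a ℓ Q ⊆ vitaliCube a ℓ R := by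
  obtain ⟨z, hzQ, hzR⟩ := hQR
  intro x hx i
  rw [dyadicTriple, mem_tripleCube] at hzQ hzR hx
  simp only [Set.mem_Ico]
  constructor <;> linarith [(hzQ i).1, (hzQ i).2, (hzR i).1, (hzR i).2, (hx i).1, (hx i).2]

lemma mul_volume_biUnion_dyadicCube_le (hℓ : 0 < ℓ) {t : Set (DyadicIndex n)} {h : Eu n → ℝ≥0∞}
    {c : ℝ≥0∞}
    (ht : ∀ Q ∈ t, c * volume (dyadicTriple a ℓ Q) ≤ ∫⁻ y in dyadicTriple a ℓ Q, h y) :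
    c * volume (⋃ Q ∈ t, dyadicCube a ℓ Q) ≤ 5 ^ n * ∫⁻ y, h y := by
  obtain ⟨s, hst, hdisj, hs⟩ := Vitali.exists_disjoint_subfamily_covering_enlargement
    (dyadicTriple a ℓ) t (dyadicSide ℓ) 2 (by norm_num) (fun Q _ => (dyadicSide_pos hℓ Q).le) ℓ
    (fun Q _ => dyadicSide_le hℓ Q)
    (fun Q _ => ⟨_, dyadicCube_subset_dyadicTriple hℓ Q (dyadicCorner_mem_dyadicCube hℓ Q)⟩)
  have hcover : (⋃ Q ∈ t, dyadicCube a ℓ Q) ⊆ ⋃ R ∈ s, vitaliCube a ℓ R := by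
    refine Set.iUnion₂_subset fun Q hQ => ?_
    obtain ⟨R, hR, hmeet, hside⟩ := hs Q hQ
    exact ((dyadicCube_subset_dyadicTriple hℓ Q).trans
      (dyadicTriple_subset_vitaliCube hmeet hside)).trans
      (Set.subset_biUnion_of_mem (u := vitaliCube a ℓ) hR)
  calc c * volume (⋃ Q ∈ t, dyadicCube a ℓ Q)
      ≤ c * ∑' R : s, volume (vitaliCube a ℓ R) := by
        gcongr
        exact (measure_mono hcover).trans (measure_biUnion_le _ s.to_countable _)
    _ = 5 ^ n * ∑' R : s, c * volume (dyadicTriple a ℓ R) := by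
        simp_rw [volume_vitaliCube, ENNReal.tsum_mul_left]; ring
    _ ≤ 5 ^ n * ∑' R : s, ∫⁻ y in dyadicTriple a ℓ R, h y := by
        gcongr with R
        exact ht R (hst R.2)
    _ = 5 ^ n * ∫⁻ y in ⋃ R ∈ s, dyadicTriple a ℓ R, h y := by
        rw [lintegral_biUnion s.to_countable (fun R _ => measurableSet_dyadicTriple a ℓ R) hdisj]
    _ ≤ 5 ^ n * ∫⁻ y, h y := by
        gcongr
        exact Measure.restrict_le_self

end DyadicGrid

/-! ### Duality -/

section Duality

variable {α : Type*} [MeasurableSpace α] {μ : Measure α}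

lemma lintegral_rpow_eq_iSup {X : α → ℝ≥0∞} {Y : ℕ → α → ℝ≥0∞} (hY : ∀ N, Measurable (Y N))
    (hmono : Monotone Y) (hX : ∀ x, ⨆ N, Y N x = X x) {q : ℝ} (hq : 0 < q) :
    ∫⁻ x, X x ^ q ∂μ = ⨆ N, ∫⁻ x, Y N x ^ q ∂μ := by
  rw [← lintegral_iSup (fun N => (hY N).pow_const q)
    (fun N M h x => ENNReal.rpow_le_rpow (hmono h x) hq.le)]
  refine lintegral_congr fun x => ?_
  rw [← hX]
  exact (ENNReal.monotone_rpow_of_nonneg hq.le).map_iSup_of_continuousAt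
    ENNReal.continuous_rpow_const.continuousAt (by simp [hq])

lemma le_rpow_of_le_mul_rpow {I K : ℝ≥0∞} {p p' : ℝ} (hpp : p.HolderConjugate p') (hI : I ≠ ∞)
    (h : I ≤ K * I ^ (1 / p')) : I ≤ K ^ p := by
  rcases eq_or_ne I 0 with h0 | h0
  · simp [h0]
  have hsplit : I ^ (1 / p) * I ^ (1 / p') = I := by
    rw [← ENNReal.rpow_add _ _ h0 hI, one_div, one_div, hpp.inv_add_inv_eq_one, ENNReal.rpow_one]
  have hroot : I ^ (1 / p) ≤ K := by
    have h0' : I ^ (1 / p') ≠ 0 := by simp [h0, hI]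
    have ht' : I ^ (1 / p') ≠ ∞ := by simp [h0, hI]
    rwa [← ENNReal.mul_le_mul_iff_left h0' ht', hsplit]
  calc I = (I ^ (1 / p)) ^ p := by
        rw [← ENNReal.rpow_mul, one_div_mul_cancel hpp.ne_zero, ENNReal.rpow_one]
    _ ≤ K ^ p := ENNReal.rpow_le_rpow hroot hpp.nonneg

lemma lintegral_rpow_le_of_forall_mul_of_ne_top {X : α → ℝ≥0∞} (hX : Measurable X)
    (hfin : ∀ x, X x ≠ ∞) {p p' : ℝ} (hpp : p.HolderConjugate p') (hI : ∫⁻ x, X x ^ p ∂μ ≠ ∞)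
    {K : ℝ≥0∞} (h : ∀ g : α → ℝ≥0, Measurable g →
      ∫⁻ x, X x * g x ∂μ ≤ K * (∫⁻ x, (g x : ℝ≥0∞) ^ p' ∂μ) ^ (1 / p')) :
    ∫⁻ x, X x ^ p ∂μ ≤ K ^ p := by
  refine le_rpow_of_le_mul_rpow hpp hI ?_
  -- Test against the extremal function `X ^ (p - 1)`.
  have hg : ∀ x, ((X x ^ (p - 1)).toNNReal : ℝ≥0∞) = X x ^ (p - 1) := fun x =>
    ENNReal.coe_toNNReal (ENNReal.rpow_ne_top_of_nonneg hpp.sub_one_pos.le (hfin x))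
  have hmul : ∀ x, X x * X x ^ (p - 1) = X x ^ p := fun x => by
    nth_rw 1 [← ENNReal.rpow_one (X x)]
    rw [← ENNReal.rpow_add_of_nonneg _ _ zero_le_one hpp.sub_one_pos.le, add_sub_cancel]
  simpa only [hg, hmul, ← ENNReal.rpow_mul, hpp.sub_one_mul_conj] using
    h _ (hX.pow_const (p - 1)).ennreal_toNNReal

/-- The truncations of `X` to the sets of finite measure exhausting `μ` and to the heights `N`. -/
def truncate (μ : Measure α) [SigmaFinite μ] (X : α → ℝ≥0∞) (N : ℕ) : α → ℝ≥0∞ :=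
  (spanningSets μ N).indicator fun x => min (X x) N

variable [SigmaFinite μ] {X : α → ℝ≥0∞}

lemma measurable_truncate (hX : Measurable X) (N : ℕ) : Measurable (truncate μ X N) :=
  (hX.min measurable_const).indicator (measurableSet_spanningSets μ N)

lemma truncate_le (N : ℕ) (x : α) : truncate μ X N x ≤ X x :=
  (Set.indicator_le_self' (fun _ _ => zero_le) x).trans (min_le_left _ _)

lemma truncate_le_indicator (N : ℕ) (x : α) :
    truncate μ X N x ≤ (spanningSets μ N).indicator (fun _ => (N : ℝ≥0∞)) x :=
  Set.indicator_le_indicator (min_le_right _ _)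

lemma truncate_ne_top (N : ℕ) (x : α) : truncate μ X N x ≠ ∞ :=
  ne_top_of_le_ne_top (ENNReal.natCast_ne_top N)
    ((truncate_le_indicator N x).trans (Set.indicator_le_self' (fun _ _ => zero_le) x))

lemma truncate_mono : Monotone (truncate μ X) := by
  intro N M hNM x
  refine (Set.indicator_le_indicator_of_subset (monotone_spanningSets μ hNM)
    (fun _ => zero_le) x).trans (Set.indicator_le_indicator ?_)
  gcongr

lemma iSup_truncate (x : α) : ⨆ N, truncate μ X N x = X x := by
  refine le_antisymm (iSup_le fun N => truncate_le N x) (le_of_forall_lt fun c hc => ?_)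
  obtain ⟨N, hN⟩ := ENNReal.exists_nat_gt hc.ne_top
  have hx : x ∈ spanningSets μ (max N (spanningSetsIndex μ x)) :=
    monotone_spanningSets μ (le_max_right _ _) (mem_spanningSetsIndex μ x)
  refine lt_of_lt_of_le ?_ (le_iSup _ (max N (spanningSetsIndex μ x)))
  rw [truncate, Set.indicator_of_mem hx]
  exact lt_min hc (hN.trans_le (by exact_mod_cast le_max_left _ _))

lemma lintegral_truncate_rpow_ne_top {p : ℝ} (hp : 0 < p) (N : ℕ) :
    ∫⁻ x, truncate μ X N x ^ p ∂μ ≠ ∞ := by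
  refine ne_top_of_le_ne_top (b := (N : ℝ≥0∞) ^ p * μ (spanningSets μ N))
    (ENNReal.mul_ne_top (ENNReal.rpow_ne_top_of_nonneg hp.le (ENNReal.natCast_ne_top N))
      (measure_spanningSets_lt_top μ N).ne) ?_
  rw [← setLIntegral_const, ← lintegral_indicator (measurableSet_spanningSets μ N)]
  refine lintegral_mono fun x => (ENNReal.rpow_le_rpow (truncate_le_indicator N x) hp.le).trans ?_
  by_cases hx : x ∈ spanningSets μ N <;> simp [hx, hp]

lemma lintegral_rpow_le_of_forall_mul (hX : AEMeasurable X μ) {p p' : ℝ}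
    (hpp : p.HolderConjugate p') {K : ℝ≥0∞} (h : ∀ g : α → ℝ≥0, Measurable g →
      ∫⁻ x, X x * g x ∂μ ≤ K * (∫⁻ x, (g x : ℝ≥0∞) ^ p' ∂μ) ^ (1 / p')) :
    ∫⁻ x, X x ^ p ∂μ ≤ K ^ p := by
  wlog hXm : Measurable X generalizing X
  · have hpow : ∫⁻ x, X x ^ p ∂μ = ∫⁻ x, hX.mk X x ^ p ∂μ :=
      lintegral_congr_ae (hX.ae_eq_mk.mono fun x hx => congrArg (· ^ p) hx)
    refine hpow.trans_le (this hX.measurable_mk.aemeasurable (fun g hg => ?_) hX.measurable_mk)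
    rw [lintegral_congr_ae (hX.ae_eq_mk.symm.mono fun x hx => congrArg (· * (g x : ℝ≥0∞)) hx)]
    exact h g hg
  rw [lintegral_rpow_eq_iSup (measurable_truncate hXm) truncate_mono (iSup_truncate (μ := μ))
    hpp.pos]
  refine iSup_le fun N => lintegral_rpow_le_of_forall_mul_of_ne_top (measurable_truncate hXm N)
    (truncate_ne_top N) hpp (lintegral_truncate_rpow_ne_top hpp.pos N) fun g hg => ?_
  refine le_trans (lintegral_mono fun x => ?_) (h g hg)
  gcongr
  exact truncate_le N x

end Duality

/-! ### Luxemburg norms and complementary functions -/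

section Luxemburg

/-- The Luxemburg norm of a nonnegative function for a gauge `D` with values in `[0,∞]`, relative to
an arbitrary measure. For the normalized measure `volume[|Q]` and a Young function `D` it is the
localized norm `luxemburg`. -/
def luxNorm {α : Type*} [MeasurableSpace α] (D : ℝ≥0 → ℝ≥0∞) (μ : Measure α) (g : α → ℝ≥0) :
    ℝ≥0∞ :=
  ⨅ (l : ℝ≥0) (_ : 0 < l) (_ : ∫⁻ y, D (g y / l) ∂μ ≤ 1), (l : ℝ≥0∞)

variable {α : Type*} [MeasurableSpace α] {μ : Measure α} {A : ℝ≥0 → ℝ≥0}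

lemma luxNorm_congr_ae {D : ℝ≥0 → ℝ≥0∞} {g h : α → ℝ≥0} (H : g =ᵐ[μ] h) :
    luxNorm D μ g = luxNorm D μ h := by
  have : ∀ l : ℝ≥0, ∫⁻ y, D (g y / l) ∂μ = ∫⁻ y, D (h y / l) ∂μ := fun l =>
    lintegral_congr_ae (H.mono fun y hy => by simp only [hy])
  simp only [luxNorm, this]

lemma exists_of_luxNorm_lt {D : ℝ≥0 → ℝ≥0∞} {g : α → ℝ≥0} {c : ℝ≥0∞} (h : luxNorm D μ g < c) :
    ∃ l : ℝ≥0, 0 < l ∧ ∫⁻ y, D (g y / l) ∂μ ≤ 1 ∧ (l : ℝ≥0∞) < c := by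
  simpa only [luxNorm, iInf_lt_iff, exists_prop] using h

lemma ofReal_le_complementary {s : ℝ≥0} (hs : 0 < s) (t : ℝ≥0) :
    ENNReal.ofReal ((s : ℝ) * t - A s) ≤ complementary A t :=
  le_iSup₂_of_le (f := fun (s : ℝ≥0) (_ : 0 < s) => ENNReal.ofReal ((s : ℝ) * (t : ℝ) - (A s : ℝ)))
    s hs le_rfl

lemma coe_mul_le_add_complementary (s t : ℝ≥0) : (s * t : ℝ≥0∞) ≤ A s + complementary A t := by
  rcases eq_zero_or_pos s with rfl | hs
  · simp
  calc (s * t : ℝ≥0∞) = ENNReal.ofReal ((A s : ℝ) + (s * t - A s)) := by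
        rw [add_sub_cancel, ← NNReal.coe_mul, ENNReal.ofReal_coe_nnreal, ENNReal.coe_mul]
    _ ≤ A s + ENNReal.ofReal ((s : ℝ) * t - A s) := by
        simpa using ENNReal.ofReal_add_le (p := (A s : ℝ)) (q := (s : ℝ) * t - A s)
    _ ≤ A s + complementary A t := by gcongr; exact ofReal_le_complementary hs t

lemma complementary_mono (A : ℝ≥0 → ℝ≥0) : Monotone (complementary A) := by
  intro t t' h
  refine iSup₂_mono fun s _ => ENNReal.ofReal_le_ofReal ?_
  have : (t : ℝ) ≤ t' := h
  gcongr

lemma complementary_mul_le (A : ℝ≥0 → ℝ≥0) {ε : ℝ≥0} (hε : ε ≤ 1) (t : ℝ≥0) :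
    complementary A (ε * t) ≤ ε * complementary A t := by
  refine iSup₂_le fun s hs => ?_
  calc ENNReal.ofReal (s * (ε * t : ℝ≥0) - A s) ≤ ENNReal.ofReal (ε * (s * t - A s)) := by
        refine ENNReal.ofReal_le_ofReal ?_
        have : (ε : ℝ) * A s ≤ A s := mul_le_of_le_one_left (A s).2 hε
        push_cast
        linarith
    _ = ε * ENNReal.ofReal (s * t - A s) := by
        rw [ENNReal.ofReal_mul (NNReal.coe_nonneg ε), ENNReal.ofReal_coe_nnreal]
    _ ≤ ε * complementary A t := by gcongr; exact ofReal_le_complementary hs t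

lemma lintegral_mul_le_of_lintegral_le_one (hA : Measurable A) {g h : α → ℝ≥0}
    (hh : AEMeasurable h μ) {l m : ℝ≥0} (hl : 0 < l) (hm : 0 < m)
    (hAl : ∫⁻ y, (A (h y / l) : ℝ≥0∞) ∂μ ≤ 1)
    (hDm : ∫⁻ y, complementary A (g y / m) ∂μ ≤ 1) :
    ∫⁻ y, (h y : ℝ≥0∞) * g y ∂μ ≤ 2 * (l * m) :=
  calc ∫⁻ y, (h y : ℝ≥0∞) * g y ∂μ
      ≤ ∫⁻ y, ((l * m : ℝ≥0) : ℝ≥0∞) * (A (h y / l) + complementary A (g y / m)) ∂μ := by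
        refine lintegral_mono fun y => ?_
        calc (h y : ℝ≥0∞) * g y = (l * m : ℝ≥0) * ((h y / l : ℝ≥0) * (g y / m : ℝ≥0)) := by
              norm_cast
              field_simp
          _ ≤ _ := by gcongr; exact coe_mul_le_add_complementary _ _
    _ = (l * m : ℝ≥0) * ((∫⁻ y, (A (h y / l) : ℝ≥0∞) ∂μ) +
          ∫⁻ y, complementary A (g y / m) ∂μ) := by
        rw [lintegral_const_mul' _ _ ENNReal.coe_ne_top, lintegral_add_left']
        exact (hA.comp_aemeasurable (hh.div_const l)).coe_nnreal_ennreal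
    _ ≤ (l * m : ℝ≥0) * (1 + 1) := by gcongr
    _ = 2 * (l * m) := by push_cast; ring

lemma lintegral_mul_le_luxNorm_mul_luxNorm (hA : Measurable A) {g h : α → ℝ≥0}
    (hh : AEMeasurable h μ) (h0 : luxNorm (A ·) μ h ≠ 0) (ht : luxNorm (A ·) μ h ≠ ∞) :
    ∫⁻ y, (h y : ℝ≥0∞) * g y ∂μ ≤ 2 * (luxNorm (A ·) μ h * luxNorm (complementary A) μ g) := by
  rw [mul_comm, ← ENNReal.div_le_iff_le_mul (by simp) (by simp)]
  refine ENNReal.le_mul_of_forall_lt (Or.inl h0) (Or.inl ht) fun a ha b hb => ?_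
  obtain ⟨l, hl, hAl, hla⟩ := exists_of_luxNorm_lt ha
  obtain ⟨m, hm, hDm, hmb⟩ := exists_of_luxNorm_lt hb
  rw [ENNReal.div_le_iff_le_mul (by simp) (by simp)]
  calc ∫⁻ y, (h y : ℝ≥0∞) * g y ∂μ ≤ 2 * (l * m) :=
        lintegral_mul_le_of_lintegral_le_one hA hh hl hm hAl hDm
    _ ≤ 2 * (a * b) := by gcongr
    _ = a * b * 2 := by ring

lemma exists_pos_measure_lt_ne_zero {h : α → ℝ≥0} (hne : ¬h =ᵐ[μ] 0) :
    ∃ ε : ℝ≥0, 0 < ε ∧ μ {y | ε < h y} ≠ 0 := by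
  by_contra! hcon
  refine hne (measure_mono_null (t := ⋃ k : ℕ, {y | 1 / ((k : ℝ≥0) + 1) < h y}) (fun y hy => ?_)
    (measure_iUnion_null fun k => hcon _ (by positivity)))
  exact Set.mem_iUnion.2 (exists_nat_one_div_lt (pos_iff_ne_zero.2 hy))

lemma luxNorm_ne_zero (hA : Monotone A) (hAt : Filter.Tendsto A Filter.atTop Filter.atTop)
    {h : α → ℝ≥0} (hh : AEMeasurable h μ) (hne : ¬h =ᵐ[μ] 0) : luxNorm (A ·) μ h ≠ 0 := by
  obtain ⟨ε, hε, hE⟩ := exists_pos_measure_lt_ne_zero hne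
  obtain ⟨t, ht⟩ := Filter.eventually_atTop.1
    (hAt.eventually_gt_atTop (μ {y | ε < h y})⁻¹.toNNReal)
  intro hzero
  obtain ⟨l, hl, hAl, hlt⟩ := exists_of_luxNorm_lt (c := (ε / (t + 1) : ℝ≥0))
    (hzero.trans_lt (by exact_mod_cast (by positivity : 0 < ε / (t + 1))))
  have htl : t ≤ ε / l := by
    rw [ENNReal.coe_lt_coe, lt_div_iff₀ (by positivity)] at hlt
    rw [le_div_iff₀ hl]
    calc t * l ≤ l * (t + 1) := by rw [mul_comm]; gcongr; exact le_self_add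
      _ ≤ ε := hlt.le
  have hchebyshev : (A (ε / l) : ℝ≥0∞) * μ {y | ε < h y} ≤ 1 := by
    refine le_trans ?_ ((mul_meas_ge_le_lintegral₀ (hA.measurable.comp_aemeasurable
      (hh.div_const l)).coe_nnreal_ennreal (A (ε / l))).trans hAl)
    gcongr with y
    intro hy
    exact_mod_cast hA (div_le_div_of_nonneg_right hy.le l.2)
  refine (ht _ htl).not_ge ?_
  rw [← ENNReal.coe_le_coe, ENNReal.coe_toNNReal (ENNReal.inv_ne_top.2 hE)]
  exact ENNReal.le_inv_iff_mul_le.2 hchebyshev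

end Luxemburg

/-! ### The Orlicz maximal function -/

section OrliczMaximal

lemma lintegral_rpow_le_lintegral_meas_lt_mul {α : Type*} [MeasurableSpace α] {μ : Measure α}
    [SigmaFinite μ] {M : α → ℝ≥0∞} (hM : Measurable M) {q : ℝ} (hq : 0 < q) :
    ∫⁻ x, M x ^ q ∂μ ≤ ENNReal.ofReal q *
      ∫⁻ t in Set.Ioi (0 : ℝ), μ {x | ENNReal.ofReal t < M x} * ENNReal.ofReal (t ^ (q - 1)) := by
  rw [lintegral_rpow_eq_iSup (measurable_truncate hM) truncate_mono (iSup_truncate (μ := μ)) hq]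
  refine iSup_le fun N => ?_
  calc ∫⁻ x, truncate μ M N x ^ q ∂μ
      = ∫⁻ x, ENNReal.ofReal ((truncate μ M N x).toReal ^ q) ∂μ := by
        refine lintegral_congr fun x => ?_
        rw [← ENNReal.ofReal_rpow_of_nonneg ENNReal.toReal_nonneg hq.le,
          ENNReal.ofReal_toReal (truncate_ne_top N x)]
    _ = ENNReal.ofReal q * ∫⁻ t in Set.Ioi (0 : ℝ),
          μ {x | t < (truncate μ M N x).toReal} * ENNReal.ofReal (t ^ (q - 1)) :=
        lintegral_rpow_eq_lintegral_meas_lt_mul _ (ae_of_all _ fun x => ENNReal.toReal_nonneg)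
          (measurable_truncate hM N).ennreal_toReal.aemeasurable hq
    _ ≤ _ := by
        refine mul_le_mul_right (setLIntegral_mono' measurableSet_Ioi fun t ht => ?_) _
        gcongr with x
        intro hx
        exact ((ENNReal.ofReal_lt_iff_lt_toReal (le_of_lt ht) (truncate_ne_top N x)).2 hx).trans_le
          (truncate_le N x)

/-- The Orlicz maximal function along the triples of the cubes of a dyadic grid. -/
def orliczMax {n : ℕ} (D : ℝ≥0 → ℝ≥0∞) (a : Eu n) (ℓ : ℝ) (g : Eu n → ℝ≥0) (x : Eu n) : ℝ≥0∞ :=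
  ⨆ Q : DyadicIndex n,
    (dyadicCube a ℓ Q).indicator (fun _ => luxNorm D volume[|dyadicTriple a ℓ Q] g) x

variable {n : ℕ} {D : ℝ≥0 → ℝ≥0∞} {a : Eu n} {ℓ : ℝ} {g : Eu n → ℝ≥0}

lemma measurable_orliczMax : Measurable (orliczMax D a ℓ g) :=
  Measurable.iSup fun Q => measurable_const.indicator (measurableSet_dyadicCube a ℓ Q)

lemma luxNorm_le_orliczMax {Q : DyadicIndex n} {x : Eu n} (hx : x ∈ dyadicCube a ℓ Q) :
    luxNorm D volume[|dyadicTriple a ℓ Q] g ≤ orliczMax D a ℓ g x :=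
  le_iSup_of_le Q (by rw [Set.indicator_of_mem hx])

lemma orliczMax_congr_ae {h : Eu n → ℝ≥0} (H : g =ᵐ[volume] h) :
    orliczMax D a ℓ g = orliczMax D a ℓ h := by
  funext x
  simp only [orliczMax, luxNorm_congr_ae (ProbabilityTheory.cond_absolutelyContinuous.ae_eq H)]

lemma le_half_add_indicator (hD : Monotone D) {c ε : ℝ≥0} (hε : 0 < ε) (hε1 : ε ≤ 1)
    (hεc : D (ε * c) ≤ 1 / 2) (t : ℝ≥0) : D t ≤ 1 / 2 + (Set.Ioi c).indicator D (t / ε) := by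
  by_cases ht : c < t / ε
  · rw [Set.indicator_of_mem (show t / ε ∈ Set.Ioi c from ht)]
    exact le_add_left (hD (le_div_self zero_le hε hε1))
  · refine le_add_right (le_trans (hD ?_) hεc)
    calc t = ε * (t / ε) := by field_simp
      _ ≤ ε * c := by gcongr; exact not_lt.1 ht

lemma half_le_lintegral_of_lt_luxNorm {α : Type*} [MeasurableSpace α] {μ : Measure α}
    [IsProbabilityMeasure μ] {g : α → ℝ≥0} {h : α → ℝ≥0∞} {s : ℝ≥0} (hs : 0 < s)
    (hlt : (s : ℝ≥0∞) < luxNorm D μ g) (hh : ∀ y, D (g y / s) ≤ 1 / 2 + h y) :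
    1 / 2 ≤ ∫⁻ y, h y ∂μ := by
  have hone : 1 < ∫⁻ y, D (g y / s) ∂μ := by
    by_contra! hcon
    exact hlt.not_ge (iInf_le_of_le s (iInf₂_le_of_le hs hcon le_rfl))
  have hadd : 1 / 2 + 1 / 2 ≤ 1 / 2 + ∫⁻ y, h y ∂μ := by
    calc (1 / 2 + 1 / 2 : ℝ≥0∞) ≤ ∫⁻ y, D (g y / s) ∂μ := by
          rw [ENNReal.add_halves]; exact hone.le
      _ ≤ ∫⁻ y, (1 / 2 + h y) ∂μ := lintegral_mono hh
      _ = 1 / 2 + ∫⁻ y, h y ∂μ := by simp [lintegral_add_left measurable_const]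
  exact (ENNReal.add_le_add_iff_left (by simp)).1 hadd

lemma isProbabilityMeasure_cond_dyadicTriple (hℓ : 0 < ℓ) (Q : DyadicIndex n) :
    IsProbabilityMeasure volume[|dyadicTriple a ℓ Q] :=
  ProbabilityTheory.cond_isProbabilityMeasure_of_finite (volume_dyadicTriple_ne_zero hℓ Q)
    (volume_dyadicTriple_ne_top Q)

lemma setLIntegral_dyadicTriple (hℓ : 0 < ℓ) (Q : DyadicIndex n) (f : Eu n → ℝ≥0∞) :
    ∫⁻ y in dyadicTriple a ℓ Q, f y =
      volume (dyadicTriple a ℓ Q) * ∫⁻ y, f y ∂volume[|dyadicTriple a ℓ Q] := by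
  rw [ProbabilityTheory.cond, lintegral_smul_measure, smul_eq_mul,
    ENNReal.mul_inv_cancel_left (volume_dyadicTriple_ne_zero hℓ Q) (volume_dyadicTriple_ne_top Q)]

lemma volume_lt_orliczMax_le (hD : Monotone D) {ε c : ℝ≥0} (hε : 0 < ε) (hε1 : ε ≤ 1)
    (hεc : D (ε * c) ≤ 1 / 2) (hℓ : 0 < ℓ) {s : ℝ≥0} (hs : 0 < s) :
    volume {x | (s : ℝ≥0∞) < orliczMax D a ℓ g x} ≤
      2 * 5 ^ n * ∫⁻ y, (Set.Ioi c).indicator D (g y / ε / s) := by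
  set h : Eu n → ℝ≥0∞ := fun y => (Set.Ioi c).indicator D (g y / ε / s) with hh
  set t : Set (DyadicIndex n) := {Q | (s : ℝ≥0∞) < luxNorm D volume[|dyadicTriple a ℓ Q] g}
  have hsubset : {x | (s : ℝ≥0∞) < orliczMax D a ℓ g x} ⊆ ⋃ Q ∈ t, dyadicCube a ℓ Q := by
    intro x hx
    obtain ⟨Q, hQ⟩ := lt_iSup_iff.1 (Set.mem_ofPred_eq ▸ hx)
    have hxQ : x ∈ dyadicCube a ℓ Q := Set.mem_of_indicator_ne_zero (ne_bot_of_gt hQ)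
    rw [Set.indicator_of_mem hxQ] at hQ
    exact Set.mem_biUnion (x := Q) hQ hxQ
  have hmean : ∀ Q ∈ t, (1 / 2 : ℝ≥0∞) * volume (dyadicTriple a ℓ Q) ≤
      ∫⁻ y in dyadicTriple a ℓ Q, h y := by
    intro Q hQ
    have := isProbabilityMeasure_cond_dyadicTriple (a := a) hℓ Q
    rw [setLIntegral_dyadicTriple hℓ, mul_comm]
    gcongr
    refine half_le_lintegral_of_lt_luxNorm hs hQ fun y => ?_
    simp only [hh]
    rw [div_right_comm]
    exact le_half_add_indicator hD hε hε1 hεc _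
  calc volume {x | (s : ℝ≥0∞) < orliczMax D a ℓ g x}
      ≤ 2 * (1 / 2 * volume (⋃ Q ∈ t, dyadicCube a ℓ Q)) := by
        rw [← mul_assoc, one_div, ENNReal.mul_inv_cancel (by norm_num) (by norm_num), one_mul]
        exact measure_mono hsubset
    _ ≤ 2 * (5 ^ n * ∫⁻ y, h y) := by
        exact mul_le_mul_right (mul_volume_biUnion_dyadicCube_le hℓ hmean) 2
    _ = 2 * 5 ^ n * ∫⁻ y, h y := by rw [mul_assoc]

/-- The substitution `t ↦ G / t`. -/
lemma lintegral_Ioi_comp_div_mul_rpow {Φ : ℝ≥0 → ℝ≥0∞} {q : ℝ} {G : ℝ≥0} (hG : 0 < G) :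
    ∫⁻ t in Set.Ioi (0 : ℝ), Φ (G / t.toNNReal) * ENNReal.ofReal (t ^ (q - 1)) =
      (G : ℝ≥0∞) ^ q * ∫⁻ t in Set.Ioi (0 : ℝ),
        Φ t.toNNReal / ENNReal.ofReal (t ^ q) / ENNReal.ofReal t := by
  have hG' : (0 : ℝ) < G := hG
  have himage : (fun t : ℝ => (G : ℝ) / t) '' Set.Ioi 0 = Set.Ioi 0 := by
    ext t
    constructor
    · rintro ⟨s, hs, rfl⟩; exact div_pos hG' hs
    · intro ht
      exact ⟨G / t, div_pos hG' ht, by have : t ≠ 0 := ne_of_gt ht; field_simp⟩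
  rw [← himage, lintegral_image_eq_lintegral_abs_deriv_mul measurableSet_Ioi
    (f' := fun t => -(G : ℝ) / t ^ 2), himage, ← lintegral_const_mul']
  · refine setLIntegral_congr_fun measurableSet_Ioi fun t (ht : 0 < t) => ?_
    have hinvolution : G / ((G : ℝ) / t).toNNReal = t.toNNReal := by
      rw [Real.toNNReal_div hG'.le, Real.toNNReal_coe, div_div_cancel₀ hG.ne']
    simp only [hinvolution]
    rw [ENNReal.div_eq_inv_mul, ENNReal.div_eq_inv_mul, ← ENNReal.ofReal_inv_of_pos ht,
      ← ENNReal.ofReal_inv_of_pos (by positivity), ← ENNReal.ofReal_coe_nnreal (p := G),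
      ENNReal.ofReal_rpow_of_pos hG', mul_left_comm, ← ENNReal.ofReal_mul (by positivity),
      ← mul_assoc, ← mul_assoc, ← ENNReal.ofReal_mul (by positivity),
      ← ENNReal.ofReal_mul (by positivity), mul_comm]
    congr 2
    rw [abs_div, abs_neg, abs_of_pos hG', abs_of_pos (by positivity : (0 : ℝ) < t ^ 2),
      Real.div_rpow hG'.le ht.le, Real.rpow_sub_one hG'.ne', Real.rpow_sub_one ht.ne']
    field_simp
  · exact ENNReal.rpow_ne_top_of_ne_zero (by exact_mod_cast hG.ne') ENNReal.coe_ne_top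
  · intro t ht
    simpa [div_eq_mul_inv] using
      ((hasDerivAt_inv (ne_of_gt ht)).const_mul (G : ℝ)).hasDerivWithinAt
  · intro s hs t ht hst
    have hs' : s ≠ 0 := ne_of_gt hs
    have ht' : t ≠ 0 := ne_of_gt ht
    simp only at hst
    field_simp at hst
    exact hst.symm

lemma lintegral_lintegral_comp_div_mul_rpow {α : Type*} [MeasurableSpace α] {μ : Measure α}
    [SFinite μ] {Φ : ℝ≥0 → ℝ≥0∞} (hΦ : Measurable Φ) (hΦ0 : Φ 0 = 0) {G : α → ℝ≥0}
    (hG : Measurable G) {q : ℝ} (hq : 0 < q) :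
    ∫⁻ t in Set.Ioi (0 : ℝ), (∫⁻ y, Φ (G y / t.toNNReal) ∂μ) * ENNReal.ofReal (t ^ (q - 1)) =
      (∫⁻ y, (G y : ℝ≥0∞) ^ q ∂μ) * ∫⁻ t in Set.Ioi (0 : ℝ),
        Φ t.toNNReal / ENNReal.ofReal (t ^ q) / ENNReal.ofReal t := by
  have hmeas : Measurable fun z : ℝ × α => Φ (G z.2 / z.1.toNNReal) := hΦ.comp (by fun_prop)
  calc ∫⁻ t in Set.Ioi (0 : ℝ), (∫⁻ y, Φ (G y / t.toNNReal) ∂μ) * ENNReal.ofReal (t ^ (q - 1))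
      = ∫⁻ t in Set.Ioi (0 : ℝ),
          ∫⁻ y, Φ (G y / t.toNNReal) * ENNReal.ofReal (t ^ (q - 1)) ∂μ := by
        simp_rw [lintegral_mul_const' _ _ ENNReal.ofReal_ne_top]
    _ = ∫⁻ y, (∫⁻ t in Set.Ioi (0 : ℝ),
          Φ (G y / t.toNNReal) * ENNReal.ofReal (t ^ (q - 1))) ∂μ :=
        lintegral_lintegral_swap (hmeas.mul (by fun_prop)).aemeasurable
    _ = ∫⁻ y, (G y : ℝ≥0∞) ^ q * (∫⁻ t in Set.Ioi (0 : ℝ),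
          Φ t.toNNReal / ENNReal.ofReal (t ^ q) / ENNReal.ofReal t) ∂μ := by
        refine lintegral_congr fun y => ?_
        rcases eq_zero_or_pos (G y) with h0 | h0
        · simp [h0, hΦ0, hq]
        · exact lintegral_Ioi_comp_div_mul_rpow h0
    _ = _ := lintegral_mul_const _ (by fun_prop)

lemma lintegral_orliczMax_rpow_le_of_le_half (hD : Monotone D) {ε c : ℝ≥0} (hε : 0 < ε)
    (hε1 : ε ≤ 1) (hεc : D (ε * c) ≤ 1 / 2) (hℓ : 0 < ℓ) (hg : Measurable g) {q : ℝ}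
    (hq : 0 < q) :
    ∫⁻ x, orliczMax D a ℓ g x ^ q ≤ ENNReal.ofReal q * (2 * 5 ^ n *
      ((∫⁻ y, ((g y / ε : ℝ≥0) : ℝ≥0∞) ^ q) * ∫⁻ t in Set.Ioi (0 : ℝ),
        (Set.Ioi c).indicator D t.toNNReal / ENNReal.ofReal (t ^ q) / ENNReal.ofReal t)) := by
  refine (lintegral_rpow_le_lintegral_meas_lt_mul measurable_orliczMax hq).trans ?_
  gcongr
  rw [← lintegral_lintegral_comp_div_mul_rpow (G := fun y => g y / ε)
    (hD.measurable.indicator measurableSet_Ioi) (by simp) (by fun_prop) hq,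
    ← lintegral_const_mul' _ _ (by finiteness)]
  refine setLIntegral_mono' measurableSet_Ioi fun t ht => ?_
  rw [← mul_assoc]
  gcongr
  exact volume_lt_orliczMax_le hD hε hε1 hεc hℓ (Real.toNNReal_pos.2 ht)

lemma exists_ne_top_of_satisfiesB {q : ℝ} (hB : SatisfiesB q D) :
    ∃ c : ℝ≥0, D c ≠ ∞ ∧ ∫⁻ t in Set.Ioi (0 : ℝ),
      (Set.Ioi c).indicator D t.toNNReal / ENNReal.ofReal (t ^ q) / ENNReal.ofReal t ≠ ∞ := by
  obtain ⟨b, hb, hI⟩ := hB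
  obtain ⟨d, hbd, hd⟩ : ∃ d : ℝ, b < d ∧ D d.toNNReal ≠ ∞ := by
    by_contra! hcon
    refine hI.ne (top_unique ?_)
    calc ∞ = ∫⁻ _ in Set.Ioi b, ∞ := by simp
      _ ≤ _ := setLIntegral_mono' measurableSet_Ioi fun _ ht => by
        simp [hcon _ ht, ENNReal.top_div]
  refine ⟨d.toNNReal, hd, ne_top_of_le_ne_top hI.ne ?_⟩
  rw [← lintegral_indicator measurableSet_Ioi, ← lintegral_indicator measurableSet_Ioi]
  refine lintegral_mono fun t => ?_
  by_cases ht : d.toNNReal < t.toNNReal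
  · have hdt : d < t := (Real.toNNReal_lt_toNNReal_iff_of_nonneg (hb.trans hbd).le).1 ht
    simp [Set.indicator, ht, hbd.trans hdt, hb.trans (hbd.trans hdt)]
  · simp [Set.indicator, ht]

lemma exists_le_half_of_ne_top (hD : ∀ ε : ℝ≥0, ε ≤ 1 → ∀ t, D (ε * t) ≤ ε * D t) {c : ℝ≥0}
    (hc : D c ≠ ∞) : ∃ ε : ℝ≥0, 0 < ε ∧ ε ≤ 1 ∧ D (ε * c) ≤ 1 / 2 := by
  lift D c to ℝ≥0 using hc with m hm
  have hε : (1 / (2 * m + 1) : ℝ≥0) ≤ 1 := by rw [div_le_iff₀ (by positivity)]; simp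
  refine ⟨1 / (2 * m + 1), by positivity, hε, (hD _ hε c).trans ?_⟩
  have : 1 / (2 * m + 1) * m ≤ 1 / 2 := by
    rw [one_div_mul_eq_div, div_le_div_iff₀ (by positivity) (by norm_num), one_mul, mul_comm]
    exact le_self_add
  calc ((1 / (2 * m + 1) : ℝ≥0) : ℝ≥0∞) * D c = ((1 / (2 * m + 1) * m : ℝ≥0) : ℝ≥0∞) := by
        rw [ENNReal.coe_mul, hm]
    _ ≤ ((1 / 2 : ℝ≥0) : ℝ≥0∞) := by exact_mod_cast this
    _ = 1 / 2 := by rw [ENNReal.coe_div (by norm_num)]; simp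

theorem lintegral_orliczMax_rpow_le (n : ℕ) (hD : Monotone D)
    (hconv : ∀ ε : ℝ≥0, ε ≤ 1 → ∀ t, D (ε * t) ≤ ε * D t) {q : ℝ} (hq : 0 < q)
    (hB : SatisfiesB q D) :
    ∃ C : ℝ≥0, ∀ (a : Eu n) (ℓ : ℝ), 0 < ℓ → ∀ g : Eu n → ℝ≥0, AEMeasurable g volume →
      ∫⁻ x, orliczMax D a ℓ g x ^ q ≤ C * ∫⁻ x, (g x : ℝ≥0∞) ^ q := by
  obtain ⟨c, hc, hI⟩ := exists_ne_top_of_satisfiesB hB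
  obtain ⟨ε, hε, hε1, hεc⟩ := exists_le_half_of_ne_top hconv hc
  set I := ∫⁻ t in Set.Ioi (0 : ℝ),
    (Set.Ioi c).indicator D t.toNNReal / ENNReal.ofReal (t ^ q) / ENNReal.ofReal t
  have hεq : (ε : ℝ≥0∞)⁻¹ ^ q ≠ ∞ := ENNReal.rpow_ne_top_of_nonneg hq.le (by simp [hε.ne'])
  have hK : ENNReal.ofReal q * (2 * 5 ^ n * ((ε : ℝ≥0∞)⁻¹ ^ q * I)) ≠ ∞ := by finiteness
  refine ⟨(ENNReal.ofReal q * (2 * 5 ^ n * ((ε : ℝ≥0∞)⁻¹ ^ q * I))).toNNReal,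
    fun a ℓ hℓ g hg => ?_⟩
  wlog hgm : Measurable g generalizing g
  · rw [orliczMax_congr_ae hg.ae_eq_mk, lintegral_congr_ae
      (hg.ae_eq_mk.mono fun x hx => congrArg (fun t : ℝ≥0 => (t : ℝ≥0∞) ^ q) hx)]
    exact this _ hg.measurable_mk.aemeasurable hg.measurable_mk
  rw [ENNReal.coe_toNNReal hK]
  refine (lintegral_orliczMax_rpow_le_of_le_half hD hε hε1 hεc hℓ hgm hq).trans (le_of_eq ?_)
  have hscale (y : Eu n) :
      ((g y / ε : ℝ≥0) : ℝ≥0∞) ^ q = (g y : ℝ≥0∞) ^ q * (ε : ℝ≥0∞)⁻¹ ^ q := by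
    rw [ENNReal.coe_div hε.ne', div_eq_mul_inv, ENNReal.mul_rpow_of_nonneg _ _ hq.le]
  simp_rw [hscale]
  rw [lintegral_mul_const' _ _ hεq]
  ring

end OrliczMaximal

/-! ### Oscillation of a Calderón–Zygmund kernel -/

section Kernel

variable {n : ℕ} {K : Eu n → Eu n → ℂ}

lemma norm_sub_le_of_mem_cube {a : Eu n} {ℓ : ℝ} (hℓ : 0 ≤ ℓ) {x y : Eu n} (hx : x ∈ cube a ℓ)
    (hy : y ∈ cube a ℓ) : ‖x - y‖ ≤ √n * ℓ := by
  rw [EuclideanSpace.norm_eq]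
  calc √(∑ i, ‖(x - y) i‖ ^ 2) ≤ √(∑ _i : Fin n, ℓ ^ 2) := by
        refine Real.sqrt_le_sqrt (Finset.sum_le_sum fun i _ => ?_)
        refine pow_le_pow_left₀ (norm_nonneg _) ?_ 2
        rw [PiLp.sub_apply, Real.norm_eq_abs, abs_le]
        constructor <;> linarith [(hx i).1, (hx i).2, (hy i).1, (hy i).2]
    _ = √n * ℓ := by
        rw [Finset.sum_const, Finset.card_univ, Fintype.card_fin, nsmul_eq_mul,
          Real.sqrt_mul (by positivity), Real.sqrt_sq hℓ]

lemma le_norm_sub_of_notMem_tripleCube {a : Eu n} {ℓ : ℝ} {x y : Eu n} (hx : x ∈ cube a ℓ)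
    (hy : y ∉ tripleCube a ℓ) : ℓ ≤ ‖x - y‖ := by
  rw [mem_tripleCube] at hy
  push Not at hy
  obtain ⟨i, hi⟩ := hy
  refine le_trans ?_ (PiLp.norm_apply_le (x - y) i)
  rw [PiLp.sub_apply, Real.norm_eq_abs]
  by_cases h : a i - ℓ ≤ y i
  · rw [abs_sub_comm]
    exact le_trans (by linarith [hi h, (hx i).2]) (le_abs_self _)
  · exact le_trans (by linarith [(hx i).1]) (le_abs_self _)

lemma IsCZKernel.continuousOn (hK : IsCZKernel K) (x : Eu n) : ContinuousOn (K x) {x}ᶜ := by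
  obtain ⟨C, δ, hδ, -, -, hreg⟩ := hK
  intro y hy
  refine ContinuousAt.continuousWithinAt (tendsto_iff_norm_sub_tendsto_zero.2 ?_)
  have hyx : 0 < ‖y - x‖ := norm_pos_iff.2 (sub_ne_zero.2 hy)
  have hlim : Filter.Tendsto (fun z => C * ‖y - z‖ ^ δ / ‖y - x‖ ^ ((n : ℝ) + δ)) (nhds y)
      (nhds 0) := by
    have : ContinuousAt (fun z => C * ‖y - z‖ ^ δ / ‖y - x‖ ^ ((n : ℝ) + δ)) y :=
      (continuousAt_const.mul (((continuous_const.sub continuous_id).norm.continuousAt).rpow_const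
        (Or.inr hδ.le))).div_const _
    simpa [Real.zero_rpow hδ.ne'] using this.tendsto
  refine squeeze_zero' (Filter.Eventually.of_forall fun z => norm_nonneg _) ?_ hlim
  filter_upwards [Metric.ball_mem_nhds y (half_pos hyx)] with z hz
  rw [norm_sub_rev]
  linarith [norm_nonneg (K y x - K z x), hreg y z x (mem_ball_iff_norm'.1 hz)]

lemma IsCZKernel.aestronglyMeasurable_mul (hK : IsCZKernel K) {x : Eu n} {h : Eu n → ℂ}
    (hh : AEStronglyMeasurable h volume) (hx : h x = 0) :
    AEStronglyMeasurable (fun y => K x y * h y) volume := by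
  have hKx : AEStronglyMeasurable (({x}ᶜ : Set (Eu n)).indicator (K x)) volume :=
    (aestronglyMeasurable_indicator_iff (measurableSet_singleton x).compl).2
      ((hK.continuousOn x).aestronglyMeasurable (measurableSet_singleton x).compl)
  refine (hKx.mul hh).congr (ae_of_all _ fun y => ?_)
  by_cases hy : y = x
  · simp [hy, hx]
  · simp [Set.indicator_of_mem (show y ∈ ({x}ᶜ : Set (Eu n)) from hy)]

lemma IsCZKernel.exists_norm_le (hK : IsCZKernel K) :
    ∃ C : ℝ, 0 ≤ C ∧ ∀ x y s, 0 < s → s ≤ ‖x - y‖ → ‖K x y‖ ≤ C / s ^ n := by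
  obtain ⟨C, -, -, -, hsize, -⟩ := hK
  refine ⟨|C|, abs_nonneg C, fun x y s hs hxy => ?_⟩
  have hne : x ≠ y := sub_ne_zero.1 (norm_pos_iff.1 (hs.trans_le hxy))
  calc ‖K x y‖ ≤ C / ‖x - y‖ ^ n := hsize x y hne
    _ ≤ |C| / ‖x - y‖ ^ n := by gcongr; exact le_abs_self C
    _ ≤ |C| / s ^ n := by gcongr

lemma IsCZKernel.integrable_mul (hK : IsCZKernel K) {x : Eu n} {h : Eu n → ℂ} {s : ℝ}
    (hs : 0 < s) (hint : Integrable h volume) (hx : ∀ y, h y ≠ 0 → s ≤ ‖x - y‖) :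
    Integrable (fun y => K x y * h y) volume := by
  obtain ⟨C, _hC, hsize⟩ := hK.exists_norm_le
  have hx0 : h x = 0 := by
    by_contra hne
    exact hs.not_ge (by simpa using hx x hne)
  refine (hint.norm.const_mul (C / s ^ n)).mono' (hK.aestronglyMeasurable_mul hint.1 hx0)
    (ae_of_all _ fun y => ?_)
  rw [norm_mul]
  by_cases hy : h y = 0
  · simp [hy]
  · gcongr
    exact hsize x y s hs (hx y hy)

/-- The size condition takes over where the regularity condition does not apply. -/
lemma IsCZKernel.exists_norm_sub_le (hK : IsCZKernel K) :
    ∃ C δ : ℝ, 0 ≤ C ∧ 0 < δ ∧ ∀ (x x' y : Eu n) (d s : ℝ), 0 < s → ‖x - x'‖ ≤ d →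
      s ≤ ‖x - y‖ → s ≤ ‖x' - y‖ → ‖K x y - K x' y‖ ≤ C * (d / s) ^ δ / s ^ n := by
  obtain ⟨C₁, hC₁, hsize⟩ := hK.exists_norm_le
  obtain ⟨C₂, δ, hδ, -, -, hreg⟩ := hK
  refine ⟨|C₂| + 2 * C₁ * 2 ^ δ, δ, by positivity, hδ, fun x x' y d s hs hxx hxy hxy' => ?_⟩
  have hd : 0 ≤ d := (norm_nonneg _).trans hxx
  rw [add_mul, add_div]
  by_cases hnear : ‖x - x'‖ < ‖x - y‖ / 2
  · refine le_add_of_le_of_nonneg ?_ (by positivity)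
    calc ‖K x y - K x' y‖ ≤ C₂ * ‖x - x'‖ ^ δ / ‖x - y‖ ^ ((n : ℝ) + δ) := by
          linarith [norm_nonneg (K y x - K y x'), hreg x x' y hnear]
      _ ≤ |C₂| * ‖x - x'‖ ^ δ / ‖x - y‖ ^ ((n : ℝ) + δ) := by gcongr; exact le_abs_self _
      _ ≤ |C₂| * d ^ δ / s ^ ((n : ℝ) + δ) := by gcongr
      _ = |C₂| * (d / s) ^ δ / s ^ n := by
          rw [Real.rpow_add hs, Real.rpow_natCast, Real.div_rpow hd hs.le]
          field_simp
  · refine le_add_of_nonneg_of_le (by positivity) ?_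
    have hone : 1 ≤ (2 * (d / s)) ^ δ := by
      refine Real.one_le_rpow ?_ hδ.le
      rw [← mul_div_assoc, one_le_div hs]
      linarith [not_lt.1 hnear]
    calc ‖K x y - K x' y‖ ≤ ‖K x y‖ + ‖K x' y‖ := norm_sub_le _ _
      _ ≤ C₁ / s ^ n + C₁ / s ^ n := add_le_add (hsize x y s hs hxy) (hsize x' y s hs hxy')
      _ = 2 * C₁ * 1 / s ^ n := by ring
      _ ≤ 2 * C₁ * (2 * (d / s)) ^ δ / s ^ n := by gcongr
      _ = 2 * C₁ * 2 ^ δ * (d / s) ^ δ / s ^ n := by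
          rw [Real.mul_rpow zero_le_two (by positivity)]; ring

lemma dyadicSide_div_dyadicSide {ℓ : ℝ} (hℓ : 0 < ℓ) {P S : DyadicIndex n} (h : S.1 ≤ P.1) :
    dyadicSide ℓ P / dyadicSide ℓ S = 2⁻¹ ^ (P.1 - S.1) := by
  obtain ⟨d, hd⟩ := Nat.exists_eq_add_of_le h
  simp only [dyadicSide, hd, pow_add, inv_pow, add_tsub_cancel_left]
  field_simp

lemma volume_dyadicTriple_of_succ (a : Eu n) {ℓ : ℝ} (hℓ : 0 < ℓ) {R S : DyadicIndex n}
    (h : S.1 = R.1 + 1) :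
    volume (dyadicTriple a ℓ R) = ENNReal.ofReal (6 ^ n * dyadicSide ℓ S ^ n) := by
  have hS := (dyadicSide_pos hℓ S).le
  have hside : 3 * dyadicSide ℓ R = 6 * dyadicSide ℓ S := by
    simp only [dyadicSide, h, pow_succ]; field_simp; norm_num
  rw [dyadicTriple, tripleCube, volume_cube, hside, ← ENNReal.ofReal_pow (by positivity), mul_pow]

lemma IsCZKernel.exists_enorm_sub_mul_volume_le (hK : IsCZKernel K) :
    ∃ c t : ℝ≥0∞, c ≠ ∞ ∧ t < 1 ∧ ∀ (a : Eu n) (ℓ : ℝ), 0 < ℓ → ∀ P R S : DyadicIndex n,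
      S.1 = R.1 + 1 → S.1 ≤ P.1 → dyadicCube a ℓ P ⊆ dyadicCube a ℓ S →
      ∀ x ∈ dyadicCube a ℓ P, ∀ x' ∈ dyadicCube a ℓ P, ∀ y ∉ dyadicTriple a ℓ S,
        ‖K x y - K x' y‖ₑ * volume (dyadicTriple a ℓ R) ≤ c * t ^ (P.1 - S.1) := by
  obtain ⟨C, δ, hC, hδ, hosc⟩ := hK.exists_norm_sub_le
  refine ⟨ENNReal.ofReal (C * √n ^ δ * 6 ^ n), ENNReal.ofReal ((2⁻¹ : ℝ) ^ δ),
    ENNReal.ofReal_ne_top,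
    ENNReal.ofReal_lt_one.2 (Real.rpow_lt_one (by norm_num) (by norm_num) hδ), ?_⟩
  intro a ℓ hℓ P R S hRS hSP hsub x hx x' hx' y hy
  have hSpos := dyadicSide_pos hℓ S
  have hPpos := dyadicSide_pos hℓ P
  rw [← ofReal_norm, volume_dyadicTriple_of_succ a hℓ hRS, ← ENNReal.ofReal_mul (norm_nonneg _),
    ← ENNReal.ofReal_pow (by positivity), ← ENNReal.ofReal_mul (by positivity)]
  refine ENNReal.ofReal_le_ofReal ?_
  calc ‖K x y - K x' y‖ * (6 ^ n * dyadicSide ℓ S ^ n)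
      ≤ C * (√n * dyadicSide ℓ P / dyadicSide ℓ S) ^ δ / dyadicSide ℓ S ^ n *
          (6 ^ n * dyadicSide ℓ S ^ n) := by
        gcongr
        exact hosc x x' y _ _ hSpos (norm_sub_le_of_mem_cube hPpos.le hx hx')
          (le_norm_sub_of_notMem_tripleCube (hsub hx) hy)
          (le_norm_sub_of_notMem_tripleCube (hsub hx') hy)
    _ = C * √n ^ δ * 6 ^ n * (dyadicSide ℓ P / dyadicSide ℓ S) ^ δ := by
        rw [mul_div_assoc (√(n : ℝ)) (dyadicSide ℓ P),
          Real.mul_rpow (by positivity) (by positivity)]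
        field_simp
    _ = C * √n ^ δ * 6 ^ n * (2⁻¹ ^ δ) ^ (P.1 - S.1) := by
        rw [dyadicSide_div_dyadicSide hℓ hSP, Real.rpow_pow_comm (by norm_num)]

lemma exists_mem_dyadicTriple_notMem_succ {a : Eu n} {ℓ : ℝ} (hℓ : 0 < ℓ) {P Q : DyadicIndex n}
    (hQP : Q.1 ≤ P.1) {x y : Eu n} (hxP : x ∈ dyadicCube a ℓ P) (hxQ : x ∈ dyadicCube a ℓ Q)
    (hyQ : y ∈ dyadicTriple a ℓ Q) (hyP : y ∉ dyadicTriple a ℓ P) :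
    ∃ j ∈ Finset.Ico Q.1 P.1, y ∈ dyadicTriple a ℓ (j, dyadicPos a ℓ j x) ∧
      y ∉ dyadicTriple a ℓ (j + 1, dyadicPos a ℓ (j + 1) x) := by
  have hat : ∀ R : DyadicIndex n, x ∈ dyadicCube a ℓ R → (R.1, dyadicPos a ℓ R.1 x) = R :=
    fun R hR => Prod.ext rfl ((mem_dyadicCube hℓ).1 hR)
  by_contra! hcon
  have hdesc : ∀ k, Q.1 ≤ k → k ≤ P.1 → y ∈ dyadicTriple a ℓ (k, dyadicPos a ℓ k x) := by
    intro k hQk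
    induction k, hQk using Nat.le_induction with
    | base => exact fun _ => (hat Q hxQ).symm ▸ hyQ
    | succ k hQk ih =>
      intro hk
      exact hcon k (Finset.mem_Ico.2 ⟨hQk, hk⟩) (ih (k.le_succ.trans hk))
  exact hyP (hat P hxP ▸ hdesc P.1 hQP le_rfl)

lemma sum_Ico_pow_sub_le_tsum (t : ℝ≥0∞) (k m : ℕ) :
    ∑ j ∈ Finset.Ico k m, t ^ (m - (j + 1)) ≤ ∑' i : ℕ, t ^ i := by
  rw [← Finset.sum_image (s := Finset.Ico k m) (g := fun j => m - (j + 1)) (f := fun i => t ^ i)]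
  · exact ENNReal.sum_le_tsum _
  · intro i hi j hj hij
    simp only [Finset.coe_Ico, Set.mem_Ico] at hi hj hij
    omega

lemma setLIntegral_dyadicTriple_diff_le {a : Eu n} {ℓ : ℝ} (hℓ : 0 < ℓ) {P Q : DyadicIndex n}
    (hQP : Q.1 ≤ P.1) {x : Eu n} (hxP : x ∈ dyadicCube a ℓ P) (hxQ : x ∈ dyadicCube a ℓ Q)
    {k F : Eu n → ℝ≥0∞} (hF : AEMeasurable F) {w : ℕ → ℝ≥0∞}
    (hk : ∀ j ∈ Finset.Ico Q.1 P.1, ∀ y ∉ dyadicTriple a ℓ (j + 1, dyadicPos a ℓ (j + 1) x),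
      k y * volume (dyadicTriple a ℓ (j, dyadicPos a ℓ j x)) ≤ w j) :
    ∫⁻ y in dyadicTriple a ℓ Q \ dyadicTriple a ℓ P, k y * F y ≤
      ∑ j ∈ Finset.Ico Q.1 P.1,
        w j * ∫⁻ y, F y ∂volume[|dyadicTriple a ℓ (j, dyadicPos a ℓ j x)] := by
  set R : ℕ → DyadicIndex n := fun j => (j, dyadicPos a ℓ j x)
  set d : ℕ → ℝ≥0∞ := fun j => w j / volume (dyadicTriple a ℓ (R j)) with hd
  set G : ℕ → Eu n → ℝ≥0∞ := fun j => (dyadicTriple a ℓ (R j)).indicator fun y => d j * F y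
  have hpointwise : ∀ y ∈ dyadicTriple a ℓ Q \ dyadicTriple a ℓ P,
      k y * F y ≤ ∑ j ∈ Finset.Ico Q.1 P.1, G j y := by
    rintro y ⟨hyQ, hyP⟩
    obtain ⟨j, hj, hyj, hyj'⟩ := exists_mem_dyadicTriple_notMem_succ hℓ hQP hxP hxQ hyQ hyP
    refine le_trans ?_ (Finset.single_le_sum (f := fun j => G j y) (fun _ _ => zero_le) hj)
    rw [show G j y = d j * F y from Set.indicator_of_mem hyj _]
    gcongr
    exact (ENNReal.le_div_iff_mul_le (Or.inl (volume_dyadicTriple_ne_zero hℓ _))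
      (Or.inl (volume_dyadicTriple_ne_top _))).2 (hk j hj y hyj')
  have hterm : ∀ j, ∫⁻ y, G j y = w j * ∫⁻ y, F y ∂volume[|dyadicTriple a ℓ (R j)] := by
    intro j
    rw [lintegral_indicator (measurableSet_dyadicTriple _ _ _), setLIntegral_dyadicTriple hℓ,
      lintegral_const_mul'' _ (hF.mono_ac ProbabilityTheory.cond_absolutelyContinuous),
      ← mul_assoc, hd, ENNReal.mul_div_cancel (volume_dyadicTriple_ne_zero hℓ _)
        (volume_dyadicTriple_ne_top _)]
  calc ∫⁻ y in dyadicTriple a ℓ Q \ dyadicTriple a ℓ P, k y * F y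
      ≤ ∫⁻ y in dyadicTriple a ℓ Q \ dyadicTriple a ℓ P, ∑ j ∈ Finset.Ico Q.1 P.1, G j y :=
        setLIntegral_mono' ((measurableSet_dyadicTriple _ _ _).diff
          (measurableSet_dyadicTriple _ _ _)) hpointwise
    _ ≤ ∫⁻ y, ∑ j ∈ Finset.Ico Q.1 P.1, G j y := setLIntegral_le_lintegral _ _
    _ = ∑ j ∈ Finset.Ico Q.1 P.1, ∫⁻ y, G j y :=
        lintegral_finsetSum' _ fun j _ =>
          (hF.const_mul _).indicator (measurableSet_dyadicTriple _ _ _)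
    _ = _ := Finset.sum_congr rfl fun j _ => hterm j

lemma IsCZKernel.exists_lintegral_enorm_sub_le (hK : IsCZKernel K) :
    ∃ C : ℝ≥0, ∀ (a : Eu n) (ℓ : ℝ), 0 < ℓ → ∀ P Q : DyadicIndex n, Q.1 ≤ P.1 →
      dyadicCube a ℓ P ⊆ dyadicCube a ℓ Q → ∀ F : Eu n → ℝ≥0∞, AEMeasurable F → ∀ B : ℝ≥0∞,
      (∀ R : DyadicIndex n, Q.1 ≤ R.1 → R.1 < P.1 → dyadicCube a ℓ P ⊆ dyadicCube a ℓ R →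
        ∫⁻ y, F y ∂volume[|dyadicTriple a ℓ R] ≤ B) →
      ∀ x ∈ dyadicCube a ℓ P, ∀ x' ∈ dyadicCube a ℓ P,
        ∫⁻ y in dyadicTriple a ℓ Q \ dyadicTriple a ℓ P, ‖K x y - K x' y‖ₑ * F y ≤ C * B := by
  obtain ⟨c, t, hc, ht, hosc⟩ := hK.exists_enorm_sub_mul_volume_le
  have hC : c * ∑' i : ℕ, t ^ i ≠ ∞ := by
    have : (1 - t)⁻¹ ≠ ∞ := ENNReal.inv_ne_top.2 (tsub_pos_of_lt ht).ne'
    rw [ENNReal.tsum_geometric]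
    finiteness
  refine ⟨(c * ∑' i : ℕ, t ^ i).toNNReal, ?_⟩
  rw [ENNReal.coe_toNNReal hC]
  intro a ℓ hℓ P Q hQP hPQ F hF B hB x hx x' hx'
  set R : ℕ → DyadicIndex n := fun j => (j, dyadicPos a ℓ j x)
  have hPR : ∀ j ≤ P.1, dyadicCube a ℓ P ⊆ dyadicCube a ℓ (R j) := fun j hj =>
    dyadicCube_subset_of_mem hℓ hj (mem_dyadicCube_dyadicPos hℓ j x) hx
  calc ∫⁻ y in dyadicTriple a ℓ Q \ dyadicTriple a ℓ P, ‖K x y - K x' y‖ₑ * F y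
      ≤ ∑ j ∈ Finset.Ico Q.1 P.1,
          c * t ^ (P.1 - (j + 1)) * ∫⁻ y, F y ∂volume[|dyadicTriple a ℓ (R j)] := by
        refine setLIntegral_dyadicTriple_diff_le hℓ hQP hx (hPQ hx) hF fun j hj y hy => ?_
        have hjP : j + 1 ≤ P.1 := (Finset.mem_Ico.1 hj).2
        exact hosc a ℓ hℓ P (R j) (R (j + 1)) rfl hjP (hPR _ hjP) x hx x' hx' y hy
    _ ≤ ∑ j ∈ Finset.Ico Q.1 P.1, c * t ^ (P.1 - (j + 1)) * B := by
        refine Finset.sum_le_sum fun j hj => ?_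
        rw [Finset.mem_Ico] at hj
        gcongr
        exact hB (R j) hj.1 hj.2 (hPR j hj.2.le)
    _ = c * (∑ j ∈ Finset.Ico Q.1 P.1, t ^ (P.1 - (j + 1))) * B := by
        rw [Finset.mul_sum, Finset.sum_mul]
    _ ≤ c * (∑' i : ℕ, t ^ i) * B := by
        gcongr
        exact sum_Ico_pow_sub_le_tsum t Q.1 P.1

end Kernel

/-! ### Stopping cubes -/

section Stopping

variable {n : ℕ} {a : Eu n} {ℓ : ℝ} {P Q R : DyadicIndex n} {U : Set (Eu n)}

/-- The set `U` occupies a proportion of more than `2⁻⁽ⁿ⁺¹⁾` of the dyadic cube `P`. -/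
def IsDenseIn (a : Eu n) (ℓ : ℝ) (U : Set (Eu n)) (P : DyadicIndex n) : Prop :=
  (2 ^ (n + 1))⁻¹ * volume (dyadicCube a ℓ P) < volume (dyadicCube a ℓ P ∩ U)

/-- The stopping cubes of `Q` relative to `U`: the maximal dyadic proper subcubes of `Q` in which
`U` is dense. -/
def stoppingCubes (a : Eu n) (ℓ : ℝ) (U : Set (Eu n)) (Q : DyadicIndex n) :
    Set (DyadicIndex n) :=
  {P | Q.1 < P.1 ∧ dyadicCube a ℓ P ⊆ dyadicCube a ℓ Q ∧ IsDenseIn a ℓ U P ∧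
    ∀ R : DyadicIndex n, Q.1 < R.1 → R.1 < P.1 → dyadicCube a ℓ P ⊆ dyadicCube a ℓ R →
      ¬ IsDenseIn a ℓ U R}

lemma exists_dyadicCube_subset_of_isOpen (hℓ : 0 < ℓ) (hU : IsOpen U) {x : Eu n} (hx : x ∈ U)
    (k₀ : ℕ) : ∃ k, k₀ < k ∧ dyadicCube a ℓ (k, dyadicPos a ℓ k x) ⊆ U := by
  obtain ⟨ε, hε, hball⟩ := Metric.isOpen_iff.1 hU x hx
  have hlim : Filter.Tendsto (fun k : ℕ => √(n : ℝ) * (ℓ / 2 ^ k)) Filter.atTop (nhds 0) := by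
    have hpow := (tendsto_pow_atTop_nhds_zero_of_lt_one (r := (1 / 2 : ℝ)) (by norm_num)
      (by norm_num)).const_mul (√(n : ℝ) * ℓ)
    rw [mul_zero] at hpow
    refine hpow.congr fun k => ?_
    rw [one_div, inv_pow]; ring
  obtain ⟨k, hk, hk₀⟩ := ((hlim.eventually_lt_const hε).and
    (Filter.eventually_gt_atTop k₀)).exists
  refine ⟨k, hk₀, fun y hy => hball ?_⟩
  rw [mem_ball_iff_norm]
  exact (norm_sub_le_of_mem_cube (dyadicSide_pos hℓ _).le hy
    (mem_dyadicCube_dyadicPos hℓ k x)).trans_lt hk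

lemma isDenseIn_of_subset (hℓ : 0 < ℓ) (hP : dyadicCube a ℓ P ⊆ U) : IsDenseIn a ℓ U P := by
  rw [IsDenseIn, Set.inter_eq_left.2 hP]
  conv_rhs => rw [← one_mul (volume (dyadicCube a ℓ P))]
  refine ENNReal.mul_lt_mul_left (volume_dyadicCube_ne_zero hℓ P) (volume_dyadicCube_ne_top P) ?_
  rw [ENNReal.inv_lt_one]
  exact one_lt_pow₀ (by norm_num) (by omega)

lemma not_isDenseIn_of_volume_le
    (hU : volume U ≤ (2 ^ (n + 2))⁻¹ * volume (dyadicCube a ℓ Q)) : ¬ IsDenseIn a ℓ U Q := by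
  refine not_lt.2 ((measure_mono Set.inter_subset_right).trans (hU.trans ?_))
  gcongr
  · norm_num
  · omega

lemma pairwiseDisjoint_stoppingCubes (hℓ : 0 < ℓ) :
    (stoppingCubes a ℓ U Q).PairwiseDisjoint (dyadicCube a ℓ) := by
  intro P hP R hR hne
  refine Set.disjoint_left.2 fun x hxP hxR => hne ?_
  rcases lt_trichotomy P.1 R.1 with h | h | h
  · exact absurd hP.2.2.1 (hR.2.2.2 P hP.1 h (dyadicCube_subset_of_mem hℓ h.le hxP hxR))
  · exact eq_of_mem_dyadicCube hℓ h hxP hxR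
  · exact absurd hR.2.2.1 (hP.2.2.2 R hR.1 h (dyadicCube_subset_of_mem hℓ h.le hxR hxP))

lemma not_isDenseIn_of_mem_stoppingCubes (hℓ : 0 < ℓ) (hQ : ¬ IsDenseIn a ℓ U Q)
    (hP : P ∈ stoppingCubes a ℓ U Q) (hQR : Q.1 ≤ R.1) (hRP : R.1 < P.1)
    (hPR : dyadicCube a ℓ P ⊆ dyadicCube a ℓ R) : ¬ IsDenseIn a ℓ U R := by
  rcases hQR.lt_or_eq with h | h
  · exact hP.2.2.2 R h hRP hPR
  · have hc := dyadicCorner_mem_dyadicCube (a := a) hℓ P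
    rwa [← eq_of_mem_dyadicCube hℓ h (hP.2.1 hc) (hPR hc)]

lemma not_subset_of_mem_stoppingCubes (hℓ : 0 < ℓ) (hQ : ¬ IsDenseIn a ℓ U Q)
    (hP : P ∈ stoppingCubes a ℓ U Q) (hQR : Q.1 ≤ R.1) (hRP : R.1 < P.1)
    (hPR : dyadicCube a ℓ P ⊆ dyadicCube a ℓ R) : ¬ dyadicCube a ℓ R ⊆ U := fun hRU =>
  not_isDenseIn_of_mem_stoppingCubes hℓ hQ hP hQR hRP hPR (isDenseIn_of_subset hℓ hRU)

lemma tsum_volume_stoppingCubes_le (hℓ : 0 < ℓ) (hU : MeasurableSet U)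
    (hUQ : volume U ≤ (2 ^ (n + 2))⁻¹ * volume (dyadicCube a ℓ Q)) :
    ∑' P : stoppingCubes a ℓ U Q, volume (dyadicCube a ℓ P.1) ≤
      2⁻¹ * volume (dyadicCube a ℓ Q) := by
  have h2 : (2 : ℝ≥0∞) ^ (n + 1) ≠ 0 := by positivity
  have h2t : (2 : ℝ≥0∞) ^ (n + 1) ≠ ∞ := by finiteness
  calc ∑' P : stoppingCubes a ℓ U Q, volume (dyadicCube a ℓ P.1)
      ≤ ∑' P : stoppingCubes a ℓ U Q, 2 ^ (n + 1) * volume (dyadicCube a ℓ P.1 ∩ U) :=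
        ENNReal.tsum_le_tsum fun P => (ENNReal.inv_mul_le_iff h2 h2t).1 P.2.2.2.1.le
    _ = 2 ^ (n + 1) * volume (⋃ P ∈ stoppingCubes a ℓ U Q, dyadicCube a ℓ P ∩ U) := by
        rw [ENNReal.tsum_mul_left, measure_biUnion (stoppingCubes a ℓ U Q).to_countable
          ((pairwiseDisjoint_stoppingCubes hℓ).mono fun P => Set.inter_subset_left)
          (fun P _ => (measurableSet_dyadicCube a ℓ P).inter hU)]
    _ ≤ 2 ^ (n + 1) * ((2 ^ (n + 2))⁻¹ * volume (dyadicCube a ℓ Q)) := by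
        gcongr
        exact (measure_mono (Set.iUnion₂_subset fun P _ => Set.inter_subset_right)).trans hUQ
    _ = 2⁻¹ * volume (dyadicCube a ℓ Q) := by
        rw [← mul_assoc, pow_succ 2 (n + 1), ENNReal.mul_inv (Or.inl h2) (Or.inl h2t),
          ← mul_assoc, ENNReal.mul_inv_cancel h2 h2t, one_mul]

/-- The dyadic parent of a stopping cube is not dense, and it is only `2ⁿ` times as large. -/
lemma volume_inter_le_of_mem_stoppingCubes (hℓ : 0 < ℓ) (hQ : ¬ IsDenseIn a ℓ U Q)
    (hP : P ∈ stoppingCubes a ℓ U Q) :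
    volume (dyadicCube a ℓ P ∩ U) ≤ 2⁻¹ * volume (dyadicCube a ℓ P) := by
  obtain ⟨k, hk⟩ : ∃ k, P.1 = k + 1 := Nat.exists_eq_succ_of_ne_zero (by have := hP.1; omega)
  set R : DyadicIndex n := (k, dyadicPos a ℓ k (dyadicCorner a ℓ P))
  have hRP : R.1 < P.1 := by rw [hk]; exact k.lt_succ_self
  have hQR : Q.1 ≤ R.1 := Nat.lt_succ_iff.1 (lt_of_lt_of_eq hP.1 hk)
  have hPR : dyadicCube a ℓ P ⊆ dyadicCube a ℓ R := dyadicCube_subset_of_mem hℓ hRP.le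
    (mem_dyadicCube_dyadicPos hℓ k _) (dyadicCorner_mem_dyadicCube hℓ P)
  calc volume (dyadicCube a ℓ P ∩ U)
      ≤ volume (dyadicCube a ℓ R ∩ U) := measure_mono (Set.inter_subset_inter_left U hPR)
    _ ≤ (2 ^ (n + 1))⁻¹ * volume (dyadicCube a ℓ R) :=
        not_lt.1 (not_isDenseIn_of_mem_stoppingCubes hℓ hQ hP hQR hRP hPR)
    _ = 2⁻¹ * volume (dyadicCube a ℓ P) := by
        have h2 : (2 : ℝ≥0∞) ^ n ≠ 0 := by positivity
        have h2t : (2 : ℝ≥0∞) ^ n ≠ ∞ := by finiteness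
        rw [volume_dyadicCube_of_succ (Q := R) (R := P) hk, ← mul_assoc, pow_succ,
          mul_comm ((2 : ℝ≥0∞) ^ n) 2, ENNReal.mul_inv (Or.inl (by norm_num))
          (Or.inl (by norm_num)), mul_assoc 2⁻¹, ENNReal.inv_mul_cancel h2 h2t, mul_one]

lemma exists_mem_stoppingCubes (hℓ : 0 < ℓ) (hU : IsOpen U) {x : Eu n}
    (hxQ : x ∈ dyadicCube a ℓ Q) (hxU : x ∈ U) :
    ∃ P ∈ stoppingCubes a ℓ U Q, x ∈ dyadicCube a ℓ P := by
  classical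
  have hex : ∃ k, Q.1 < k ∧ IsDenseIn a ℓ U (k, dyadicPos a ℓ k x) := by
    obtain ⟨k, hk, hsub⟩ := exists_dyadicCube_subset_of_isOpen (a := a) hℓ hU hxU Q.1
    exact ⟨k, hk, isDenseIn_of_subset hℓ hsub⟩
  obtain ⟨hlt, hdense⟩ := Nat.find_spec hex
  have hx := mem_dyadicCube_dyadicPos (a := a) hℓ (Nat.find hex) x
  refine ⟨(Nat.find hex, dyadicPos a ℓ (Nat.find hex) x),
    ⟨hlt, dyadicCube_subset_of_mem hℓ hlt.le hxQ hx, hdense, fun R hQR hRk hsub hR => ?_⟩, hx⟩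
  refine Nat.find_min hex hRk ⟨hQR, ?_⟩
  rwa [show (R.1, dyadicPos a ℓ R.1 x) = R from Prod.ext rfl ((mem_dyadicCube hℓ).1 (hsub hx))]

end Stopping

/-! ### Sublinearity and kernel bounds for the maximal modulation -/

/-- `T` is linear on `L²` and represented by the kernel `K` off the support of the function. -/
structure IsRepresentedBy {n : ℕ} (T : (Eu n → ℂ) → Eu n → ℂ) (K : Eu n → Eu n → ℂ) : Prop where
  map_add : ∀ f g, MemLp f 2 volume → MemLp g 2 volume → T (f + g) = T f + T g
  map_smul : ∀ (c : ℂ) (f), MemLp f 2 volume → T (c • f) = c • T f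
  apply_eq_integral : ∀ f, MemLp f 2 volume → ∀ x, x ∉ tsupport f → T f x = ∫ y, K x y * f y

section MaxMod

variable {n : ℕ} {ι : Type*} {T : (Eu n → ℂ) → Eu n → ℂ} {K : Eu n → Eu n → ℂ}
  {φ : ι → Eu n → ℝ} {θ : Eu n → ℝ} {f g : Eu n → ℂ}

lemma norm_modulate (θ : Eu n → ℝ) (f : Eu n → ℂ) (x : Eu n) : ‖modulate θ f x‖ = ‖f x‖ := by
  rw [modulate, norm_mul, show 2 * Real.pi * Complex.I * (θ x : ℂ) =
    ((2 * Real.pi * θ x : ℝ) : ℂ) * Complex.I by push_cast; ring, Complex.norm_exp_ofReal_mul_I,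
    one_mul]

lemma enorm_modulate (θ : Eu n → ℝ) (f : Eu n → ℂ) (x : Eu n) : ‖modulate θ f x‖ₑ = ‖f x‖ₑ := by
  rw [← ofReal_norm, norm_modulate, ofReal_norm]

lemma modulate_apply_eq_zero {x : Eu n} : modulate θ f x = 0 ↔ f x = 0 := by
  rw [← norm_eq_zero, norm_modulate, norm_eq_zero]

lemma tsupport_modulate (θ : Eu n → ℝ) (f : Eu n → ℂ) : tsupport (modulate θ f) = tsupport f := by
  simp only [tsupport, Function.support, ne_eq, modulate_apply_eq_zero]

lemma modulate_add (θ : Eu n → ℝ) (f g : Eu n → ℂ) :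
    modulate θ (f + g) = modulate θ f + modulate θ g := by
  ext x; simp [modulate, mul_add]

lemma modulate_neg (θ : Eu n → ℝ) (f : Eu n → ℂ) :
    modulate θ (-f) = (-1 : ℂ) • modulate θ f := by
  ext x; simp [modulate]

lemma aestronglyMeasurable_modulate (hθ : Measurable θ) (hf : AEStronglyMeasurable f volume) :
    AEStronglyMeasurable (modulate θ f) volume := by
  have : Measurable fun x => Complex.exp (2 * Real.pi * Complex.I * (θ x : ℂ)) := by fun_prop
  exact this.aestronglyMeasurable.mul hf

lemma memLp_modulate (hθ : Measurable θ) {q : ℝ≥0∞} (hf : MemLp f q volume) :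
    MemLp (modulate θ f) q volume :=
  hf.of_le (aestronglyMeasurable_modulate hθ hf.1) (ae_of_all _ fun x => (norm_modulate θ f x).le)

lemma maxMod_add_le (hT : IsRepresentedBy T K) (hφ : ∀ α, Measurable (φ α))
    (hf : MemLp f 2 volume) (hg : MemLp g 2 volume) (x : Eu n) :
    maxMod T φ (f + g) x ≤ maxMod T φ f x + maxMod T φ g x := by
  refine iSup_le fun α => ?_
  rw [modulate_add, hT.map_add _ _ (memLp_modulate (hφ α) hf) (memLp_modulate (hφ α) hg)]
  exact (enorm_add_le _ _).trans (add_le_add (le_iSup (fun α => ‖T (modulate (φ α) f) x‖ₑ) α)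
    (le_iSup (fun α => ‖T (modulate (φ α) g) x‖ₑ) α))

lemma maxMod_neg (hT : IsRepresentedBy T K) (hφ : ∀ α, Measurable (φ α))
    (hf : MemLp f 2 volume) (x : Eu n) : maxMod T φ (-f) x = maxMod T φ f x := by
  refine iSup_congr fun α => ?_
  rw [modulate_neg, hT.map_smul _ _ (memLp_modulate (hφ α) hf)]
  simp

lemma maxMod_sub_le (hT : IsRepresentedBy T K) (hφ : ∀ α, Measurable (φ α))
    (hf : MemLp f 2 volume) (hg : MemLp g 2 volume) (x : Eu n) :
    maxMod T φ (f - g) x ≤ maxMod T φ f x + maxMod T φ g x := by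
  rw [sub_eq_add_neg, ← maxMod_neg hT hφ hg]
  exact maxMod_add_le hT hφ hf hg.neg x

lemma maxMod_le_add_sub (hT : IsRepresentedBy T K) (hφ : ∀ α, Measurable (φ α))
    (hf : MemLp f 2 volume) (hg : MemLp g 2 volume) (x : Eu n) :
    maxMod T φ f x ≤ maxMod T φ g x + maxMod T φ (f - g) x := by
  simpa only [add_sub_cancel] using maxMod_add_le hT hφ hg (hf.sub hg) x

lemma notMem_tsupport_of_le {x : Eu n} {s : ℝ} (hs : 0 < s)
    (hx : ∀ y, f y ≠ 0 → s ≤ ‖x - y‖) : x ∉ tsupport f := by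
  rw [notMem_tsupport_iff_eventuallyEq]
  filter_upwards [Metric.ball_mem_nhds x hs] with y hy
  by_contra hne
  exact (hx y hne).not_gt (mem_ball_iff_norm'.1 hy)

lemma maxMod_le_lintegral (hT : IsRepresentedBy T K) (hφ : ∀ α, Measurable (φ α))
    (hf : MemLp f 2 volume) {x : Eu n} (hx : x ∉ tsupport f) :
    maxMod T φ f x ≤ ∫⁻ y, ‖K x y‖ₑ * ‖f y‖ₑ := by
  refine iSup_le fun α => ?_
  rw [hT.apply_eq_integral _ (memLp_modulate (hφ α) hf) x (by rwa [tsupport_modulate])]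
  refine (enorm_integral_le_lintegral_enorm _).trans_eq ?_
  simp_rw [enorm_mul, enorm_modulate]

lemma maxMod_le_add_lintegral (hT : IsRepresentedBy T K) (hK : IsCZKernel K)
    (hφ : ∀ α, Measurable (φ α)) (hf : MemLp f 2 volume) (hint : Integrable f volume)
    {x x' : Eu n} {s : ℝ} (hs : 0 < s) (hx : ∀ y, f y ≠ 0 → s ≤ ‖x - y‖)
    (hx' : ∀ y, f y ≠ 0 → s ≤ ‖x' - y‖) :
    maxMod T φ f x ≤ maxMod T φ f x' + ∫⁻ y, ‖K x y - K x' y‖ₑ * ‖f y‖ₑ := by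
  refine iSup_le fun α => ?_
  have hm : MemLp (modulate (φ α) f) 2 volume := memLp_modulate (hφ α) hf
  have hKint {z : Eu n} (hz : ∀ y, f y ≠ 0 → s ≤ ‖z - y‖) :
      Integrable (fun y => K z y * modulate (φ α) f y) volume :=
    hK.integrable_mul hs (hint.mono (aestronglyMeasurable_modulate (hφ α) hint.1)
      (ae_of_all _ fun y => (norm_modulate _ _ y).le)) fun y hy =>
        hz y (mt modulate_apply_eq_zero.2 hy)
  have hrep {z : Eu n} (hz : ∀ y, f y ≠ 0 → s ≤ ‖z - y‖) :
      T (modulate (φ α) f) z = ∫ y, K z y * modulate (φ α) f y :=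
    hT.apply_eq_integral _ hm z (by
      rw [tsupport_modulate]; exact notMem_tsupport_of_le hs hz)
  have hdiff : T (modulate (φ α) f) x =
      T (modulate (φ α) f) x' + ∫ y, (K x y - K x' y) * modulate (φ α) f y := by
    simp_rw [hrep hx, hrep hx', sub_mul, integral_sub (hKint hx) (hKint hx'), add_sub_cancel]
  calc ‖T (modulate (φ α) f) x‖ₑ
      ≤ ‖T (modulate (φ α) f) x'‖ₑ + ‖∫ y, (K x y - K x' y) * modulate (φ α) f y‖ₑ :=
        hdiff ▸ enorm_add_le _ _
    _ ≤ maxMod T φ f x' + ∫⁻ y, ‖(K x y - K x' y) * modulate (φ α) f y‖ₑ :=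
        add_le_add (le_iSup (fun α => ‖T (modulate (φ α) f) x'‖ₑ) α)
          (enorm_integral_le_lintegral_enorm _)
    _ = maxMod T φ f x' + ∫⁻ y, ‖K x y - K x' y‖ₑ * ‖f y‖ₑ := by
        simp_rw [enorm_mul, enorm_modulate]

end MaxMod

/-! ### Sparse families -/

section Sparse

variable {X ι : Type*}

/-- The sparse operator `∑_{i ∈ S} b i 1_{Q i}`. -/
def sparseSum (Q : ι → Set X) (S : Set ι) (b : ι → ℝ≥0∞) (x : X) : ℝ≥0∞ :=
  ∑' i : S, (Q i).indicator (fun _ => b i) x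

lemma sparseSum_const_mul (Q : ι → Set X) (S : Set ι) (c : ℝ≥0∞) (b : ι → ℝ≥0∞) (x : X) :
    sparseSum Q S (fun i => c * b i) x = c * sparseSum Q S b x := by
  simp only [sparseSum, Set.indicator_const_mul, ENNReal.tsum_mul_left]

variable [MeasurableSpace X] {μ : Measure X} {Q : ι → Set X}

/-- The sets `Q i`, `i ∈ S`, form a sparse family: they have disjoint parts that carry at least
half of their measure. -/
def IsSparse (μ : Measure X) (Q : ι → Set X) (S : Set ι) : Prop :=
  ∃ E : ι → Set X, (∀ i ∈ S, MeasurableSet (E i) ∧ E i ⊆ Q i ∧ μ (Q i) ≤ 2 * μ (E i)) ∧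
    S.PairwiseDisjoint E

lemma measurable_sparseSum [Countable ι] (hQ : ∀ i, MeasurableSet (Q i)) (S : Set ι)
    (b : ι → ℝ≥0∞) : Measurable (sparseSum Q S b) :=
  Measurable.tsum fun i => measurable_const.indicator (hQ i)

lemma lintegral_sparseSum_mul [Countable ι] (hQ : ∀ i, MeasurableSet (Q i)) (S : Set ι)
    (b : ι → ℝ≥0∞) {w : X → ℝ≥0∞} (hw : AEMeasurable w μ) :
    ∫⁻ x, sparseSum Q S b x * w x ∂μ = ∑' i : S, b i * ∫⁻ x in Q i, w x ∂μ := by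
  simp only [sparseSum, ← ENNReal.tsum_mul_right]
  refine (lintegral_tsum fun i : S =>
    (measurable_const.indicator (hQ i)).aemeasurable.mul hw).trans (tsum_congr fun i => ?_)
  rw [← lintegral_const_mul'' _ hw.restrict, ← lintegral_indicator (hQ i)]
  exact lintegral_congr fun x => (Set.indicator_mul_left _ _ _).symm

lemma IsSparse.tsum_mul_measure_le [Countable ι] {S : Set ι} (hS : IsSparse μ Q S)
    {c : ι → ℝ≥0∞} {F : X → ℝ≥0∞} (hc : ∀ i, ∀ x ∈ Q i, c i ≤ F x) :
    ∑' i : S, c i * μ (Q i) ≤ 2 * ∫⁻ x, F x ∂μ := by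
  obtain ⟨E, hE, hdisj⟩ := hS
  calc ∑' i : S, c i * μ (Q i) ≤ ∑' i : S, 2 * ∫⁻ x in E i, F x ∂μ := by
        refine ENNReal.tsum_le_tsum fun i => ?_
        obtain ⟨hEm, hEQ, hvol⟩ := hE i i.2
        calc c i * μ (Q i) ≤ c i * (2 * μ (E i)) := by gcongr
          _ = 2 * ∫⁻ _ in E i, c i ∂μ := by rw [setLIntegral_const]; ring
          _ ≤ 2 * ∫⁻ x in E i, F x ∂μ := by
            gcongr 2 * ?_
            exact setLIntegral_mono' hEm fun x hx => hc i x (hEQ hx)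
    _ = 2 * ∫⁻ x in ⋃ i ∈ S, E i, F x ∂μ := by
        rw [ENNReal.tsum_mul_left,
          lintegral_biUnion S.to_countable (fun i hi => (hE i hi).1) hdisj]
    _ ≤ 2 * ∫⁻ x, F x ∂μ := by
        gcongr
        exact Measure.restrict_le_self

/-- A tree of sets in which the children of a set are disjoint subsets that fill at most half
of it. -/
structure IsHalvingTree (μ : Measure X) (Q : ι → Set X) (child : ι → Set ι) : Prop where
  measurableSet : ∀ i, MeasurableSet (Q i)
  measure_ne_zero : ∀ i, μ (Q i) ≠ 0
  measure_ne_top : ∀ i, μ (Q i) ≠ ∞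
  subset : ∀ i, ∀ j ∈ child i, Q j ⊆ Q i
  pairwiseDisjoint : ∀ i, (child i).PairwiseDisjoint Q
  tsum_measure_le : ∀ i, ∑' j : child i, μ (Q j) ≤ 2⁻¹ * μ (Q i)

/-- The descendants of `i`, including `i` itself, when `child` lists the immediate ones. -/
def descendants (child : ι → Set ι) (i : ι) : Set ι :=
  {j | Relation.ReflTransGen (fun k l => l ∈ child k) i j}

namespace IsHalvingTree

variable {child : ι → Set ι}

lemma subset_of_mem_descendants (h : IsHalvingTree μ Q child) {i j : ι}
    (hj : j ∈ descendants child i) : Q j ⊆ Q i :=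
  Relation.ReflTransGen.head_induction_on (motive := fun k _ => Q j ⊆ Q k) hj subset_rfl
    fun hkl _ ih => ih.trans (h.subset _ _ hkl)

lemma measure_le_two_mul_measure_diff [Countable ι] (h : IsHalvingTree μ Q child) (i : ι) :
    μ (Q i) ≤ 2 * μ (Q i \ ⋃ j ∈ child i, Q j) := by
  have hhalf : μ (⋃ j ∈ child i, Q j) ≤ 2⁻¹ * μ (Q i) :=
    (measure_biUnion_le _ (child i).to_countable _).trans (h.tsum_measure_le i)
  have hrest : 2⁻¹ * μ (Q i) ≤ μ (Q i \ ⋃ j ∈ child i, Q j) := by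
    refine (ENNReal.le_sub_of_add_le_left (by finiteness [h.measure_ne_top i]) ?_).trans
      ((tsub_le_tsub_left hhalf _).trans le_measure_sdiff)
    rw [← add_mul, ENNReal.inv_two_add_inv_two, one_mul]
  calc μ (Q i) = 2 * (2⁻¹ * μ (Q i)) := by
        rw [← mul_assoc, ENNReal.mul_inv_cancel two_ne_zero ENNReal.ofNat_ne_top, one_mul]
    _ ≤ _ := by gcongr

lemma pairwiseDisjoint_descendants (h : IsHalvingTree μ Q child) (i : ι) :
    (descendants child i).PairwiseDisjoint fun j => Q j \ ⋃ k ∈ child j, Q k := by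
  have hroot {i k j : ι} (hk : k ∈ child i) (hj : j ∈ descendants child k) :
      Disjoint (Q i \ ⋃ k ∈ child i, Q k) (Q j \ ⋃ k ∈ child j, Q k) :=
    Set.disjoint_sdiff_left.mono_right <| Set.sdiff_subset.trans <|
      (h.subset_of_mem_descendants hj).trans (Set.subset_biUnion_of_mem hk)
  intro j hj
  induction hj using Relation.ReflTransGen.head_induction_on with
  | refl =>
    intro l hl hne
    obtain rfl | ⟨k, hk, hkl⟩ := Relation.ReflTransGen.cases_head hl
    · exact absurd rfl hne
    · exact hroot hk hkl
  | @head i k hk hkj ih =>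
    intro l hl hne
    obtain rfl | ⟨k', hk', hkl⟩ := Relation.ReflTransGen.cases_head hl
    · exact (hroot hk hkj).symm
    · obtain rfl | hkk' := eq_or_ne k' k
      · exact ih hkl hne
      · exact (h.pairwiseDisjoint _ hk' hk hkk').symm.mono
          (Set.sdiff_subset.trans (h.subset_of_mem_descendants hkj))
          (Set.sdiff_subset.trans (h.subset_of_mem_descendants hkl))

lemma isSparse_descendants [Countable ι] (h : IsHalvingTree μ Q child) (i : ι) :
    IsSparse μ Q (descendants child i) :=
  ⟨fun j => Q j \ ⋃ k ∈ child j, Q k, fun j _ =>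
    ⟨(h.measurableSet j).diff (.biUnion (child j).to_countable fun k _ => h.measurableSet k),
      Set.sdiff_subset, h.measure_le_two_mul_measure_diff j⟩, h.pairwiseDisjoint_descendants i⟩

lemma notMem_descendants_of_mem (h : IsHalvingTree μ Q child) {i j : ι} (hj : j ∈ child i) :
    i ∉ descendants child j := by
  intro hi
  have hle : μ (Q i) ≤ 2⁻¹ * μ (Q i) :=
    calc μ (Q i) ≤ μ (Q j) := measure_mono (h.subset_of_mem_descendants hi)
      _ ≤ ∑' k : child i, μ (Q k) := ENNReal.le_tsum (⟨j, hj⟩ : child i)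
      _ ≤ 2⁻¹ * μ (Q i) := h.tsum_measure_le i
  rw [mul_comm, ← div_eq_mul_inv] at hle
  exact hle.not_gt (ENNReal.half_lt_self (h.measure_ne_zero i) (h.measure_ne_top i))

lemma add_sparseSum_le (h : IsHalvingTree μ Q child) (b : ι → ℝ≥0∞) {i j : ι} {x : X}
    (hx : x ∈ Q i) (hj : j ∈ child i) :
    b i + sparseSum Q (descendants child j) b x ≤ sparseSum Q (descendants child i) b x := by
  have hsub : {i} ∪ descendants child j ⊆ descendants child i := Set.union_subset
    (Set.singleton_subset_iff.2 .refl) fun k hk => Relation.ReflTransGen.head hj hk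
  have hdisj : Disjoint {i} (descendants child j) :=
    Set.disjoint_singleton_left.2 (h.notMem_descendants_of_mem hj)
  refine le_trans (le_of_eq ?_)
    (ENNReal.tsum_mono_subtype (fun k => (Q k).indicator (fun _ => b k) x) hsub)
  rw [ENNReal.summable.tsum_union_disjoint (f := fun k => (Q k).indicator (fun _ => b k) x) hdisj
    ENNReal.summable, tsum_singleton i (fun k => (Q k).indicator (fun _ => b k) x),
    Set.indicator_of_mem hx, sparseSum]

lemma measure_eq_zero_of_subset [Countable ι] (h : IsHalvingTree μ Q child) {Z : ι → Set X}
    (hZQ : ∀ i, Z i ⊆ Q i) (hZ : ∀ i, Z i ⊆ ⋃ j ∈ child i, Z j) (i : ι) : μ (Z i) = 0 := by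
  set θ : ℝ≥0∞ := ⨆ i, μ (Z i) / μ (Q i)
  have hθ1 : θ ≤ 1 :=
    iSup_le fun i => ENNReal.div_le_of_le_mul (by simpa using measure_mono (hZQ i))
  have hle (i : ι) : μ (Z i) ≤ θ * μ (Q i) :=
    (ENNReal.div_le_iff (h.measure_ne_zero i) (h.measure_ne_top i)).1
      (le_iSup (fun i => μ (Z i) / μ (Q i)) i)
  have hhalf : θ ≤ θ / 2 := iSup_le fun i => ENNReal.div_le_of_le_mul <|
    calc μ (Z i) ≤ ∑' j : child i, μ (Z j) :=
          (measure_mono (hZ i)).trans (measure_biUnion_le _ (child i).to_countable _)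
      _ ≤ ∑' j : child i, θ * μ (Q j) := ENNReal.tsum_le_tsum fun j => hle j
      _ ≤ θ * (2⁻¹ * μ (Q i)) := by
          rw [ENNReal.tsum_mul_left]
          gcongr
          exact h.tsum_measure_le i
      _ = θ / 2 * μ (Q i) := by rw [div_eq_mul_inv, mul_assoc]
  have hθ0 : θ = 0 := by
    by_contra hne
    exact hhalf.not_gt (ENNReal.half_lt_self hne (ne_top_of_le_ne_top ENNReal.one_ne_top hθ1))
  simpa [hθ0] using hle i

lemma ae_le_sparseSum [Countable ι] (h : IsHalvingTree μ Q child) {G : ι → X → ℝ≥0∞}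
    {b : ι → ℝ≥0∞} (hG : ∀ i, ∀ x ∈ Q i,
      G i x ≤ b i ∨ ∃ j ∈ child i, x ∈ Q j ∧ G i x ≤ b i + G j x) (i : ι) :
    ∀ᵐ x ∂μ, x ∈ Q i → G i x ≤ sparseSum Q (descendants child i) b x := by
  set Z : ι → Set X := fun i =>
    {x | x ∈ Q i ∧ ¬ G i x ≤ sparseSum Q (descendants child i) b x}
  have hsub (i : ι) : Z i ⊆ ⋃ j ∈ child i, Z j := by
    rintro x ⟨hx, hxi⟩
    obtain hle | ⟨j, hj, hxj, hle⟩ := hG i x hx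
    · refine absurd (hle.trans ?_) hxi
      refine le_trans ?_ (ENNReal.le_tsum (⟨i, .refl⟩ : descendants child i))
      rw [Set.indicator_of_mem hx]
    · refine Set.mem_biUnion hj ⟨hxj, fun hGj => hxi (hle.trans ?_)⟩
      exact (add_le_add_right hGj (b i)).trans (h.add_sparseSum_le b hx hj)
  have hnull : μ (Z i) = 0 := h.measure_eq_zero_of_subset (fun i x hx => hx.1) hsub i
  filter_upwards [measure_eq_zero_iff_ae_notMem.1 hnull] with x hx hxQ
  exact not_not.1 fun hcon => hx ⟨hxQ, hcon⟩

end IsHalvingTree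

end Sparse

/-! ### The sparse domination -/

section SparseDomination

variable {n : ℕ} {ι : Type*} {T : (Eu n → ℂ) → Eu n → ℂ} {K : Eu n → Eu n → ℂ}
  {φ : ι → Eu n → ℝ}

/-- The weak-type inequality `‖T^Φ f‖_{L^{r,∞}} ≤ c ‖f‖_r` for `f ∈ L² ∩ L^r`, at a single
exponent. -/
def HasWeakType (T : (Eu n → ℂ) → Eu n → ℂ) (φ : ι → Eu n → ℝ) (r : ℝ) (c : ℝ≥0) : Prop :=
  ∀ f : Eu n → ℂ, MemLp f 2 volume → MemLp f (ENNReal.ofReal r) volume →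
    AEMeasurable (maxMod T φ f) volume ∧
      weakNorm r (maxMod T φ f) ≤ c * eLpNorm f (ENNReal.ofReal r) volume

/-- The `L^r` average of `f` over the triple of a dyadic cube. -/
def avg (r : ℝ) (a : Eu n) (ℓ : ℝ) (f : Eu n → ℂ) (Q : DyadicIndex n) : ℝ≥0∞ :=
  eLpNorm' f r volume[|dyadicTriple a ℓ Q]

/-- The function `f` cut off to the triple of a dyadic cube. -/
def localize (a : Eu n) (ℓ : ℝ) (f : Eu n → ℂ) (Q : DyadicIndex n) : Eu n → ℂ :=
  (dyadicTriple a ℓ Q).indicator f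

/-- The dyadic subcubes of `Q` over whose triples the average of `f` is large compared with its
average over `3Q`. -/
def largeAvgCubes (r : ℝ) (c : ℝ≥0) (a : Eu n) (ℓ : ℝ) (f : Eu n → ℂ) (Q : DyadicIndex n) :
    Set (DyadicIndex n) :=
  {P | Q.1 ≤ P.1 ∧ dyadicCube a ℓ P ⊆ dyadicCube a ℓ Q ∧ c * avg r a ℓ f Q < avg r a ℓ f P}

/-- The points where `T^Φ` or an average of `f` over a smaller cube is large compared with
the average of `f` over `3Q`. -/
def exceptionalSet (T : (Eu n → ℂ) → Eu n → ℂ) (φ : ι → Eu n → ℝ) (r : ℝ) (c : ℝ≥0) (a : Eu n)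
    (ℓ : ℝ) (f : Eu n → ℂ) (Q : DyadicIndex n) : Set (Eu n) :=
  {x | c * avg r a ℓ f Q < maxMod T φ (localize a ℓ f Q) x} ∪
    ⋃ P ∈ largeAvgCubes r c a ℓ f Q, dyadicCube a ℓ P

variable {a : Eu n} {ℓ r : ℝ} {f : Eu n → ℂ} {P Q R : DyadicIndex n} {c : ℝ≥0}

lemma setLIntegral_rpow_eq_mul_avg_rpow (hℓ : 0 < ℓ) (hr : 0 < r) (Q : DyadicIndex n) :
    ∫⁻ y in dyadicTriple a ℓ Q, ‖f y‖ₑ ^ r =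
      volume (dyadicTriple a ℓ Q) * avg r a ℓ f Q ^ r := by
  rw [setLIntegral_dyadicTriple hℓ, avg, eLpNorm'_eq_lintegral_enorm, ← ENNReal.rpow_mul,
    one_div_mul_cancel hr.ne', ENNReal.rpow_one]

lemma memLp_localize {q : ℝ≥0∞} (hf : MemLp f q volume) (Q : DyadicIndex n) :
    MemLp (localize a ℓ f Q) q volume :=
  hf.indicator (measurableSet_dyadicTriple a ℓ Q)

lemma integrable_localize (hf : MemLp f 2 volume) (Q : DyadicIndex n) :
    Integrable (localize a ℓ f Q) volume := by
  have : IsFiniteMeasure (volume.restrict (dyadicTriple a ℓ Q)) :=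
    isFiniteMeasure_restrict.2 (volume_dyadicTriple_ne_top Q)
  exact (integrable_indicator_iff (measurableSet_dyadicTriple a ℓ Q)).2
    ((hf.restrict _).integrable one_le_two)

lemma eLpNorm_localize (hℓ : 0 < ℓ) (hr : 0 < r) (Q : DyadicIndex n) :
    eLpNorm (localize a ℓ f Q) (ENNReal.ofReal r) volume =
      avg r a ℓ f Q * volume (dyadicTriple a ℓ Q) ^ (1 / r) := by
  rw [localize, eLpNorm_indicator_eq_eLpNorm_restrict (measurableSet_dyadicTriple a ℓ Q),
    eLpNorm_eq_lintegral_rpow_enorm_toReal (by simpa using hr) ENNReal.ofReal_ne_top,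
    ENNReal.toReal_ofReal hr.le, setLIntegral_rpow_eq_mul_avg_rpow hℓ hr,
    ENNReal.mul_rpow_of_nonneg _ _ (by positivity), ← ENNReal.rpow_mul, mul_one_div_cancel hr.ne',
    ENNReal.rpow_one, mul_comm]

lemma memLp_localize_of_avg_ne_top (hℓ : 0 < ℓ) (hr : 0 < r) (hf : AEStronglyMeasurable f volume)
    (hQ : avg r a ℓ f Q ≠ ∞) : MemLp (localize a ℓ f Q) (ENNReal.ofReal r) volume := by
  refine ⟨hf.indicator (measurableSet_dyadicTriple a ℓ Q), ?_⟩
  rw [eLpNorm_localize hℓ hr]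
  exact ENNReal.mul_lt_top hQ.lt_top
    (ENNReal.rpow_lt_top_of_nonneg (by positivity) (volume_dyadicTriple_ne_top Q))

lemma lintegral_enorm_le_avg (hℓ : 0 < ℓ) (hr : 1 ≤ r) (hf : AEStronglyMeasurable f volume)
    (Q : DyadicIndex n) : ∫⁻ y, ‖f y‖ₑ ∂volume[|dyadicTriple a ℓ Q] ≤ avg r a ℓ f Q := by
  have := isProbabilityMeasure_cond_dyadicTriple (a := a) hℓ Q
  simpa [avg, eLpNorm'_eq_lintegral_enorm] using eLpNorm'_le_eLpNorm'_of_exponent_le one_pos hr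
    volume[|dyadicTriple a ℓ Q] (hf.mono_ac ProbabilityTheory.cond_absolutelyContinuous)

lemma volume_pos_eq_zero_of_weakNorm_eq_zero {g : Eu n → ℝ≥0∞} (hr : 0 < r)
    (h : weakNorm r g = 0) : volume {x | 0 < g x} = 0 := by
  have hnull (k : ℕ) : volume {x | (((k : ℝ≥0) + 1)⁻¹ : ℝ≥0) < g x} = 0 := by
    have hk := ENNReal.iSup_eq_zero.1 h ((k : ℝ≥0) + 1)⁻¹
    rw [mul_eq_zero, ENNReal.rpow_eq_zero_iff_of_pos (by positivity)] at hk
    exact hk.resolve_left (by norm_cast; positivity)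
  refine measure_mono_null (fun x hx => ?_) (measure_iUnion_null hnull)
  obtain ⟨ε, hε, hεx⟩ := ENNReal.lt_iff_exists_nnreal_btwn.1 (show 0 < g x from hx)
  obtain ⟨k, hk⟩ := exists_nat_one_div_lt (ENNReal.coe_pos.1 hε)
  exact Set.mem_iUnion.2 ⟨k, (ENNReal.coe_lt_coe.2 (by rwa [← one_div])).trans hεx⟩

lemma mul_volume_lt_rpow_le {g : Eu n → ℝ≥0∞} {b d : ℝ≥0∞} (hr : 0 < r) (hb : b ≠ ∞)
    (h : weakNorm r g ≤ b * d) : c * volume {x | c * b < g x} ^ (1 / r) ≤ d := by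
  obtain rfl | hb0 := eq_or_ne b 0
  · rw [zero_mul, nonpos_iff_eq_zero] at h
    simp [volume_pos_eq_zero_of_weakNorm_eq_zero hr h, hr]
  · have hle := (le_iSup (fun t : ℝ≥0 => t * volume {x | t < g x} ^ (1 / r))
      (c * b.toNNReal)).trans h
    rw [ENNReal.coe_mul, ENNReal.coe_toNNReal hb, mul_comm (c : ℝ≥0∞), mul_assoc] at hle
    exact (ENNReal.mul_le_mul_iff_right hb0 hb).1 (by simpa only [mul_comm] using hle)

lemma exists_pos_le_mul_rpow (hr : 0 < r) {η : ℝ≥0} (hη : 0 < η) (M : ℝ≥0) :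
    ∃ c : ℝ≥0, 0 < c ∧ (M : ℝ≥0∞) ≤ η * (c : ℝ≥0∞) ^ r := by
  refine ⟨(η⁻¹ * (M + 1)) ^ (1 / r), by positivity, ?_⟩
  rw [← ENNReal.coe_rpow_of_nonneg _ hr.le, ← NNReal.rpow_mul, one_div_mul_cancel hr.ne',
    NNReal.rpow_one, ← ENNReal.coe_mul, mul_inv_cancel_left₀ hη.ne']
  exact ENNReal.coe_le_coe.2 le_self_add

lemma exists_volume_avg_lt_maxMod_le {c₀ : ℝ≥0} (hwt : HasWeakType T φ r c₀) (hr : 0 < r)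
    {η : ℝ≥0} (hη : 0 < η) :
    ∃ c : ℝ≥0, ∀ (a : Eu n) (ℓ : ℝ), 0 < ℓ → ∀ f : Eu n → ℂ, MemLp f 2 volume →
      ∀ Q : DyadicIndex n, avg r a ℓ f Q ≠ ∞ →
        volume {x | c * avg r a ℓ f Q < maxMod T φ (localize a ℓ f Q) x} ≤
          η * volume (dyadicCube a ℓ Q) := by
  obtain ⟨c, hc, hcη⟩ := exists_pos_le_mul_rpow hr hη (c₀ ^ r * 3 ^ n)
  refine ⟨c, fun a ℓ hℓ f hf Q hQ => ?_⟩
  set V : ℝ≥0∞ := volume {x | c * avg r a ℓ f Q < maxMod T φ (localize a ℓ f Q) x}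
  have hV : c * V ^ (1 / r) ≤ c₀ * volume (dyadicTriple a ℓ Q) ^ (1 / r) := by
    refine mul_volume_lt_rpow_le hr hQ ((hwt _ (memLp_localize hf Q)
      (memLp_localize_of_avg_ne_top hℓ hr hf.1 hQ)).2.trans_eq ?_)
    rw [eLpNorm_localize hℓ hr, mul_left_comm]
  refine (ENNReal.mul_le_mul_iff_right (a := (c : ℝ≥0∞) ^ r) (by simp [hc.ne'])
    (by finiteness)).1 ?_
  calc (c : ℝ≥0∞) ^ r * V = (c * V ^ (1 / r)) ^ r := by
        rw [ENNReal.mul_rpow_of_nonneg _ _ hr.le, ← ENNReal.rpow_mul, one_div_mul_cancel hr.ne',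
          ENNReal.rpow_one]
    _ ≤ (c₀ * volume (dyadicTriple a ℓ Q) ^ (1 / r)) ^ r := by gcongr
    _ = (c₀ ^ r * 3 ^ n : ℝ≥0) * volume (dyadicCube a ℓ Q) := by
        rw [ENNReal.mul_rpow_of_nonneg _ _ hr.le, ← ENNReal.rpow_mul, one_div_mul_cancel hr.ne',
          ENNReal.rpow_one, volume_dyadicTriple, ← mul_assoc, ENNReal.coe_mul,
          ENNReal.coe_rpow_of_nonneg _ hr.le]
        norm_cast
    _ ≤ η * (c : ℝ≥0∞) ^ r * volume (dyadicCube a ℓ Q) := by gcongr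
    _ = (c : ℝ≥0∞) ^ r * (η * volume (dyadicCube a ℓ Q)) := by ring

lemma avg_eq_zero_of_subset (hℓ : 0 < ℓ) (hr : 0 < r)
    (hPQ : dyadicTriple a ℓ P ⊆ dyadicTriple a ℓ Q) (hQ : avg r a ℓ f Q = 0) :
    avg r a ℓ f P = 0 := by
  have hP := lintegral_mono_set (μ := volume) (f := fun y => ‖f y‖ₑ ^ r) hPQ
  rw [setLIntegral_rpow_eq_mul_avg_rpow hℓ hr, setLIntegral_rpow_eq_mul_avg_rpow hℓ hr, hQ,
    ENNReal.zero_rpow_of_pos hr, mul_zero, nonpos_iff_eq_zero, mul_eq_zero,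
    ENNReal.rpow_eq_zero_iff_of_pos hr] at hP
  exact hP.resolve_left (volume_dyadicTriple_ne_zero hℓ P)

lemma exists_volume_biUnion_avg_lt_le (n : ℕ) (hr : 0 < r) {η : ℝ≥0} (hη : 0 < η) :
    ∃ c : ℝ≥0, ∀ (a : Eu n) (ℓ : ℝ), 0 < ℓ → ∀ (f : Eu n → ℂ) (Q : DyadicIndex n),
      avg r a ℓ f Q ≠ ∞ →
        volume (⋃ P ∈ largeAvgCubes r c a ℓ f Q, dyadicCube a ℓ P) ≤
          η * volume (dyadicCube a ℓ Q) := by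
  obtain ⟨c, hc, hcη⟩ := exists_pos_le_mul_rpow hr hη (5 ^ n * 3 ^ n)
  refine ⟨c, fun a ℓ hℓ f Q hQ => ?_⟩
  set t := largeAvgCubes r c a ℓ f Q
  have hsub : ∀ P ∈ t, dyadicTriple a ℓ P ⊆ dyadicTriple a ℓ Q := fun P hP =>
    dyadicTriple_subset hℓ hP.2.1
  obtain h0 | h0 := eq_or_ne (avg r a ℓ f Q) 0
  · have ht : t = ∅ := Set.eq_empty_of_forall_notMem fun P hP =>
      hP.2.2.not_ge (by simp [avg_eq_zero_of_subset hℓ hr (hsub P hP) h0])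
    simp [ht]
  set b : ℝ≥0∞ := (c * avg r a ℓ f Q) ^ r
  have hcover : b * volume (⋃ P ∈ t, dyadicCube a ℓ P) ≤
      5 ^ n * ∫⁻ y, (dyadicTriple a ℓ Q).indicator (fun y => ‖f y‖ₑ ^ r) y := by
    refine mul_volume_biUnion_dyadicCube_le hℓ fun P hP => ?_
    rw [setLIntegral_congr_fun (measurableSet_dyadicTriple a ℓ P) fun y hy =>
      Set.indicator_of_mem (hsub P hP hy) _, setLIntegral_rpow_eq_mul_avg_rpow hℓ hr, mul_comm]
    exact mul_le_mul_right (ENNReal.rpow_le_rpow hP.2.2.le hr.le) _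
  refine (ENNReal.mul_le_mul_iff_right (a := b) (by simp [b, h0, hr.le, hc.ne'])
    (by finiteness)).1 (hcover.trans ?_)
  calc 5 ^ n * ∫⁻ y, (dyadicTriple a ℓ Q).indicator (fun y => ‖f y‖ₑ ^ r) y
      = (5 ^ n * 3 ^ n : ℝ≥0) * (avg r a ℓ f Q ^ r * volume (dyadicCube a ℓ Q)) := by
        rw [lintegral_indicator (measurableSet_dyadicTriple a ℓ Q),
          setLIntegral_rpow_eq_mul_avg_rpow hℓ hr, volume_dyadicTriple]
        push_cast
        ring
    _ ≤ η * (c : ℝ≥0∞) ^ r * (avg r a ℓ f Q ^ r * volume (dyadicCube a ℓ Q)) := by gcongr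
    _ = (c * avg r a ℓ f Q) ^ r * (η * volume (dyadicCube a ℓ Q)) := by
        rw [ENNReal.mul_rpow_of_nonneg _ _ hr.le]
        ring

lemma exceptionalSet_subset {c₁ c₂ : ℝ≥0} (hc₁ : c₁ ≤ c) (hc₂ : c₂ ≤ c) :
    exceptionalSet T φ r c a ℓ f Q ⊆
      {x | c₁ * avg r a ℓ f Q < maxMod T φ (localize a ℓ f Q) x} ∪
        ⋃ P ∈ largeAvgCubes r c₂ a ℓ f Q, dyadicCube a ℓ P := by
  have hle {c' : ℝ≥0} (hc' : c' ≤ c) : c' * avg r a ℓ f Q ≤ c * avg r a ℓ f Q := by gcongr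
  exact Set.union_subset_union (fun x hx => (hle hc₁).trans_lt hx)
    (Set.biUnion_subset_biUnion_left fun P hP => ⟨hP.1, hP.2.1, (hle hc₂).trans_lt hP.2.2⟩)

lemma exists_volume_exceptionalSet_le {c₀ : ℝ≥0} (hwt : HasWeakType T φ r c₀) (hr : 0 < r)
    {η : ℝ≥0} (hη : 0 < η) :
    ∃ c : ℝ≥0, ∀ (a : Eu n) (ℓ : ℝ), 0 < ℓ → ∀ f : Eu n → ℂ, MemLp f 2 volume →
      ∀ Q : DyadicIndex n, avg r a ℓ f Q ≠ ∞ →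
        volume (exceptionalSet T φ r c a ℓ f Q) ≤ η * volume (dyadicCube a ℓ Q) := by
  obtain ⟨c₁, hc₁⟩ := exists_volume_avg_lt_maxMod_le hwt hr (half_pos hη)
  obtain ⟨c₂, hc₂⟩ := exists_volume_biUnion_avg_lt_le n hr (half_pos hη)
  refine ⟨max c₁ c₂, fun a ℓ hℓ f hf Q hQ => ?_⟩
  calc volume (exceptionalSet T φ r (max c₁ c₂) a ℓ f Q)
      ≤ (η / 2 : ℝ≥0) * volume (dyadicCube a ℓ Q) + (η / 2 : ℝ≥0) * volume (dyadicCube a ℓ Q) :=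
        (measure_mono (exceptionalSet_subset (le_max_left _ _) (le_max_right _ _))).trans
          ((measure_union_le _ _).trans
            (add_le_add (hc₁ a ℓ hℓ f hf Q hQ) (hc₂ a ℓ hℓ f Q hQ)))
    _ = η * volume (dyadicCube a ℓ Q) := by
        rw [← add_mul, ← ENNReal.coe_add, add_halves]

lemma maxMod_le_of_notMem_exceptionalSet {x : Eu n} (hx : x ∉ exceptionalSet T φ r c a ℓ f Q) :
    maxMod T φ (localize a ℓ f Q) x ≤ c * avg r a ℓ f Q :=
  not_lt.1 fun h => hx (Or.inl h)

lemma avg_le_of_not_subset_exceptionalSet (hQR : Q.1 ≤ R.1)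
    (hRQ : dyadicCube a ℓ R ⊆ dyadicCube a ℓ Q)
    (hR : ¬ dyadicCube a ℓ R ⊆ exceptionalSet T φ r c a ℓ f Q) :
    avg r a ℓ f R ≤ c * avg r a ℓ f Q :=
  not_lt.1 fun h => hR ((Set.subset_biUnion_of_mem (u := dyadicCube a ℓ)
    (show R ∈ largeAvgCubes r c a ℓ f Q from ⟨hQR, hRQ, h⟩)).trans Set.subset_union_right)

lemma exists_mem_notMem_of_measure_le {X : Type*} [MeasurableSpace X] {μ : Measure X}
    {s U V : Set X} (hs : μ s ≠ ∞) (hU : μ (s ∩ U) ≤ 2⁻¹ * μ s) (hV : μ V < 2⁻¹ * μ s) :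
    ∃ x ∈ s, x ∉ U ∧ x ∉ V := by
  by_contra! hcon
  have hsub : s ⊆ s ∩ U ∪ V := fun x hx => by
    by_cases hxU : x ∈ U
    · exact Or.inl ⟨hx, hxU⟩
    · exact Or.inr (hcon x hx hxU)
  refine ((measure_mono (μ := μ) hsub).trans (measure_union_le _ _)).not_gt ?_
  calc μ (s ∩ U) + μ V < 2⁻¹ * μ s + 2⁻¹ * μ s :=
        ENNReal.add_lt_add_of_le_of_lt (by finiteness) hU hV
    _ = μ s := by rw [← add_mul, ENNReal.inv_two_add_inv_two, one_mul]

lemma localize_sub_localize (hPQ : dyadicTriple a ℓ P ⊆ dyadicTriple a ℓ Q) :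
    localize a ℓ f Q - localize a ℓ f P =
      (dyadicTriple a ℓ Q \ dyadicTriple a ℓ P).indicator f :=
  (Set.indicator_sdiff hPQ f).symm

lemma maxMod_localize_le (hT : IsRepresentedBy T K) (hK : IsCZKernel K)
    (hφ : ∀ α, Measurable (φ α)) (hℓ : 0 < ℓ) (hf : MemLp f 2 volume)
    (hPQ : dyadicCube a ℓ P ⊆ dyadicCube a ℓ Q) {x x' : Eu n} (hx : x ∈ dyadicCube a ℓ P)
    (hx' : x' ∈ dyadicCube a ℓ P) :
    maxMod T φ (localize a ℓ f Q) x ≤ maxMod T φ (localize a ℓ f P) x +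
      (maxMod T φ (localize a ℓ f Q) x' + maxMod T φ (localize a ℓ f P) x' +
        ∫⁻ y in dyadicTriple a ℓ Q \ dyadicTriple a ℓ P, ‖K x y - K x' y‖ₑ * ‖f y‖ₑ) := by
  set D : Set (Eu n) := dyadicTriple a ℓ Q \ dyadicTriple a ℓ P
  set h : Eu n → ℂ := localize a ℓ f Q - localize a ℓ f P
  have hh : h = D.indicator f := localize_sub_localize (dyadicTriple_subset hℓ hPQ)
  have hfQ : MemLp (localize a ℓ f Q) 2 volume := memLp_localize hf Q
  have hfP : MemLp (localize a ℓ f P) 2 volume := memLp_localize hf P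
  have hsep : ∀ z ∈ dyadicCube a ℓ P, ∀ y, h y ≠ 0 → dyadicSide ℓ P ≤ ‖z - y‖ := by
    intro z hz y hy
    rw [hh] at hy
    exact le_norm_sub_of_notMem_tripleCube hz (Set.mem_of_indicator_ne_zero hy).2
  have hint : ∫⁻ y, ‖K x y - K x' y‖ₑ * ‖h y‖ₑ = ∫⁻ y in D, ‖K x y - K x' y‖ₑ * ‖f y‖ₑ := by
    have hD : MeasurableSet D :=
      (measurableSet_dyadicTriple a ℓ Q).diff (measurableSet_dyadicTriple a ℓ P)
    simp_rw [← lintegral_indicator hD, hh, enorm_indicator_eq_indicator_enorm,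
      Set.indicator_mul_right]
  calc maxMod T φ (localize a ℓ f Q) x
      ≤ maxMod T φ (localize a ℓ f P) x + maxMod T φ h x := maxMod_le_add_sub hT hφ hfQ hfP x
    _ ≤ maxMod T φ (localize a ℓ f P) x +
        (maxMod T φ h x' + ∫⁻ y, ‖K x y - K x' y‖ₑ * ‖h y‖ₑ) := by
        gcongr
        exact maxMod_le_add_lintegral hT hK hφ (hfQ.sub hfP)
          ((integrable_localize hf Q).sub (integrable_localize hf P)) (dyadicSide_pos hℓ P)
          (hsep x hx) (hsep x' hx')
    _ ≤ _ := by
        rw [hint]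
        gcongr
        exact maxMod_sub_le hT hφ hfQ hfP x'

variable {U : Set (Eu n)}

lemma exists_mem_maxMod_le_of_mem_stoppingCubes (hℓ : 0 < ℓ) (hQ : ¬ IsDenseIn a ℓ U Q)
    (hEU : exceptionalSet T φ r c a ℓ f Q ⊆ U) (hP : P ∈ stoppingCubes a ℓ U Q)
    (hEP : volume (exceptionalSet T φ r c a ℓ f P) < 2⁻¹ * volume (dyadicCube a ℓ P)) :
    ∃ x ∈ dyadicCube a ℓ P, maxMod T φ (localize a ℓ f Q) x ≤ c * avg r a ℓ f Q ∧
      maxMod T φ (localize a ℓ f P) x ≤ c * avg r a ℓ f P := by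
  obtain ⟨x, hx, hxU, hxE⟩ := exists_mem_notMem_of_measure_le (volume_dyadicCube_ne_top P)
    (volume_inter_le_of_mem_stoppingCubes hℓ hQ hP) hEP
  exact ⟨x, hx, maxMod_le_of_notMem_exceptionalSet fun h => hxU (hEU h),
    maxMod_le_of_notMem_exceptionalSet hxE⟩

lemma lintegral_enorm_le_of_mem_stoppingCubes (hℓ : 0 < ℓ) (hr : 1 ≤ r)
    (hf : AEStronglyMeasurable f volume) (hQ : ¬ IsDenseIn a ℓ U Q)
    (hEU : exceptionalSet T φ r c a ℓ f Q ⊆ U) (hP : P ∈ stoppingCubes a ℓ U Q) (hQR : Q.1 ≤ R.1)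
    (hRP : R.1 < P.1) (hPR : dyadicCube a ℓ P ⊆ dyadicCube a ℓ R) :
    ∫⁻ y, ‖f y‖ₑ ∂volume[|dyadicTriple a ℓ R] ≤ c * avg r a ℓ f Q := by
  have hRQ : dyadicCube a ℓ R ⊆ dyadicCube a ℓ Q := by
    have hc := dyadicCorner_mem_dyadicCube (a := a) hℓ P
    exact dyadicCube_subset_of_mem hℓ hQR (hP.2.1 hc) (hPR hc)
  exact (lintegral_enorm_le_avg hℓ hr hf R).trans (avg_le_of_not_subset_exceptionalSet hQR hRQ
    fun h => not_subset_of_mem_stoppingCubes hℓ hQ hP hQR hRP hPR (h.trans hEU))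

lemma exists_isOpen_exceptionalSet_subset (hℓ : 0 < ℓ)
    (hE : volume (exceptionalSet T φ r c a ℓ f Q) ≤ (2 ^ (n + 3))⁻¹ * volume (dyadicCube a ℓ Q)) :
    ∃ U, exceptionalSet T φ r c a ℓ f Q ⊆ U ∧ IsOpen U ∧
      volume U ≤ (2 ^ (n + 2))⁻¹ * volume (dyadicCube a ℓ Q) := by
  have hlt : volume (exceptionalSet T φ r c a ℓ f Q) <
      (2 ^ (n + 2))⁻¹ * volume (dyadicCube a ℓ Q) := by
    refine hE.trans_lt (ENNReal.mul_lt_mul_left (volume_dyadicCube_ne_zero hℓ Q)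
      (volume_dyadicCube_ne_top Q) (ENNReal.inv_lt_inv.2 ?_))
    exact_mod_cast Nat.pow_lt_pow_right one_lt_two (Nat.lt_succ_self (n + 2))
  obtain ⟨U, hEU, hU, hUQ⟩ := Set.exists_isOpen_lt_of_lt _ _ hlt
  exact ⟨U, hEU, hU, hUQ.le⟩

lemma exists_children_maxMod_le {c₀ : ℝ≥0} (hT : IsRepresentedBy T K) (hK : IsCZKernel K)
    (hφ : ∀ α, Measurable (φ α)) (hr : 1 ≤ r) (hwt : HasWeakType T φ r c₀) :
    ∃ C : ℝ≥0, ∀ (a : Eu n) (ℓ : ℝ), 0 < ℓ → ∀ f : Eu n → ℂ, MemLp f 2 volume →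
      (∀ Q, avg r a ℓ f Q ≠ ∞) → ∀ Q : DyadicIndex n, ∃ S : Set (DyadicIndex n),
        (∀ P ∈ S, dyadicCube a ℓ P ⊆ dyadicCube a ℓ Q) ∧ S.PairwiseDisjoint (dyadicCube a ℓ) ∧
        ∑' P : S, volume (dyadicCube a ℓ P) ≤ 2⁻¹ * volume (dyadicCube a ℓ Q) ∧
        ∀ x ∈ dyadicCube a ℓ Q, maxMod T φ (localize a ℓ f Q) x ≤ C * avg r a ℓ f Q ∨
          ∃ P ∈ S, x ∈ dyadicCube a ℓ P ∧ maxMod T φ (localize a ℓ f Q) x ≤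
            maxMod T φ (localize a ℓ f P) x + C * (avg r a ℓ f Q + avg r a ℓ f P) := by
  obtain ⟨c, hc⟩ := exists_volume_exceptionalSet_le hwt (one_pos.trans_le hr)
    (η := (2 ^ (n + 3))⁻¹) (by positivity)
  push_cast at hc
  obtain ⟨C₁, hC₁⟩ := hK.exists_lintegral_enorm_sub_le
  refine ⟨c * (1 + C₁), fun a ℓ hℓ f hf havg Q => ?_⟩
  have hcC : (c : ℝ≥0∞) ≤ (c * (1 + C₁) : ℝ≥0) :=
    ENNReal.coe_le_coe.2 (le_mul_of_one_le_right' le_self_add)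
  obtain ⟨U, hEU, hU, hUQ⟩ := exists_isOpen_exceptionalSet_subset hℓ (hc a ℓ hℓ f hf Q (havg Q))
  have hQ : ¬ IsDenseIn a ℓ U Q := not_isDenseIn_of_volume_le hUQ
  refine ⟨stoppingCubes a ℓ U Q, fun P hP => hP.2.1, pairwiseDisjoint_stoppingCubes hℓ,
    tsum_volume_stoppingCubes_le hℓ hU.measurableSet hUQ, fun x hxQ => ?_⟩
  by_cases hxU : x ∈ U
  swap
  · exact Or.inl ((maxMod_le_of_notMem_exceptionalSet fun h => hxU (hEU h)).trans (by gcongr))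
  obtain ⟨P, hP, hxP⟩ := exists_mem_stoppingCubes hℓ hU hxQ hxU
  refine Or.inr ⟨P, hP, hxP, ?_⟩
  have hEP : volume (exceptionalSet T φ r c a ℓ f P) < 2⁻¹ * volume (dyadicCube a ℓ P) := by
    refine (hc a ℓ hℓ f hf P (havg P)).trans_lt (ENNReal.mul_lt_mul_left
      (volume_dyadicCube_ne_zero hℓ P) (volume_dyadicCube_ne_top P) (ENNReal.inv_lt_inv.2 ?_))
    exact_mod_cast lt_self_pow₀ (M₀ := ℕ) one_lt_two (by omega : 1 < n + 3)
  obtain ⟨x', hx'P, hx'Q, hx'⟩ := exists_mem_maxMod_le_of_mem_stoppingCubes hℓ hQ hEU hP hEP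
  have htail := hC₁ a ℓ hℓ P Q hP.1.le hP.2.1 _ hf.1.enorm _
    (fun R => lintegral_enorm_le_of_mem_stoppingCubes hℓ hr hf.1 hQ hEU hP) x hxP x' hx'P
  refine (maxMod_localize_le hT hK hφ hℓ hf hP.2.1 hxP hx'P).trans ?_
  gcongr
  calc maxMod T φ (localize a ℓ f Q) x' + maxMod T φ (localize a ℓ f P) x' +
        ∫⁻ y in dyadicTriple a ℓ Q \ dyadicTriple a ℓ P, ‖K x y - K x' y‖ₑ * ‖f y‖ₑ
      ≤ c * avg r a ℓ f Q + c * avg r a ℓ f P + C₁ * (c * avg r a ℓ f Q) := by gcongr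
    _ = (c * (1 + C₁) : ℝ≥0) * avg r a ℓ f Q + c * avg r a ℓ f P := by push_cast; ring
    _ ≤ (c * (1 + C₁) : ℝ≥0) * (avg r a ℓ f Q + avg r a ℓ f P) := by
        rw [mul_add (_ : ℝ≥0∞)]
        gcongr

theorem exists_isSparse_maxMod_le {c₀ : ℝ≥0} (hT : IsRepresentedBy T K) (hK : IsCZKernel K)
    (hφ : ∀ α, Measurable (φ α)) (hr : 1 ≤ r) (hwt : HasWeakType T φ r c₀) :
    ∃ C : ℝ≥0, ∀ (a : Eu n) (ℓ : ℝ), 0 < ℓ → ∀ f : Eu n → ℂ, MemLp f 2 volume →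
      (∀ Q, avg r a ℓ f Q ≠ ∞) → ∀ Q : DyadicIndex n, ∃ S : Set (DyadicIndex n),
        IsSparse volume (dyadicCube a ℓ) S ∧ ∀ᵐ x, x ∈ dyadicCube a ℓ Q →
          maxMod T φ (localize a ℓ f Q) x ≤
            C * sparseSum (dyadicCube a ℓ) S (avg r a ℓ f) x := by
  obtain ⟨C, hC⟩ := exists_children_maxMod_le hT hK hφ hr hwt
  refine ⟨2 * C, fun a ℓ hℓ f hf havg Q => ?_⟩
  choose child hsub hdisj hhalf hstep using hC a ℓ hℓ f hf havg
  have htree : IsHalvingTree volume (dyadicCube a ℓ) child :=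
    ⟨measurableSet_dyadicCube a ℓ, volume_dyadicCube_ne_zero hℓ, volume_dyadicCube_ne_top, hsub,
      hdisj, hhalf⟩
  refine ⟨descendants child Q, htree.isSparse_descendants Q, ?_⟩
  -- the error `C * avg P` inherited from a child `P` is charged to `P` itself
  set G : DyadicIndex n → Eu n → ℝ≥0∞ := fun P x =>
    maxMod T φ (localize a ℓ f P) x + C * avg r a ℓ f P
  have hG (P : DyadicIndex n) (x : Eu n) (hx : x ∈ dyadicCube a ℓ P) :
      G P x ≤ (2 * C : ℝ≥0) * avg r a ℓ f P ∨ ∃ R ∈ child P, x ∈ dyadicCube a ℓ R ∧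
        G P x ≤ (2 * C : ℝ≥0) * avg r a ℓ f P + G R x := by
    refine (hstep P x hx).imp (fun h => ?_) (fun ⟨R, hR, hxR, h⟩ => ⟨R, hR, hxR, ?_⟩)
    · calc G P x ≤ C * avg r a ℓ f P + C * avg r a ℓ f P := add_le_add_left h _
        _ = (2 * C : ℝ≥0) * avg r a ℓ f P := by push_cast; ring
    · calc G P x ≤ maxMod T φ (localize a ℓ f R) x + C * (avg r a ℓ f P + avg r a ℓ f R) +
            C * avg r a ℓ f P := add_le_add_left h _
        _ = (2 * C : ℝ≥0) * avg r a ℓ f P + G R x := by simp only [G]; push_cast; ring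
  filter_upwards [htree.ae_le_sparseSum hG Q] with x hx hxQ
  rw [← sparseSum_const_mul]
  exact le_self_add.trans (hx hxQ)

end SparseDomination

/-! ### The bump condition -/

section Bump

variable {n : ℕ}

/-- The bump condition with constant `κ` for the powers `W = u^{1/p}` and `V = v^{-r/p}` of the
weights, with the properties of the gauges `A` and `B` that make their norms finite. -/
structure IsBumpPair (A B : ℝ≥0 → ℝ≥0) (r : ℝ) (κ : ℝ≥0) (W V : Eu n → ℝ≥0) : Prop where
  monotone_left : Monotone A
  monotone_right : Monotone B
  tendsto_left : Filter.Tendsto A Filter.atTop Filter.atTop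
  tendsto_right : Filter.Tendsto B Filter.atTop Filter.atTop
  aemeasurable_left : AEMeasurable W volume
  aemeasurable_right : AEMeasurable V volume
  pos_left : ∀ᵐ x, 0 < W x
  pos_right : ∀ᵐ x, 0 < V x
  luxNorm_mul_le : ∀ (a : Eu n) (ℓ : ℝ), 0 < ℓ →
    luxNorm (A ·) volume[|cube a ℓ] W * luxNorm (B ·) volume[|cube a ℓ] V ^ (1 / r) ≤ κ

variable {A B : ℝ≥0 → ℝ≥0} {r : ℝ} {κ : ℝ≥0} {W V g h : Eu n → ℝ≥0} {f : Eu n → ℂ} {a : Eu n}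
  {ℓ : ℝ}

lemma luxNorm_dyadicTriple_ne_zero (hA : Monotone A)
    (hAt : Filter.Tendsto A Filter.atTop Filter.atTop) (hW : AEMeasurable W volume)
    (hpos : ∀ᵐ x, 0 < W x) (hℓ : 0 < ℓ) (Q : DyadicIndex n) :
    luxNorm (A ·) volume[|dyadicTriple a ℓ Q] W ≠ 0 := by
  have := isProbabilityMeasure_cond_dyadicTriple (a := a) hℓ Q
  refine luxNorm_ne_zero hA hAt (hW.mono_ac ProbabilityTheory.cond_absolutelyContinuous)
    fun hzero => ?_
  obtain ⟨x, hx0, hx⟩ :=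
    (hzero.and (ProbabilityTheory.cond_absolutelyContinuous.ae_le hpos)).exists
  exact hx.ne' hx0

lemma exists_lintegral_orliczMax_mul_orliczMax_le (n : ℕ) (hr : 0 < r) {p p' : ℝ}
    (hpp : p.HolderConjugate p') (hA : SatisfiesB p' (complementary A))
    (hB : SatisfiesB (p / r) (complementary B)) :
    ∃ C : ℝ≥0, ∀ (a : Eu n) (ℓ : ℝ), 0 < ℓ → ∀ h g : Eu n → ℝ≥0, AEMeasurable h volume →
      AEMeasurable g volume → ∫⁻ x,
        orliczMax (complementary B) a ℓ h x ^ (1 / r) * orliczMax (complementary A) a ℓ g x ≤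
          C * ((∫⁻ x, (h x : ℝ≥0∞) ^ (p / r)) ^ (1 / p) *
            (∫⁻ x, (g x : ℝ≥0∞) ^ p') ^ (1 / p')) := by
  have hp := hpp.pos
  have hp' := hpp.symm.pos
  obtain ⟨CA, hCA⟩ := lintegral_orliczMax_rpow_le n (complementary_mono A)
    (fun _ => complementary_mul_le A) hp' hA
  obtain ⟨CB, hCB⟩ := lintegral_orliczMax_rpow_le n (complementary_mono B)
    (fun _ => complementary_mul_le B) (div_pos hp hr) hB
  refine ⟨CB ^ (1 / p) * CA ^ (1 / p'), fun a ℓ hℓ h g hh hg => ?_⟩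
  calc _ ≤ (∫⁻ x, (orliczMax (complementary B) a ℓ h x ^ (1 / r)) ^ p) ^ (1 / p) *
        (∫⁻ x, orliczMax (complementary A) a ℓ g x ^ p') ^ (1 / p') :=
        ENNReal.lintegral_mul_le_Lp_mul_Lq volume hpp
          (measurable_orliczMax.pow_const (1 / r)).aemeasurable measurable_orliczMax.aemeasurable
    _ ≤ (CB * ∫⁻ x, (h x : ℝ≥0∞) ^ (p / r)) ^ (1 / p) *
        (CA * ∫⁻ x, (g x : ℝ≥0∞) ^ p') ^ (1 / p') := by
        simp only [← ENNReal.rpow_mul, one_div_mul_eq_div r p]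
        gcongr
        exacts [hCB a ℓ hℓ h hh, hCA a ℓ hℓ g hg]
    _ = _ := by
        rw [ENNReal.mul_rpow_of_nonneg _ _ (by positivity),
          ENNReal.mul_rpow_of_nonneg _ _ (by positivity), ENNReal.coe_mul,
          ENNReal.coe_rpow_of_nonneg _ (by positivity),
          ENNReal.coe_rpow_of_nonneg _ (by positivity)]
        ring

namespace IsBumpPair

lemma luxNorm_left_ne_zero (H : IsBumpPair A B r κ W V) (hℓ : 0 < ℓ) (Q : DyadicIndex n) :
    luxNorm (A ·) volume[|dyadicTriple a ℓ Q] W ≠ 0 :=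
  luxNorm_dyadicTriple_ne_zero H.monotone_left H.tendsto_left H.aemeasurable_left H.pos_left hℓ Q

lemma luxNorm_right_ne_zero (H : IsBumpPair A B r κ W V) (hℓ : 0 < ℓ) (Q : DyadicIndex n) :
    luxNorm (B ·) volume[|dyadicTriple a ℓ Q] V ≠ 0 :=
  luxNorm_dyadicTriple_ne_zero H.monotone_right H.tendsto_right H.aemeasurable_right H.pos_right
    hℓ Q

lemma luxNorm_dyadicTriple_mul_le (H : IsBumpPair A B r κ W V) (hℓ : 0 < ℓ) (Q : DyadicIndex n) :
    luxNorm (A ·) volume[|dyadicTriple a ℓ Q] W *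
      luxNorm (B ·) volume[|dyadicTriple a ℓ Q] V ^ (1 / r) ≤ κ :=
  H.luxNorm_mul_le _ _ (mul_pos three_pos (dyadicSide_pos hℓ Q))

lemma luxNorm_right_ne_top (H : IsBumpPair A B r κ W V) (hr : 0 < r) (hℓ : 0 < ℓ)
    (Q : DyadicIndex n) : luxNorm (B ·) volume[|dyadicTriple a ℓ Q] V ≠ ∞ := by
  intro htop
  have hle := H.luxNorm_dyadicTriple_mul_le (a := a) hℓ Q
  rw [htop, ENNReal.top_rpow_of_pos (by positivity),
    ENNReal.mul_top (H.luxNorm_left_ne_zero hℓ Q)] at hle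
  exact ENNReal.coe_ne_top (top_unique hle)

lemma luxNorm_left_ne_top (H : IsBumpPair A B r κ W V) (hr : 0 < r) (hℓ : 0 < ℓ)
    (Q : DyadicIndex n) : luxNorm (A ·) volume[|dyadicTriple a ℓ Q] W ≠ ∞ := by
  intro htop
  have hle := H.luxNorm_dyadicTriple_mul_le (a := a) hℓ Q
  have hV : luxNorm (B ·) volume[|dyadicTriple a ℓ Q] V ^ (1 / r) ≠ 0 := by
    simp [H.luxNorm_right_ne_zero hℓ Q, H.luxNorm_right_ne_top hr hℓ Q]
  rw [htop, ENNReal.top_mul hV] at hle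
  exact ENNReal.coe_ne_top (top_unique hle)

lemma avg_le_luxNorm (H : IsBumpPair A B r κ W V) (hr : 0 < r)
    (hfh : ∀ᵐ x, ‖f x‖ₑ ^ r = V x * h x) (hℓ : 0 < ℓ) (Q : DyadicIndex n) :
    avg r a ℓ f Q ≤ (2 * (luxNorm (B ·) volume[|dyadicTriple a ℓ Q] V *
      luxNorm (complementary B) volume[|dyadicTriple a ℓ Q] h)) ^ (1 / r) := by
  rw [avg, eLpNorm'_eq_lintegral_enorm,
    lintegral_congr_ae (ProbabilityTheory.cond_absolutelyContinuous.ae_le hfh)]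
  refine ENNReal.rpow_le_rpow ?_ (by positivity)
  exact lintegral_mul_le_luxNorm_mul_luxNorm H.monotone_right.measurable
    (H.aemeasurable_right.mono_ac ProbabilityTheory.cond_absolutelyContinuous)
    (H.luxNorm_right_ne_zero hℓ Q) (H.luxNorm_right_ne_top hr hℓ Q)

lemma setLIntegral_mul_le (H : IsBumpPair A B r κ W V) (hr : 0 < r) (hℓ : 0 < ℓ)
    (g : Eu n → ℝ≥0) (Q : DyadicIndex n) :
    ∫⁻ x in dyadicCube a ℓ Q, (W x : ℝ≥0∞) * g x ≤ 3 ^ n * volume (dyadicCube a ℓ Q) *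
      (2 * (luxNorm (A ·) volume[|dyadicTriple a ℓ Q] W *
        luxNorm (complementary A) volume[|dyadicTriple a ℓ Q] g)) := by
  refine (lintegral_mono_set (dyadicCube_subset_dyadicTriple hℓ Q)).trans ?_
  rw [setLIntegral_dyadicTriple hℓ, volume_dyadicTriple]
  gcongr
  exact lintegral_mul_le_luxNorm_mul_luxNorm H.monotone_left.measurable
    (H.aemeasurable_left.mono_ac ProbabilityTheory.cond_absolutelyContinuous)
    (H.luxNorm_left_ne_zero hℓ Q) (H.luxNorm_left_ne_top hr hℓ Q)

lemma avg_mul_setLIntegral_le (H : IsBumpPair A B r κ W V) (hr : 0 < r)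
    (hfh : ∀ᵐ x, ‖f x‖ₑ ^ r = V x * h x) (hℓ : 0 < ℓ) (g : Eu n → ℝ≥0) (Q : DyadicIndex n) :
    avg r a ℓ f Q * ∫⁻ x in dyadicCube a ℓ Q, (W x : ℝ≥0∞) * g x ≤
      2 ^ (1 / r) * (2 * 3 ^ n) * κ *
        (luxNorm (complementary B) volume[|dyadicTriple a ℓ Q] h ^ (1 / r) *
          luxNorm (complementary A) volume[|dyadicTriple a ℓ Q] g *
            volume (dyadicCube a ℓ Q)) := by
  set bV := luxNorm (B ·) volume[|dyadicTriple a ℓ Q] V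
  set aW := luxNorm (A ·) volume[|dyadicTriple a ℓ Q] W
  set bh := luxNorm (complementary B) volume[|dyadicTriple a ℓ Q] h
  set ag := luxNorm (complementary A) volume[|dyadicTriple a ℓ Q] g
  calc avg r a ℓ f Q * ∫⁻ x in dyadicCube a ℓ Q, (W x : ℝ≥0∞) * g x
      ≤ (2 * (bV * bh)) ^ (1 / r) *
          (3 ^ n * volume (dyadicCube a ℓ Q) * (2 * (aW * ag))) :=
        mul_le_mul' (H.avg_le_luxNorm hr hfh hℓ Q) (H.setLIntegral_mul_le hr hℓ g Q)
    _ = 2 ^ (1 / r) * (2 * 3 ^ n) * (aW * bV ^ (1 / r)) *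
          (bh ^ (1 / r) * ag * volume (dyadicCube a ℓ Q)) := by
        rw [ENNReal.mul_rpow_of_nonneg _ _ (by positivity),
          ENNReal.mul_rpow_of_nonneg _ _ (by positivity)]
        ring
    _ ≤ _ := by
        gcongr
        exact H.luxNorm_dyadicTriple_mul_le hℓ Q

lemma lintegral_sparseSum_mul_le (H : IsBumpPair A B r κ W V) (hr : 0 < r)
    (hfh : ∀ᵐ x, ‖f x‖ₑ ^ r = V x * h x) (hℓ : 0 < ℓ) (hg : AEMeasurable g volume)
    {S : Set (DyadicIndex n)} (hS : IsSparse volume (dyadicCube a ℓ) S) :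
    ∫⁻ x, sparseSum (dyadicCube a ℓ) S (avg r a ℓ f) x * (W x * g x) ≤
      2 ^ (1 / r) * (2 * 3 ^ n) * κ * (2 * ∫⁻ x,
        orliczMax (complementary B) a ℓ h x ^ (1 / r) * orliczMax (complementary A) a ℓ g x) := by
  have hWg : AEMeasurable (fun x => (W x : ℝ≥0∞) * g x) volume :=
    H.aemeasurable_left.coe_nnreal_ennreal.mul hg.coe_nnreal_ennreal
  rw [lintegral_sparseSum_mul (measurableSet_dyadicCube a ℓ) S _ hWg]
  refine (ENNReal.tsum_le_tsum fun Q : S => H.avg_mul_setLIntegral_le hr hfh hℓ g Q).trans ?_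
  rw [ENNReal.tsum_mul_left]
  gcongr
  refine hS.tsum_mul_measure_le (c := fun Q =>
    luxNorm (complementary B) volume[|dyadicTriple a ℓ Q] h ^ (1 / r) *
      luxNorm (complementary A) volume[|dyadicTriple a ℓ Q] g) fun Q x hx => ?_
  gcongr <;> exact luxNorm_le_orliczMax hx

lemma avg_ne_top (H : IsBumpPair A B r κ W V) (hr : 0 < r)
    (hfh : ∀ᵐ x, ‖f x‖ₑ ^ r = V x * h x) (hℓ : 0 < ℓ) {q : ℝ} (hq : 0 < q)
    (hfin : ∫⁻ x, orliczMax (complementary B) a ℓ h x ^ q ≠ ∞) (Q : DyadicIndex n) :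
    avg r a ℓ f Q ≠ ∞ := by
  have hlux : luxNorm (complementary B) volume[|dyadicTriple a ℓ Q] h ≠ ∞ := by
    intro htop
    refine hfin (top_unique ?_)
    calc ∞ = ∫⁻ _ in dyadicCube a ℓ Q, ∞ := by
          rw [setLIntegral_const, ENNReal.top_mul (volume_dyadicCube_ne_zero hℓ Q)]
      _ ≤ ∫⁻ x in dyadicCube a ℓ Q, orliczMax (complementary B) a ℓ h x ^ q := by
          refine setLIntegral_mono' (measurableSet_dyadicCube a ℓ Q) fun x hx => ?_
          rw [top_unique (htop.symm.trans_le (luxNorm_le_orliczMax hx)),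
            ENNReal.top_rpow_of_pos hq]
      _ ≤ _ := setLIntegral_le_lintegral _ _
  refine ne_top_of_le_ne_top ?_ (H.avg_le_luxNorm hr hfh hℓ Q)
  have := H.luxNorm_right_ne_top (a := a) hr hℓ Q
  exact ENNReal.rpow_ne_top_of_nonneg (by positivity) (by finiteness)

theorem exists_lintegral_sparseSum_mul_rpow_le (H : IsBumpPair A B r κ W V) (hr : 0 < r)
    {p p' : ℝ} (hpp : p.HolderConjugate p') (hA : SatisfiesB p' (complementary A))
    (hB : SatisfiesB (p / r) (complementary B)) :
    ∃ C : ℝ≥0, ∀ (a : Eu n) (ℓ : ℝ), 0 < ℓ → ∀ (f : Eu n → ℂ) (h : Eu n → ℝ≥0),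
      AEMeasurable h volume → (∀ᵐ x, ‖f x‖ₑ ^ r = V x * h x) →
      ∀ S : Set (DyadicIndex n), IsSparse volume (dyadicCube a ℓ) S →
        ∫⁻ x, (sparseSum (dyadicCube a ℓ) S (avg r a ℓ f) x * W x) ^ p ≤
          C * ∫⁻ x, (h x : ℝ≥0∞) ^ (p / r) := by
  obtain ⟨C, hC⟩ := exists_lintegral_orliczMax_mul_orliczMax_le n hr hpp hA hB
  set c : ℝ≥0 := 2 ^ (1 / r) * (2 * 3 ^ n) * κ * (2 * C) with hc
  have hc' : (c : ℝ≥0∞) = 2 ^ (1 / r) * (2 * 3 ^ n) * κ * (2 * C) := by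
    rw [hc]
    push_cast [ENNReal.coe_rpow_of_nonneg _ (by positivity : 0 ≤ 1 / r)]
    rfl
  refine ⟨c ^ p, fun a ℓ hℓ f h hh hfh S hS => ?_⟩
  set I := ∫⁻ x, (h x : ℝ≥0∞) ^ (p / r)
  have hbilinear (g : Eu n → ℝ≥0) (hg : Measurable g) :
      ∫⁻ x, sparseSum (dyadicCube a ℓ) S (avg r a ℓ f) x * W x * g x ≤
        c * I ^ (1 / p) * (∫⁻ x, (g x : ℝ≥0∞) ^ p') ^ (1 / p') := by
    simp only [mul_assoc (sparseSum _ _ _ _)]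
    calc _ ≤ _ := H.lintegral_sparseSum_mul_le hr hfh hℓ hg.aemeasurable hS
      _ ≤ 2 ^ (1 / r) * (2 * 3 ^ n) * κ * (2 * (C * (I ^ (1 / p) *
          (∫⁻ x, (g x : ℝ≥0∞) ^ p') ^ (1 / p')))) := by
          gcongr
          exact hC a ℓ hℓ h g hh hg.aemeasurable
      _ = _ := by rw [hc']; ring
  refine (lintegral_rpow_le_of_forall_mul ((measurable_sparseSum (measurableSet_dyadicCube a ℓ) S
    _).aemeasurable.mul H.aemeasurable_left.coe_nnreal_ennreal) hpp hbilinear).trans_eq ?_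
  rw [ENNReal.mul_rpow_of_nonneg _ _ hpp.nonneg, ← ENNReal.rpow_mul,
    one_div_mul_cancel hpp.ne_zero, ENNReal.rpow_one, ENNReal.coe_rpow_of_nonneg _ hpp.nonneg]

end IsBumpPair

end Bump

/-! ### The two-weight inequality -/

section LocalBound

variable {n : ℕ} {ι : Type*} {T : (Eu n → ℂ) → Eu n → ℂ} {K : Eu n → Eu n → ℂ}
  {φ : ι → Eu n → ℝ} {A B : ℝ≥0 → ℝ≥0} {r p : ℝ} {κ c : ℝ≥0} {W V h : Eu n → ℝ≥0}
  {f : Eu n → ℂ} {a : Eu n} {ℓ : ℝ}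

namespace IsBumpPair

lemma avg_ne_top_of_lintegral_rpow_ne_top (H : IsBumpPair A B r κ W V) (hr : 0 < r) (hp : 0 < p)
    (hB : SatisfiesB (p / r) (complementary B)) (hh : AEMeasurable h volume)
    (hfh : ∀ᵐ x, ‖f x‖ₑ ^ r = V x * h x) (hfin : ∫⁻ x, (h x : ℝ≥0∞) ^ (p / r) ≠ ∞) (hℓ : 0 < ℓ)
    (Q : DyadicIndex n) : avg r a ℓ f Q ≠ ∞ := by
  obtain ⟨C, hC⟩ := lintegral_orliczMax_rpow_le n (complementary_mono B)
    (fun _ => complementary_mul_le B) (div_pos hp hr) hB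
  exact H.avg_ne_top hr hfh hℓ (div_pos hp hr)
    (ne_top_of_le_ne_top (ENNReal.mul_ne_top ENNReal.coe_ne_top hfin) (hC a ℓ hℓ h hh)) Q

lemma memLp_indicator_tripleCube (H : IsBumpPair A B r κ W V) (hr : 0 < r) (hp : 0 < p)
    (hB : SatisfiesB (p / r) (complementary B)) (hf : AEStronglyMeasurable f volume)
    (hh : AEMeasurable h volume) (hfh : ∀ᵐ x, ‖f x‖ₑ ^ r = V x * h x)
    (hfin : ∫⁻ x, (h x : ℝ≥0∞) ^ (p / r) ≠ ∞) (hℓ : 0 < ℓ) :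
    MemLp ((tripleCube a ℓ).indicator f) (ENNReal.ofReal r) volume := by
  rw [← dyadicTriple_zero]
  exact memLp_localize_of_avg_ne_top hℓ hr hf
    (H.avg_ne_top_of_lintegral_rpow_ne_top hr hp hB hh hfh hfin hℓ (0, 0))

theorem exists_setLIntegral_maxMod_mul_rpow_le (H : IsBumpPair A B r κ W V)
    (hT : IsRepresentedBy T K) (hK : IsCZKernel K) (hφ : ∀ α, Measurable (φ α)) (hr : 1 ≤ r)
    (hwt : HasWeakType T φ r c) {p' : ℝ} (hpp : p.HolderConjugate p')
    (hA : SatisfiesB p' (complementary A)) (hB : SatisfiesB (p / r) (complementary B)) :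
    ∃ C : ℝ≥0, ∀ (a : Eu n) (ℓ : ℝ), 0 < ℓ → ∀ (f : Eu n → ℂ) (h : Eu n → ℝ≥0),
      MemLp f 2 volume → AEMeasurable h volume → (∀ᵐ x, ‖f x‖ₑ ^ r = V x * h x) →
      ∫⁻ x, (h x : ℝ≥0∞) ^ (p / r) ≠ ∞ →
        ∫⁻ x in cube a ℓ, (maxMod T φ ((tripleCube a ℓ).indicator f) x * W x) ^ p ≤
          C * ∫⁻ x, (h x : ℝ≥0∞) ^ (p / r) := by
  have hr0 : 0 < r := one_pos.trans_le hr
  have hp := hpp.pos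
  obtain ⟨C₁, hC₁⟩ := exists_isSparse_maxMod_le hT hK hφ hr hwt
  obtain ⟨C₂, hC₂⟩ := H.exists_lintegral_sparseSum_mul_rpow_le hr0 hpp hA hB
  refine ⟨C₁ ^ p * C₂, fun a ℓ hℓ f h hf hh hfh hfin => ?_⟩
  obtain ⟨S, hS, hdom⟩ := hC₁ a ℓ hℓ f hf
    (H.avg_ne_top_of_lintegral_rpow_ne_top hr0 hp hB hh hfh hfin hℓ) (0, 0)
  rw [dyadicCube_zero, localize, dyadicTriple_zero] at hdom
  set s := sparseSum (dyadicCube a ℓ) S (avg r a ℓ f)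
  calc ∫⁻ x in cube a ℓ, (maxMod T φ ((tripleCube a ℓ).indicator f) x * W x) ^ p
      ≤ ∫⁻ x in cube a ℓ, (C₁ : ℝ≥0∞) ^ p * (s x * W x) ^ p := by
        refine lintegral_mono_ae ?_
        filter_upwards [ae_restrict_of_ae hdom, ae_restrict_mem (measurableSet_cube a ℓ)]
          with x hx hxa
        rw [← ENNReal.mul_rpow_of_nonneg _ _ hp.le, ← mul_assoc]
        gcongr
        exact hx hxa
    _ ≤ ∫⁻ x, (C₁ : ℝ≥0∞) ^ p * (s x * W x) ^ p := setLIntegral_le_lintegral _ _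
    _ = (C₁ : ℝ≥0∞) ^ p * ∫⁻ x, (s x * W x) ^ p :=
        lintegral_const_mul' _ _ (by finiteness)
    _ ≤ (C₁ : ℝ≥0∞) ^ p * (C₂ * ∫⁻ x, (h x : ℝ≥0∞) ^ (p / r)) := by
        gcongr
        exact hC₂ a ℓ hℓ f h hh hfh S hS
    _ = _ := by rw [ENNReal.coe_mul, ENNReal.coe_rpow_of_nonneg _ hp.le, mul_assoc]

end IsBumpPair

end LocalBound

/-! ### Truncation -/

section Truncation

variable {n : ℕ} {ι : Type*} {T : (Eu n → ℂ) → Eu n → ℂ} {K : Eu n → Eu n → ℂ}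
  {φ : ι → Eu n → ℝ} {f : Eu n → ℂ} {x : Eu n} {k : ℕ}

/-- The `k`-th cube `[-(k + 1), k + 1)ⁿ` of an exhaustion of the space. -/
def box (n k : ℕ) : Set (Eu n) := cube (WithLp.toLp 2 fun _ => -((k : ℝ) + 1)) (2 * (k + 1))

/-- The cube `[-3 (k + 1), 3 (k + 1))ⁿ`, the triple of `box n k`. -/
def tripleBox (n k : ℕ) : Set (Eu n) :=
  tripleCube (WithLp.toLp 2 fun _ => -((k : ℝ) + 1)) (2 * (k + 1))

lemma measurableSet_box (n k : ℕ) : MeasurableSet (box n k) := measurableSet_cube _ _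

lemma measurableSet_tripleBox (n k : ℕ) : MeasurableSet (tripleBox n k) :=
  measurableSet_tripleCube _ _

lemma box_subset_tripleBox (n k : ℕ) : box n k ⊆ tripleBox n k :=
  cube_subset_tripleCube (by positivity)

lemma eventually_mem_box (x : Eu n) : ∀ᶠ k : ℕ in Filter.atTop, x ∈ box n k := by
  filter_upwards [(tendsto_natCast_atTop_atTop (R := ℝ)).eventually_gt_atTop ‖x‖] with k hk i
  obtain ⟨hlo, hhi⟩ := abs_lt.1 ((PiLp.norm_apply_le x i).trans_lt hk)
  exact ⟨by simp only; linarith, by simp only; linarith⟩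

lemma one_le_norm_sub_of_notMem_tripleBox {y : Eu n} (hx : x ∈ box n k)
    (hy : y ∉ tripleBox n k) : 1 ≤ ‖x - y‖ := by
  have := le_norm_sub_of_notMem_tripleCube hx hy
  have : (0 : ℝ) ≤ k := k.cast_nonneg
  linarith

lemma integrable_one_add_norm_sub_rpow_mul_norm (hn : 0 < n) (hf : MemLp f 2 volume)
    (x : Eu n) : Integrable fun y => (1 + ‖x - y‖) ^ (-(n : ℝ)) * ‖f y‖ := by
  refine MemLp.integrable_mul (p := 2) (q := 2) ?_ hf.norm
  have hmeas : Measurable fun y : Eu n => (1 + ‖x - y‖) ^ (-(n : ℝ)) := by fun_prop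
  rw [memLp_two_iff_integrable_sq hmeas.aestronglyMeasurable]
  have hint : Integrable (fun y : Eu n => (1 + ‖y‖) ^ (-(2 * n : ℝ))) volume :=
    integrable_one_add_norm (by
      rw [finrank_euclideanSpace_fin]
      have : (0 : ℝ) < n := by exact_mod_cast hn
      linarith)
  refine (hint.comp_sub_left x).congr (ae_of_all _ fun y => ?_)
  simp only
  rw [← Real.rpow_natCast, ← Real.rpow_mul (by positivity)]
  congr 1
  push_cast
  ring

lemma IsCZKernel.exists_norm_le_one_add_norm_rpow (hK : IsCZKernel K) :
    ∃ C : ℝ, ∀ x y : Eu n, 1 ≤ ‖x - y‖ → ‖K x y‖ ≤ C * (1 + ‖x - y‖) ^ (-(n : ℝ)) := by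
  obtain ⟨C, -, hC⟩ := hK.exists_norm_le
  refine ⟨C * 2 ^ n, fun x y hxy => ?_⟩
  refine (hC x y ((1 + ‖x - y‖) / 2) (by positivity) (by linarith)).trans_eq ?_
  rw [Real.rpow_neg (by positivity), Real.rpow_natCast, div_pow]
  field_simp

lemma exists_maxMod_indicator_compl_tripleBox_le (hT : IsRepresentedBy T K) (hK : IsCZKernel K)
    (hφ : ∀ α, Measurable (φ α)) :
    ∃ C : ℝ, ∀ f : Eu n → ℂ, MemLp f 2 volume → ∀ k, ∀ x ∈ box n k,
      maxMod T φ ((tripleBox n k)ᶜ.indicator f) x ≤ ∫⁻ y in (tripleBox n k)ᶜ,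
        ENNReal.ofReal (C * ((1 + ‖x - y‖) ^ (-(n : ℝ)) * ‖f y‖)) := by
  obtain ⟨C, hC⟩ := hK.exists_norm_le_one_add_norm_rpow
  refine ⟨C, fun f hf k x hx => ?_⟩
  have hfar : ∀ y, (tripleBox n k)ᶜ.indicator f y ≠ 0 → 1 ≤ ‖x - y‖ := fun y hy =>
    one_le_norm_sub_of_notMem_tripleBox hx (Set.mem_of_indicator_ne_zero hy)
  refine (maxMod_le_lintegral hT hφ (hf.indicator (measurableSet_tripleBox n k).compl)
    (notMem_tsupport_of_le one_pos hfar)).trans ?_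
  rw [← lintegral_indicator (measurableSet_tripleBox n k).compl]
  refine lintegral_mono fun y => ?_
  by_cases hy : y ∈ (tripleBox n k)ᶜ
  · rw [Set.indicator_of_mem hy, Set.indicator_of_mem hy, ← ofReal_norm, ← ofReal_norm,
      ← ENNReal.ofReal_mul (norm_nonneg _), ← mul_assoc]
    gcongr
    exact hC x y (one_le_norm_sub_of_notMem_tripleBox hx hy)
  · simp [Set.indicator_of_notMem hy]

lemma tendsto_setLIntegral_compl_tripleBox {G : Eu n → ℝ≥0∞} (hG : AEMeasurable G volume)
    (hfin : ∫⁻ y, G y ≠ ∞) :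
    Filter.Tendsto (fun k => ∫⁻ y in (tripleBox n k)ᶜ, G y) Filter.atTop (nhds 0) := by
  simp_rw [← lintegral_indicator (measurableSet_tripleBox n _).compl]
  rw [← lintegral_zero (μ := (volume : Measure (Eu n)))]
  refine tendsto_lintegral_of_dominated_convergence' G
    (fun k => hG.indicator (measurableSet_tripleBox n k).compl)
    (fun k => ae_of_all _ (Set.indicator_le_self _ _)) hfin (ae_of_all _ fun y => ?_)
  refine tendsto_const_nhds.congr' ?_
  filter_upwards [eventually_mem_box y] with k hk
  exact (Set.indicator_of_notMem (Set.notMem_compl_iff.2 (box_subset_tripleBox n k hk)) G).symm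

lemma tendsto_maxMod_indicator_compl_tripleBox (hn : 0 < n) (hT : IsRepresentedBy T K)
    (hK : IsCZKernel K) (hφ : ∀ α, Measurable (φ α)) (hf : MemLp f 2 volume) (x : Eu n) :
    Filter.Tendsto (fun k => maxMod T φ ((tripleBox n k)ᶜ.indicator f) x) Filter.atTop
      (nhds 0) := by
  obtain ⟨C, hC⟩ := exists_maxMod_indicator_compl_tripleBox_le hT hK hφ
  have hint := (integrable_one_add_norm_sub_rpow_mul_norm hn hf x).const_mul C
  refine tendsto_of_tendsto_of_tendsto_of_le_of_le' tendsto_const_nhds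
    (tendsto_setLIntegral_compl_tripleBox hint.aemeasurable.ennreal_ofReal
      hint.lintegral_lt_top.ne) (Filter.Eventually.of_forall fun _ => zero_le) ?_
  filter_upwards [eventually_mem_box x] with k hk using hC f hf k x hk

lemma tendsto_maxMod_indicator_tripleBox (hn : 0 < n) (hT : IsRepresentedBy T K)
    (hK : IsCZKernel K) (hφ : ∀ α, Measurable (φ α)) (hf : MemLp f 2 volume) (x : Eu n) :
    Filter.Tendsto (fun k => maxMod T φ ((tripleBox n k).indicator f) x) Filter.atTop
      (nhds (maxMod T φ f x)) := by
  have hzero := tendsto_maxMod_indicator_compl_tripleBox hn hT hK hφ hf x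
  have hin k : MemLp ((tripleBox n k).indicator f) 2 volume :=
    hf.indicator (measurableSet_tripleBox n k)
  simp only [Set.indicator_compl] at hzero
  refine tendsto_of_tendsto_of_tendsto_of_le_of_le
    (g := fun k => maxMod T φ f x - maxMod T φ (f - (tripleBox n k).indicator f) x)
    (h := fun k => maxMod T φ f x + maxMod T φ (f - (tripleBox n k).indicator f) x)
    ?_ ?_ (fun k => tsub_le_iff_right.2 (maxMod_le_add_sub hT hφ hf (hin k) x)) fun k => ?_
  · simpa only [tsub_zero] using
      ENNReal.Tendsto.sub tendsto_const_nhds hzero (.inr ENNReal.zero_ne_top)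
  · simpa only [add_zero] using tendsto_const_nhds.add hzero
  · simpa only [sub_sub_cancel] using maxMod_sub_le hT hφ hf (hf.sub (hin k)) x

lemma aemeasurable_maxMod_of_indicator_tripleBox (hn : 0 < n) (hT : IsRepresentedBy T K)
    (hK : IsCZKernel K) (hφ : ∀ α, Measurable (φ α)) (hf : MemLp f 2 volume)
    (hmeas : ∀ k, AEMeasurable (maxMod T φ ((tripleBox n k).indicator f)) volume) :
    AEMeasurable (maxMod T φ f) volume :=
  aemeasurable_of_tendsto_metrizable_ae Filter.atTop hmeas
    (ae_of_all _ fun x => tendsto_maxMod_indicator_tripleBox hn hT hK hφ hf x)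

lemma lintegral_maxMod_mul_rpow_le_of_setLIntegral_box_le (hn : 0 < n)
    (hT : IsRepresentedBy T K) (hK : IsCZKernel K) (hφ : ∀ α, Measurable (φ α))
    (hf : MemLp f 2 volume)
    (hmeas : ∀ k, AEMeasurable (maxMod T φ ((tripleBox n k).indicator f)) volume)
    {W : Eu n → ℝ≥0} (hW : AEMeasurable W volume) {p : ℝ} {b : ℝ≥0∞}
    (hb : ∀ k, ∫⁻ x in box n k, (maxMod T φ ((tripleBox n k).indicator f) x * W x) ^ p ≤ b) :
    ∫⁻ x, (maxMod T φ f x * W x) ^ p ≤ b := by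
  set F : ℕ → Eu n → ℝ≥0∞ := fun k => (box n k).indicator
    fun x => (maxMod T φ ((tripleBox n k).indicator f) x * W x) ^ p with hF
  have hlim x : Filter.Tendsto (F · x) Filter.atTop (nhds ((maxMod T φ f x * W x) ^ p)) := by
    have h := (ENNReal.continuous_rpow_const (y := p)).continuousAt.tendsto.comp
      (ENNReal.Tendsto.mul_const (b := W x)
        (tendsto_maxMod_indicator_tripleBox hn hT hK hφ hf x) (.inr ENNReal.coe_ne_top))
    refine h.congr' ?_
    filter_upwards [eventually_mem_box x] with k hk
    simp only [hF, Set.indicator_of_mem hk, Function.comp]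
  have hFmeas k : AEMeasurable (F k) volume :=
    (((hmeas k).mul hW.coe_nnreal_ennreal).pow_const p).indicator (measurableSet_box n k)
  calc ∫⁻ x, (maxMod T φ f x * W x) ^ p
      = ∫⁻ x, Filter.liminf (F · x) Filter.atTop :=
        lintegral_congr fun x => (hlim x).liminf_eq.symm
    _ ≤ Filter.liminf (fun k => ∫⁻ x, F k x) Filter.atTop := lintegral_liminf_le' hFmeas
    _ ≤ b := by
        refine Filter.liminf_le_of_le (by isBoundedDefault) fun c hc => ?_
        obtain ⟨k, hk⟩ := hc.exists
        refine hk.trans ?_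
        rw [hF, lintegral_indicator (measurableSet_box n k)]
        exact hb k

end Truncation

section TwoWeight

variable {n : ℕ} {ι : Type*} {T : (Eu n → ℂ) → Eu n → ℂ} {K : Eu n → Eu n → ℂ}
  {φ : ι → Eu n → ℝ} {A B : ℝ≥0 → ℝ≥0} {r p : ℝ} {c : ℝ≥0} {u v : Eu n → ℝ}

theorem IsBumpPair.exists_lintegral_maxMod_mul_rpow_le {κ : ℝ≥0} {W V : Eu n → ℝ≥0}
    (H : IsBumpPair A B r κ W V) (hn : 0 < n) (hT : IsRepresentedBy T K) (hK : IsCZKernel K)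
    (hφ : ∀ α, Measurable (φ α)) (hr : 1 ≤ r) (hwt : HasWeakType T φ r c) {p' : ℝ}
    (hpp : p.HolderConjugate p') (hA : SatisfiesB p' (complementary A))
    (hB : SatisfiesB (p / r) (complementary B)) :
    ∃ C : ℝ≥0, ∀ (f : Eu n → ℂ) (h : Eu n → ℝ≥0), MemLp f 2 volume → AEMeasurable h volume →
      (∀ᵐ x, ‖f x‖ₑ ^ r = V x * h x) → ∫⁻ x, (h x : ℝ≥0∞) ^ (p / r) ≠ ∞ →
        AEMeasurable (maxMod T φ f) volume ∧
          ∫⁻ x, (maxMod T φ f x * W x) ^ p ≤ C * ∫⁻ x, (h x : ℝ≥0∞) ^ (p / r) := by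
  obtain ⟨C, hC⟩ := H.exists_setLIntegral_maxMod_mul_rpow_le hT hK hφ hr hwt hpp hA hB
  refine ⟨C, fun f h hf hh hfh hfin => ?_⟩
  have hmeas k : AEMeasurable (maxMod T φ ((tripleBox n k).indicator f)) volume :=
    (hwt _ (hf.indicator (measurableSet_tripleBox n k)) (H.memLp_indicator_tripleCube
      (by linarith) hpp.pos hB hf.1 hh hfh hfin (by positivity))).1
  exact ⟨aemeasurable_maxMod_of_indicator_tripleBox hn hT hK hφ hf hmeas,
    lintegral_maxMod_mul_rpow_le_of_setLIntegral_box_le hn hT hK hφ hf hmeas H.aemeasurable_left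
      fun k => hC _ _ (by positivity) f h hf hh hfh hfin⟩

lemma luxemburg_rpow_eq_luxNorm {w : Eu n → ℝ} (hw : ∀ᵐ x, 0 < w x) (s : ℝ) (Q : Set (Eu n)) :
    luxemburg A Q (fun x => w x ^ s) = luxNorm (A ·) volume[|Q] fun x => (w x).toNNReal ^ s := by
  calc luxemburg A Q (fun x => w x ^ s)
      = luxNorm (A ·) volume[|Q] fun x => ‖w x ^ s‖₊ := by
        simp only [luxemburg, luxNorm, ProbabilityTheory.cond, lintegral_smul_measure,
          smul_eq_mul]
    _ = _ := by
        refine luxNorm_congr_ae (ProbabilityTheory.cond_absolutelyContinuous.ae_le ?_)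
        filter_upwards [hw] with x hx
        rw [← Real.toNNReal_rpow_of_nonneg hx.le,
          Real.toNNReal_eq_nnnorm_of_nonneg (Real.rpow_nonneg hx.le s)]

lemma isBumpPair_of_bump_ne_top (hA : Monotone A) (hB : Monotone B)
    (hAt : Filter.Tendsto A Filter.atTop Filter.atTop)
    (hBt : Filter.Tendsto B Filter.atTop Filter.atTop) (hu : AEMeasurable u volume)
    (hv : AEMeasurable v volume) (hu0 : ∀ᵐ x, 0 < u x) (hv0 : ∀ᵐ x, 0 < v x)
    (huv : bump p r A B u v ≠ ∞) :
    IsBumpPair A B r (bump p r A B u v).toNNReal (fun x => (u x).toNNReal ^ (1 / p))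
      fun x => (v x).toNNReal ^ (-r / p) where
  monotone_left := hA
  monotone_right := hB
  tendsto_left := hAt
  tendsto_right := hBt
  aemeasurable_left := hu.real_toNNReal.pow_const _
  aemeasurable_right := hv.real_toNNReal.pow_const _
  pos_left := hu0.mono fun _ hx => NNReal.rpow_pos (Real.toNNReal_pos.2 hx)
  pos_right := hv0.mono fun _ hx => NNReal.rpow_pos (Real.toNNReal_pos.2 hx)
  luxNorm_mul_le a ℓ hℓ := by
    rw [ENNReal.coe_toNNReal huv, ← luxemburg_rpow_eq_luxNorm hu0, ← luxemburg_rpow_eq_luxNorm hv0]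
    exact le_iSup_of_le a (le_iSup₂_of_le (f := fun ℓ (_ : 0 < ℓ) =>
      luxemburg A (cube a ℓ) (fun x => u x ^ (1 / p)) *
        luxemburg B (cube a ℓ) (fun x => v x ^ (-r / p)) ^ (1 / r)) ℓ hℓ le_rfl)

lemma enorm_rpow_eq_weight_rpow_mul (z : ℂ) {w : ℝ≥0} (hw : 0 < w) (hr : 0 ≤ r) :
    ‖z‖ₑ ^ r = (w ^ (-r / p) : ℝ≥0) * (‖z‖₊ ^ r * w ^ (r / p) : ℝ≥0) := by
  rw [← ENNReal.coe_mul, mul_left_comm, ← NNReal.rpow_add hw.ne', neg_div, neg_add_cancel,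
    NNReal.rpow_zero, mul_one, ENNReal.coe_rpow_of_nonneg _ hr, enorm_eq_nnnorm]

lemma coe_nnnorm_rpow_mul_rpow (z : ℂ) (w : ℝ≥0) (hr : 0 < r) (hp : 0 < p) :
    ((‖z‖₊ ^ r * w ^ (r / p) : ℝ≥0) : ℝ≥0∞) ^ (p / r) = ‖z‖ₑ ^ p * w := by
  rw [← ENNReal.coe_rpow_of_nonneg _ (by positivity), NNReal.mul_rpow, ← NNReal.rpow_mul,
    ← NNReal.rpow_mul, mul_div_cancel₀ p hr.ne', div_mul_div_cancel₀ hp.ne', div_self hr.ne',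
    NNReal.rpow_one, ENNReal.coe_mul, ENNReal.coe_rpow_of_nonneg _ hp.le, enorm_eq_nnnorm]

theorem exists_lintegral_maxMod_rpow_le (hn : 0 < n) (hT : IsRepresentedBy T K)
    (hK : IsCZKernel K) (hφ : ∀ α, Measurable (φ α)) (hr : 1 ≤ r) (hwt : HasWeakType T φ r c)
    {p' : ℝ} (hpp : p.HolderConjugate p') (hA : Monotone A) (hB : Monotone B)
    (hAt : Filter.Tendsto A Filter.atTop Filter.atTop)
    (hBt : Filter.Tendsto B Filter.atTop Filter.atTop)
    (hAp : SatisfiesB p' (complementary A)) (hBp : SatisfiesB (p / r) (complementary B))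
    (hu : AEMeasurable u volume) (hv : AEMeasurable v volume) (hu0 : ∀ᵐ x, 0 < u x)
    (hv0 : ∀ᵐ x, 0 < v x) (huv : bump p r A B u v ≠ ∞) :
    ∃ C : ℝ≥0, 0 < C ∧ ∀ f, MemLp f 2 volume → MemWeightedLp p v f →
      AEMeasurable (maxMod T φ f) volume ∧
        ∫⁻ x, maxMod T φ f x ^ p * ENNReal.ofReal (u x) ≤
          C * ∫⁻ x, ‖f x‖ₑ ^ p * ENNReal.ofReal (v x) := by
  have hr0 : 0 < r := one_pos.trans_le hr
  have hp := hpp.pos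
  have H := isBumpPair_of_bump_ne_top hA hB hAt hBt hu hv hu0 hv0 huv
  obtain ⟨C, hC⟩ := H.exists_lintegral_maxMod_mul_rpow_le hn hT hK hφ hr hwt hpp hAp hBp
  refine ⟨C + 1, by positivity, fun f hf hfv => ?_⟩
  set h : Eu n → ℝ≥0 := fun x => ‖f x‖₊ ^ r * (v x).toNNReal ^ (r / p)
  have hh : AEMeasurable h volume :=
    (hf.1.aemeasurable.nnnorm.pow_const r).mul (hv.real_toNNReal.pow_const (r / p))
  have hint : ∫⁻ x, (h x : ℝ≥0∞) ^ (p / r) = ∫⁻ x, ‖f x‖ₑ ^ p * ENNReal.ofReal (v x) :=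
    lintegral_congr fun x => coe_nnnorm_rpow_mul_rpow (f x) (v x).toNNReal hr0 hp
  obtain ⟨hmeas, hle⟩ := hC f h hf hh (hv0.mono fun x hx =>
    enorm_rpow_eq_weight_rpow_mul (f x) (Real.toNNReal_pos.2 hx) hr0.le) (hint ▸ hfv.2.ne)
  refine ⟨hmeas, ?_⟩
  calc ∫⁻ x, maxMod T φ f x ^ p * ENNReal.ofReal (u x)
      = ∫⁻ x, (maxMod T φ f x * ((u x).toNNReal ^ (1 / p) : ℝ≥0)) ^ p := by
        refine lintegral_congr fun x => ?_
        rw [ENNReal.mul_rpow_of_nonneg _ _ hp.le, ← ENNReal.coe_rpow_of_nonneg _ hp.le,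
          ← NNReal.rpow_mul, one_div_mul_cancel hp.ne', NNReal.rpow_one, ENNReal.ofReal]
    _ ≤ C * ∫⁻ x, ‖f x‖ₑ ^ p * ENNReal.ofReal (v x) := hint ▸ hle
    _ ≤ _ := by gcongr; exact le_self_add

end TwoWeight

/-! ### Extension to the weighted space -/

section DenseExtension

variable {X Y E F : Type*} [MeasurableSpace X] [MeasurableSpace Y] [NormedAddCommGroup E]
  [NormedAddCommGroup F] [CompleteSpace F] {μ : Measure X} {ν : Measure Y} {q : ℝ≥0∞}
  [Fact (1 ≤ q)] {D : Set (X → E)} {t : (X → E) → Y → F} {c : ℝ≥0}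

lemma dense_range_toLp (hD : ∀ f ∈ D, MemLp f q μ)
    (hdense : ∀ f, MemLp f q μ → ∀ ε ≠ 0, ∃ g ∈ D, eLpNorm (f - g) q μ < ε) :
    Dense (Set.range fun f : D => (hD f f.2).toLp f.1) := by
  refine EMetric.dense_iff.2 fun y ε hε => ?_
  obtain ⟨g, hg, hlt⟩ := hdense y (Lp.memLp y) ε hε.ne'
  refine ⟨(hD g hg).toLp g, ?_, ⟨g, hg⟩, rfl⟩
  rwa [Metric.mem_eball, edist_comm, ← Lp.toLp_coeFn y (Lp.memLp y), Lp.edist_toLp_toLp]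

theorem exists_extension_of_eLpNorm_sub_le (hD : ∀ f ∈ D, MemLp f q μ)
    (hdense : ∀ f, MemLp f q μ → ∀ ε ≠ 0, ∃ g ∈ D, eLpNorm (f - g) q μ < ε)
    (ht : ∀ f ∈ D, MemLp (t f) q ν)
    (hLip : ∀ f ∈ D, ∀ g ∈ D, eLpNorm (t f - t g) q ν ≤ c * eLpNorm (f - g) q μ) :
    ∃ S : (X → E) → Y → F, (∀ f, MemLp f q μ → MemLp (S f) q ν) ∧ (∀ f ∈ D, S f =ᵐ[ν] t f) ∧
      ∀ f g, MemLp f q μ → MemLp g q μ →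
        eLpNorm (S f - S g) q ν ≤ c * eLpNorm (f - g) q μ := by
  classical
  set e : D → Lp E q μ := fun f => (hD f f.2).toLp f.1
  have hs : Dense (Set.range e) := dense_range_toLp hD hdense
  set τ : Set.range e → Lp F q ν := fun y => (ht _ (Set.rangeSplitting e y).2).toLp _
  have hτ_edist (y : Set.range e) (f : D) :
      edist (τ y) ((ht f f.2).toLp _) ≤ c * edist (y : Lp E q μ) (e f) := by
    rw [← Set.apply_rangeSplitting e y, Lp.edist_toLp_toLp, Lp.edist_toLp_toLp]
    exact hLip _ (Set.rangeSplitting e y).2 _ f.2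
  have hτ : LipschitzWith c τ := fun y z => by
    rw [Subtype.edist_eq, ← Set.apply_rangeSplitting e z]
    exact hτ_edist y (Set.rangeSplitting e z)
  have hτe (f : D) : τ ⟨e f, Set.mem_range_self f⟩ = (ht f f.2).toLp _ := by
    simpa using hτ_edist ⟨e f, Set.mem_range_self f⟩ f
  refine ⟨fun f => if hf : MemLp f q μ then (hs.extend τ (hf.toLp f) : Lp F q ν) else 0,
    fun f hf => ?_, fun f hf => ?_, fun f g hf hg => ?_⟩
  · simpa only [dif_pos hf] using Lp.memLp _
  · have hext : hs.extend τ ((hD f hf).toLp f) = (ht f hf).toLp _ :=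
      (hs.extend_eq hτ.continuous ⟨_, Set.mem_range_self ⟨f, hf⟩⟩).trans (hτe ⟨f, hf⟩)
    simp only [dif_pos (hD f hf), hext]
    exact (ht f hf).coeFn_toLp
  · simp only [dif_pos hf, dif_pos hg]
    rw [← Lp.edist_def, ← Lp.edist_toLp_toLp _ _ hf hg]
    exact hs.lipschitzWith_extend hτ _ _

end DenseExtension

section WeightedExtension

variable {n : ℕ} {w u v : Eu n → ℝ} {p : ℝ} {f g : Eu n → ℂ}

/-- The measure `w dx`. -/
def weightMeasure (w : Eu n → ℝ) : Measure (Eu n) :=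
  volume.withDensity fun x => ENNReal.ofReal (w x)

lemma weightMeasure_absolutelyContinuous (w : Eu n → ℝ) : weightMeasure w ≪ volume :=
  withDensity_absolutelyContinuous _ _

lemma absolutelyContinuous_weightMeasure (hw : AEMeasurable w volume) (hw0 : ∀ᵐ x, 0 < w x) :
    volume ≪ weightMeasure w :=
  withDensity_absolutelyContinuous' hw.ennreal_ofReal
    (hw0.mono fun _ hx => (ENNReal.ofReal_pos.2 hx).ne')

lemma eLpNorm_weightMeasure_rpow {E : Type*} [NormedAddCommGroup E] (hp : 0 < p)
    (hw : AEMeasurable w volume) (f : Eu n → E) :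
    eLpNorm f (ENNReal.ofReal p) (weightMeasure w) ^ p =
      ∫⁻ x, ‖f x‖ₑ ^ p * ENNReal.ofReal (w x) := by
  rw [eLpNorm_eq_lintegral_rpow_enorm_toReal (by simpa using hp) ENNReal.ofReal_ne_top,
    ENNReal.toReal_ofReal hp.le, weightMeasure, ← ENNReal.rpow_mul, one_div_mul_cancel hp.ne',
    ENNReal.rpow_one, lintegral_withDensity_eq_lintegral_mul_non_measurable₀ _ hw.ennreal_ofReal
      (ae_of_all _ fun _ => ENNReal.ofReal_lt_top)]
  simp only [Pi.mul_apply, mul_comm]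

lemma memWeightedLp_iff_memLp (hp : 0 < p) (hw : AEMeasurable w volume)
    (hw0 : ∀ᵐ x, 0 < w x) :
    MemWeightedLp p w f ↔ MemLp f (ENNReal.ofReal p) (weightMeasure w) := by
  rw [MemWeightedLp, MemLp, ← eLpNorm_weightMeasure_rpow hp hw, ENNReal.rpow_lt_top_iff_of_pos hp]
  exact and_congr_left' ⟨fun hf => hf.mono_ac (weightMeasure_absolutelyContinuous w),
    fun hf => hf.mono_ac (absolutelyContinuous_weightMeasure hw hw0)⟩

lemma memLp_of_norm_le_indicator_closedBall {q : ℝ≥0∞} {R : ℝ}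
    (hf : AEStronglyMeasurable f volume)
    (hle : ∀ x, ‖f x‖ ≤ (Metric.closedBall 0 R).indicator (fun _ => R) x) : MemLp f q volume :=
  (memLp_indicator_const q measurableSet_closedBall R
    (.inr measure_closedBall_lt_top.ne)).of_le hf (ae_of_all _ fun x =>
      (hle x).trans (Real.le_norm_self _))

lemma MemWeightedLp.exists_memLp_two_lintegral_sub_lt (hp : 0 < p) (hw : AEMeasurable w volume)
    (hf : MemWeightedLp p w f) {ε : ℝ≥0∞} (hε : ε ≠ 0) :
    ∃ g, MemLp g 2 volume ∧ MemWeightedLp p w g ∧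
      ∫⁻ x, ‖f x - g x‖ₑ ^ p * ENNReal.ofReal (w x) < ε := by
  set s : ℕ → Set (Eu n) := fun k => {x | ‖x‖ ≤ k ∧ ‖f x‖ ≤ k}
  have hs k : NullMeasurableSet (s k) volume :=
    (measurableSet_le measurable_norm measurable_const).nullMeasurableSet.inter
      (nullMeasurableSet_le hf.1.norm.aemeasurable aemeasurable_const)
  have hmeas k : AEStronglyMeasurable ((s k).indicator f) volume := hf.1.indicator₀ (hs k)
  have htend : Filter.Tendsto
      (fun k => ∫⁻ x, ‖f x - (s k).indicator f x‖ₑ ^ p * ENNReal.ofReal (w x))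
      Filter.atTop (nhds 0) := by
    rw [← lintegral_zero (μ := (volume : Measure (Eu n)))]
    refine tendsto_lintegral_of_dominated_convergence'
      (fun x => ‖f x‖ₑ ^ p * ENNReal.ofReal (w x))
      (fun k => ((hf.1.sub (hmeas k)).enorm.pow_const p).mul hw.ennreal_ofReal)
      (fun k => ae_of_all _ fun x => ?_) hf.2.ne (ae_of_all _ fun x => ?_)
    · by_cases hx : x ∈ s k <;> simp [hx, hp]
    · refine tendsto_const_nhds.congr' ?_
      filter_upwards [tendsto_natCast_atTop_atTop.eventually_ge_atTop ‖x‖,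
        tendsto_natCast_atTop_atTop.eventually_ge_atTop ‖f x‖] with k hk hfk
      rw [Set.indicator_of_mem (show x ∈ s k from ⟨hk, hfk⟩)]
      simp [hp]
  obtain ⟨k, hk⟩ := (htend.eventually_lt_const (pos_iff_ne_zero.2 hε)).exists
  refine ⟨(s k).indicator f, memLp_of_norm_le_indicator_closedBall (R := k) (hmeas k)
    fun x => ?_, ⟨hmeas k, lt_of_le_of_lt (lintegral_mono fun x => ?_) hf.2⟩, hk⟩
  · by_cases hx : x ∈ s k
    · simpa [hx, hx.1] using hx.2
    · simpa [hx] using Set.indicator_nonneg (fun _ _ => k.cast_nonneg) x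
  · gcongr
    exact enorm_indicator_le_enorm_self f x

lemma enorm_toReal_sub_toReal_le {x y d : ℝ≥0∞} (hx : x ≠ ∞) (hy : y ≠ ∞) (hxy : x ≤ y + d)
    (hyx : y ≤ x + d) : ‖x.toReal - y.toReal‖ₑ ≤ d := by
  rcases eq_or_ne d ∞ with rfl | hd
  · exact le_top
  rw [← ofReal_norm, ← ENNReal.ofReal_toReal hd, Real.norm_eq_abs]
  refine ENNReal.ofReal_le_ofReal (abs_sub_le_iff.2 ⟨?_, ?_⟩)
  · rw [sub_le_iff_le_add', ← ENNReal.toReal_add hy hd]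
    exact ENNReal.toReal_mono (by finiteness) hxy
  · rw [sub_le_iff_le_add', ← ENNReal.toReal_add hx hd]
    exact ENNReal.toReal_mono (by finiteness) hyx

lemma edist_toNNReal_le (x y : ℝ) : edist x.toNNReal y.toNNReal ≤ ‖x - y‖ₑ := by
  have := (show LipschitzWith 1 Real.toNNReal from lipschitzWith_posPart) x y
  rwa [ENNReal.coe_one, one_mul, edist_eq_enorm_sub x y] at this

end WeightedExtension

section SublinearExtension

variable {n : ℕ} {u v : Eu n → ℝ} {p : ℝ} {C : ℝ≥0} {M : (Eu n → ℂ) → Eu n → ℝ≥0∞}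
  {f g : Eu n → ℂ}

lemma MemWeightedLp.sub (hp : 1 ≤ p) (hv : AEMeasurable v volume) (hv0 : ∀ᵐ x, 0 < v x)
    (hf : MemWeightedLp p v f) (hg : MemWeightedLp p v g) : MemWeightedLp p v (f - g) := by
  rw [memWeightedLp_iff_memLp (by linarith) hv hv0] at hf hg ⊢
  exact hf.sub hg

lemma ae_ne_top_of_lintegral_rpow_mul_lt_top (hp : 0 < p) (hu : AEMeasurable u volume)
    (hu0 : ∀ᵐ x, 0 < u x) {m : Eu n → ℝ≥0∞} (hm : AEMeasurable m volume)
    (hfin : ∫⁻ x, m x ^ p * ENNReal.ofReal (u x) < ∞) : ∀ᵐ x, m x ≠ ∞ := by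
  filter_upwards [ae_lt_top' ((hm.pow_const p).mul hu.ennreal_ofReal) hfin.ne, hu0]
    with x hx hux htop
  rw [Pi.mul_apply, htop, ENNReal.top_rpow_of_pos hp,
    ENNReal.top_mul (ENNReal.ofReal_pos.2 hux).ne'] at hx
  exact lt_irrefl _ hx

lemma ae_eq_zero_of_lintegral_rpow_mul_eq_zero (hp : 0 < p) (hu : AEMeasurable u volume)
    (hu0 : ∀ᵐ x, 0 < u x) {m : Eu n → ℝ≥0∞} (hm : AEMeasurable m volume)
    (hzero : ∫⁻ x, m x ^ p * ENNReal.ofReal (u x) = 0) : ∀ᵐ x, m x = 0 := by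
  filter_upwards [(lintegral_eq_zero_iff' ((hm.pow_const p).mul hu.ennreal_ofReal)).1 hzero, hu0]
    with x hx hux
  simpa [hp, hux, hp.le, hp.not_gt, hux.not_ge] using hx

lemma eLpNorm_weightMeasure_le_iff {E F : Type*} [NormedAddCommGroup E] [NormedAddCommGroup F]
    (hp : 0 < p) (hu : AEMeasurable u volume) (hv : AEMeasurable v volume) {f : Eu n → E}
    {g : Eu n → F} :
    eLpNorm f (ENNReal.ofReal p) (weightMeasure u) ≤
        (C ^ (1 / p) : ℝ≥0) * eLpNorm g (ENNReal.ofReal p) (weightMeasure v) ↔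
      ∫⁻ x, ‖f x‖ₑ ^ p * ENNReal.ofReal (u x) ≤
        C * ∫⁻ x, ‖g x‖ₑ ^ p * ENNReal.ofReal (v x) := by
  have hC : ((C ^ (1 / p) : ℝ≥0) : ℝ≥0∞) ^ p = C := by
    rw [← ENNReal.coe_rpow_of_nonneg _ hp.le, ← NNReal.rpow_mul, one_div_mul_cancel hp.ne',
      NNReal.rpow_one]
  rw [← ENNReal.rpow_le_rpow_iff hp, ENNReal.mul_rpow_of_nonneg _ _ hp.le, hC,
    eLpNorm_weightMeasure_rpow hp hu, eLpNorm_weightMeasure_rpow hp hv]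

lemma exists_memLp_two_eLpNorm_sub_lt (hp : 0 < p) (hv : AEMeasurable v volume)
    (hf : MemWeightedLp p v f) {ε : ℝ≥0∞} (hε : ε ≠ 0) :
    ∃ g, MemLp g 2 volume ∧ MemWeightedLp p v g ∧
      eLpNorm (f - g) (ENNReal.ofReal p) (weightMeasure v) < ε := by
  obtain ⟨g, hg, hgv, hlt⟩ := hf.exists_memLp_two_lintegral_sub_lt hp hv
    (ε := ε ^ p) (by simp [hε, hp.not_gt])
  refine ⟨g, hg, hgv, (ENNReal.rpow_lt_rpow_iff hp).1 ?_⟩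
  rwa [eLpNorm_weightMeasure_rpow hp hv]

/-- `M` is bounded from `L^p(v)` to `L^p(u)` on `L² ∩ L^p(v)` with constant `C`, and is sublinear
and even there, so that `|M f - M g| ≤ M (f - g)`. -/
structure IsBoundedSublinear (M : (Eu n → ℂ) → Eu n → ℝ≥0∞) (p : ℝ) (u v : Eu n → ℝ) (C : ℝ≥0) :
    Prop where
  aemeasurable : ∀ f, MemLp f 2 volume → MemWeightedLp p v f → AEMeasurable (M f) volume
  lintegral_le : ∀ f, MemLp f 2 volume → MemWeightedLp p v f →
    ∫⁻ x, M f x ^ p * ENNReal.ofReal (u x) ≤ C * ∫⁻ x, ‖f x‖ₑ ^ p * ENNReal.ofReal (v x)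
  le_add_sub : ∀ f g, MemLp f 2 volume → MemLp g 2 volume → ∀ x, M f x ≤ M g x + M (f - g) x
  map_neg : ∀ f, MemLp f 2 volume → ∀ x, M (-f) x = M f x

namespace IsBoundedSublinear

lemma ae_ne_top (hM : IsBoundedSublinear M p u v C) (hp : 0 < p) (hu : AEMeasurable u volume)
    (hu0 : ∀ᵐ x, 0 < u x) (hf : MemLp f 2 volume) (hfv : MemWeightedLp p v f) :
    ∀ᵐ x, M f x ≠ ∞ :=
  ae_ne_top_of_lintegral_rpow_mul_lt_top hp hu hu0 (hM.aemeasurable f hf hfv)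
    ((hM.lintegral_le f hf hfv).trans_lt (ENNReal.mul_lt_top ENNReal.coe_lt_top hfv.2))

lemma ae_map_zero (hM : IsBoundedSublinear M p u v C) (hp : 0 < p) (hu : AEMeasurable u volume)
    (hu0 : ∀ᵐ x, 0 < u x) (h0 : MemWeightedLp p v 0) : ∀ᵐ x, M 0 x = 0 :=
  ae_eq_zero_of_lintegral_rpow_mul_eq_zero hp hu hu0 (hM.aemeasurable 0 MemLp.zero h0)
    (nonpos_iff_eq_zero.1 ((hM.lintegral_le 0 MemLp.zero h0).trans_eq (by simp [hp])))

lemma lintegral_toReal_sub_le (hM : IsBoundedSublinear M p u v C) (hp : 1 ≤ p)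
    (hu : AEMeasurable u volume) (hu0 : ∀ᵐ x, 0 < u x) (hv : AEMeasurable v volume)
    (hv0 : ∀ᵐ x, 0 < v x) (hf : MemLp f 2 volume) (hfv : MemWeightedLp p v f)
    (hg : MemLp g 2 volume) (hgv : MemWeightedLp p v g) :
    ∫⁻ x, ‖(M f x).toReal - (M g x).toReal‖ₑ ^ p * ENNReal.ofReal (u x) ≤
      C * ∫⁻ x, ‖f x - g x‖ₑ ^ p * ENNReal.ofReal (v x) := by
  have hp0 : 0 < p := by linarith
  refine (lintegral_mono_ae ?_).trans
    (hM.lintegral_le (f - g) (hf.sub hg) (hfv.sub hp hv hv0 hgv))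
  filter_upwards [hM.ae_ne_top hp0 hu hu0 hf hfv, hM.ae_ne_top hp0 hu hu0 hg hgv] with x hfx hgx
  gcongr
  refine enorm_toReal_sub_toReal_le hfx hgx (hM.le_add_sub f g hf hg x) ?_
  rw [← hM.map_neg (f - g) (hf.sub hg), neg_sub]
  exact hM.le_add_sub g f hg hf x

lemma memLp_toReal (hM : IsBoundedSublinear M p u v C) (hp : 0 < p)
    (hu : AEMeasurable u volume) (hf : MemLp f 2 volume) (hfv : MemWeightedLp p v f) :
    MemLp (fun x => (M f x).toReal) (ENNReal.ofReal p) (weightMeasure u) := by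
  refine ⟨(hM.aemeasurable f hf hfv).ennreal_toReal.aestronglyMeasurable.mono_ac
    (weightMeasure_absolutelyContinuous u), ?_⟩
  rw [← ENNReal.rpow_lt_top_iff_of_pos hp, eLpNorm_weightMeasure_rpow hp hu]
  refine lt_of_le_of_lt ((lintegral_mono fun x => ?_).trans (hM.lintegral_le f hf hfv))
    (ENNReal.mul_lt_top ENNReal.coe_lt_top hfv.2)
  gcongr
  rw [Real.enorm_of_nonneg ENNReal.toReal_nonneg]
  exact ENNReal.ofReal_toReal_le

lemma exists_real_extension (hM : IsBoundedSublinear M p u v C) (hp : 1 ≤ p)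
    (hu : AEMeasurable u volume) (hu0 : ∀ᵐ x, 0 < u x) (hv : AEMeasurable v volume)
    (hv0 : ∀ᵐ x, 0 < v x) :
    ∃ L : (Eu n → ℂ) → Eu n → ℝ,
      (∀ f, MemWeightedLp p v f → AEMeasurable (L f) volume) ∧
      (∀ f, MemLp f 2 volume → MemWeightedLp p v f → ∀ᵐ x, L f x = (M f x).toReal) ∧
      ∀ f g, MemWeightedLp p v f → MemWeightedLp p v g →
        ∫⁻ x, ‖L f x - L g x‖ₑ ^ p * ENNReal.ofReal (u x) ≤
          C * ∫⁻ x, ‖f x - g x‖ₑ ^ p * ENNReal.ofReal (v x) := by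
  have hp0 : 0 < p := by linarith
  have : Fact (1 ≤ ENNReal.ofReal p) := ⟨by simpa using hp⟩
  have hac := absolutelyContinuous_weightMeasure hu hu0
  have hmem (f : Eu n → ℂ) := memWeightedLp_iff_memLp (f := f) hp0 hv hv0
  have hdense (f : Eu n → ℂ) (hf : MemLp f (ENNReal.ofReal p) (weightMeasure v)) (ε : ℝ≥0∞)
      (hε : ε ≠ 0) : ∃ g ∈ {g | MemLp g 2 volume ∧ MemWeightedLp p v g},
        eLpNorm (f - g) (ENNReal.ofReal p) (weightMeasure v) < ε := by
    simpa only [Set.mem_ofPred_eq, and_assoc] using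
      exists_memLp_two_eLpNorm_sub_lt hp0 hv ((hmem f).2 hf) hε
  obtain ⟨L, hL, hLM, hLip⟩ := exists_extension_of_eLpNorm_sub_le (ν := weightMeasure u)
    (c := C ^ (1 / p)) (t := fun f x => (M f x).toReal) (fun f hf => (hmem f).1 hf.2) hdense
    (fun f hf => hM.memLp_toReal hp0 hu hf.1 hf.2) fun f hf g hg =>
      (eLpNorm_weightMeasure_le_iff hp0 hu hv).2
        (hM.lintegral_toReal_sub_le hp hu hu0 hv hv0 hf.1 hf.2 hg.1 hg.2)
  exact ⟨L, fun f hf => ((hL f ((hmem f).1 hf)).1.mono_ac hac).aemeasurable,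
    fun f hf hfv => hac.ae_le (hLM f ⟨hf, hfv⟩), fun f g hf hg =>
      (eLpNorm_weightMeasure_le_iff hp0 hu hv).1 (hLip f g ((hmem f).1 hf) ((hmem g).1 hg))⟩

theorem exists_extension (hM : IsBoundedSublinear M p u v C) (hp : 1 ≤ p)
    (hu : AEMeasurable u volume) (hu0 : ∀ᵐ x, 0 < u x) (hv : AEMeasurable v volume)
    (hv0 : ∀ᵐ x, 0 < v x) :
    ∃ S : (Eu n → ℂ) → Eu n → ℝ≥0,
      (∀ f, MemLp f 2 volume → MemWeightedLp p v f → ∀ᵐ x, M f x = (S f x : ℝ≥0∞)) ∧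
      (∀ f, MemWeightedLp p v f → AEMeasurable (S f) volume ∧
        ∫⁻ x, (S f x : ℝ≥0∞) ^ p * ENNReal.ofReal (u x) ≤
          C * ∫⁻ x, ‖f x‖ₑ ^ p * ENNReal.ofReal (v x)) ∧
      ∀ f g, MemWeightedLp p v f → MemWeightedLp p v g →
        ∫⁻ x, edist (S f x) (S g x) ^ p * ENNReal.ofReal (u x) ≤
          C * ∫⁻ x, ‖f x - g x‖ₑ ^ p * ENNReal.ofReal (v x) := by
  have hp0 : 0 < p := by linarith
  have h0 : MemWeightedLp p v 0 := ⟨aestronglyMeasurable_zero, by simp [hp0]⟩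
  obtain ⟨L, hL, hLM, hLip⟩ := hM.exists_real_extension hp hu hu0 hv hv0
  have hL0 : ∀ᵐ x, L 0 x = 0 := by
    filter_upwards [hLM 0 MemLp.zero h0, hM.ae_map_zero hp0 hu hu0 h0] with x hx hx0
    rw [hx, hx0, ENNReal.toReal_zero]
  refine ⟨fun f x => (L f x).toNNReal, fun f hf hfv => ?_,
    fun f hf => ⟨(hL f hf).real_toNNReal, ?_⟩, fun f g hf hg => ?_⟩
  · filter_upwards [hLM f hf hfv, hM.ae_ne_top hp0 hu hu0 hf hfv] with x hx hfin
    rw [hx]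
    exact (ENNReal.ofReal_toReal hfin).symm
  · refine (lintegral_mono_ae ?_).trans ((hLip f 0 hf h0).trans_eq (by simp))
    filter_upwards [hL0] with x hx
    gcongr
    rw [hx, sub_zero]
    exact Real.ofReal_le_enorm _
  · refine (lintegral_mono fun x => ?_).trans (hLip f g hf hg)
    gcongr
    exact edist_toNNReal_le _ _

end IsBoundedSublinear

end SublinearExtension

end MaxModCZ

end

open MaxModCZ in
theorem theorem7p1_general {n : ℕ} (hn : 0 < n) {ι : Type*} {T : (Eu n → ℂ) → Eu n → ℂ}
    {K : Eu n → Eu n → ℂ} (hT : IsRepresentedBy T K) (hK : IsCZKernel K) {φ : ι → Eu n → ℝ}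
    (hφ : ∀ α, Measurable (φ α)) {r : ℝ} {c : ℝ≥0} (hr : 1 ≤ r) (hwt : HasWeakType T φ r c)
    {p p' : ℝ} (hpp : p.HolderConjugate p') {A B : ℝ≥0 → ℝ≥0} (hA : Monotone A) (hB : Monotone B)
    (hAt : Filter.Tendsto A Filter.atTop Filter.atTop)
    (hBt : Filter.Tendsto B Filter.atTop Filter.atTop)
    (hAp : SatisfiesB p' (complementary A)) (hBp : SatisfiesB (p / r) (complementary B))
    {u v : Eu n → ℝ} (hu : AEMeasurable u volume) (hv : AEMeasurable v volume)
    (hu0 : ∀ᵐ x, 0 < u x) (hv0 : ∀ᵐ x, 0 < v x) (huv : bump p r A B u v ≠ ∞) :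
    ∃ C : ℝ≥0,
      (∀ f : Eu n → ℂ, MemLp f 2 volume →
        ∫⁻ x, maxMod T φ f x ^ p * ENNReal.ofReal (u x) ≤
          C * ∫⁻ x, ‖f x‖ₑ ^ p * ENNReal.ofReal (v x)) ∧
      ∃ S : (Eu n → ℂ) → Eu n → ℝ≥0,
        (∀ f, MemLp f 2 volume → MemWeightedLp p v f →
          ∀ᵐ x, maxMod T φ f x = (S f x : ℝ≥0∞)) ∧
        (∀ f, MemWeightedLp p v f → AEMeasurable (S f) volume ∧
          ∫⁻ x, (S f x : ℝ≥0∞) ^ p * ENNReal.ofReal (u x) ≤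
            C * ∫⁻ x, ‖f x‖ₑ ^ p * ENNReal.ofReal (v x)) ∧
        ∀ f g, MemWeightedLp p v f → MemWeightedLp p v g →
          ∫⁻ x, edist (S f x) (S g x) ^ p * ENNReal.ofReal (u x) ≤
            C * ∫⁻ x, ‖f x - g x‖ₑ ^ p * ENNReal.ofReal (v x) := by
  obtain ⟨C, hC0, hC⟩ := exists_lintegral_maxMod_rpow_le hn hT hK hφ hr hwt hpp hA hB hAt hBt
    hAp hBp hu hv hu0 hv0 huv
  have hM : IsBoundedSublinear (maxMod T φ) p u v C :=
    { aemeasurable := fun f hf hfv => (hC f hf hfv).1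
      lintegral_le := fun f hf hfv => (hC f hf hfv).2
      le_add_sub := fun f g hf hg x => maxMod_le_add_sub hT hφ hf hg x
      map_neg := fun f hf x => maxMod_neg hT hφ hf x }
  refine ⟨C, fun f hf => ?_, hM.exists_extension hpp.lt.le hu hu0 hv hv0⟩
  rcases eq_or_ne (∫⁻ x, ‖f x‖ₑ ^ p * ENNReal.ofReal (v x)) ∞ with htop | hfin
  · rw [htop, ENNReal.mul_top (by exact_mod_cast hC0.ne')]
    exact le_top
  · exact hM.lintegral_le f hf ⟨hf.1, hfin.lt_top⟩

/-- Two-weight inequality `T^Φ : L^p(v) → L^p(u)`: the inequality for `f ∈ L²`, where `T^Φ f` is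
given by its defining supremum, together with the (necessarily unique) continuous extension
of `T^Φ` from `L² ∩ L^p(v)` to all of `L^p(v)`, with the same bound. -/
theorem theorem7p1 {n : ℕ} (hn : 0 < n) {ι : Type*}
    (T : (MaxModCZ.Eu n → ℂ) → MaxModCZ.Eu n → ℂ) (hT : MaxModCZ.IsCZOperator T)
    (φ : ι → MaxModCZ.Eu n → ℝ) (hφ : ∀ α, Measurable (φ α))
    (r₀ : ℝ) (hr₀ : 1 < r₀) (ψ : ℝ → ℝ≥0) (hwt : MaxModCZ.WeakTypeBounds T φ r₀ ψ)
    (p : ℝ) (hp : 1 < p)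
    (A B : ℝ≥0 → ℝ≥0) (hA : MaxModCZ.IsYoung A) (hB : MaxModCZ.IsYoung B)
    (hA2 : MaxModCZ.IsDoubling A) (hB2 : MaxModCZ.IsDoubling B)
    (r : ℝ) (hr : 1 < r) (hr' : r < min r₀ p)
    (hAp : MaxModCZ.SatisfiesB (p / (p - 1)) (MaxModCZ.complementary A))
    (hBp : MaxModCZ.SatisfiesB (p / r) (MaxModCZ.complementary B))
    (u v : MaxModCZ.Eu n → ℝ) (hu : MaxModCZ.IsPosWeight u) (hv : MaxModCZ.IsPosWeight v)
    (huv : MaxModCZ.bump p r A B u v < ∞) :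
    ∃ C : ℝ≥0,
      (∀ f : MaxModCZ.Eu n → ℂ, MemLp f 2 volume →
        ∫⁻ x, MaxModCZ.maxMod T φ f x ^ p * ENNReal.ofReal (u x) ≤
          C * ∫⁻ x, ‖f x‖ₑ ^ p * ENNReal.ofReal (v x)) ∧
      ∃ S : (MaxModCZ.Eu n → ℂ) → MaxModCZ.Eu n → ℝ≥0,
        (∀ f, MemLp f 2 volume → MaxModCZ.MemWeightedLp p v f →
          ∀ᵐ x, MaxModCZ.maxMod T φ f x = (S f x : ℝ≥0∞)) ∧
        (∀ f, MaxModCZ.MemWeightedLp p v f →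
          AEMeasurable (S f) volume ∧
          ∫⁻ x, (S f x : ℝ≥0∞) ^ p * ENNReal.ofReal (u x) ≤
            C * ∫⁻ x, ‖f x‖ₑ ^ p * ENNReal.ofReal (v x)) ∧
        (∀ f g, MaxModCZ.MemWeightedLp p v f → MaxModCZ.MemWeightedLp p v g →
          ∫⁻ x, edist (S f x) (S g x) ^ p * ENNReal.ofReal (u x) ≤
            C * ∫⁻ x, ‖f x - g x‖ₑ ^ p * ENNReal.ofReal (v x)) := by
  obtain ⟨K, hK, hTK⟩ := hT.kernel
  have hwr : MaxModCZ.HasWeakType T φ r (ψ r) := hwt r hr (hr'.trans_le (min_le_left _ _)).le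
  exact theorem7p1_general hn ⟨hT.map_add, hT.map_smul, hTK⟩ hK hφ hr.le hwr
    (.conjExponent hp) hA.monotone hB.monotone hA.tendsto_atTop hB.tendsto_atTop hAp hBp
    hu.locallyIntegrable.aestronglyMeasurable.aemeasurable
    hv.locallyIntegrable.aestronglyMeasurable.aemeasurable hu.pos hv.pos huv.ne
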